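/- Let $q$ be a prime power, $n,m,\ell\ge 1$ integers with $\ell\mid n$, $\mu:=\min\{n/\ell,m\}$, and let $\zeta\ge\mu$, $0\le t\le\ell\mu$ and $t\le s\le\ell\zeta$ be integers. For $a,b\ge 0$ let $\binom{a}{b}_q$ be the number of $b$-dimensional subspaces of $\mathbb F_q^a$. Let $\mathcal T_{t,\ell,\mu}$ be the set of all $\mathbf t\in\{0,\dots,\mu\}^\ell$ with $\sum_i t_i=t$, let $\mathcal T^{\mathrm{ord}}_{t,\ell,\mu}$ be the subset of the non-increasing vectors, and let $\delta_i(\mathbf t):=|\{j: t_j=i\}|$. For a vector $\mathbf t$ with entries at most $\zeta$ and sum at most $s$, let $\mathrm{scomp}_\zeta(\mathbf t,s)$ be the outcome of the following randomized procedure: start with $\mathbf s:=\mathbf t$; as long as $\sum_i s_i<s$, choose, among the positions $i$ with $s_i\ne\zeta$, those with maximal $t_i$, among these those with minimal $s_i$, and increase $s_i$ by one at a randomly chosen one of them. Put $$Q_{t,\ell,\mu}:=\sum_{\mathbf t\in\mathcal T_{t,\ell,\mu}}\ \prod_{i=1}^{\ell}\frac{\binom{\zeta}{t_i}_q}{\binom{\mathrm{scomp}_\zeta(\mathbf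 t,s)_i}{t_i}_q}$$ and, for integers $t',\ell',\mu',s'\ge 0$, $$\mathsf M(t',\ell',\mu',s'):=\sum_{\mathbf t\in\mathcal T^{\mathrm{ord}}_{t',\ell',\mu'}}\Big(\prod_{i=0}^{\mu'}\delta_i(\mathbf t)!\Big)^{-1}\prod_{i=1}^{\ell'}\frac{\binom{\zeta}{t_i}_q}{\binom{\mathrm{scomp}_\zeta(\mathbf t,s')_i}{t_i}_q}$$ if $\ell'\ge1$, $t'\le\min\{s',\ell'\mu'\}$ and $s'\le\ell'\zeta$; $\mathsf M(0,0,\mu',0):=1$; and $\mathsf M(t',\ell',\mu',s'):=0$ in all other cases. Consider the following memoized recursion. A table indexed by $t'\le t$, $\ell'\le\ell$, $\mu'\le\mu$, $s'\le s$ is initialized with the mark "not computed". A call with $(t',\ell',\mu',s')$ returns the table entry if it has been computed. Otherwise it computes the entry as $1$ if $\ell'=t'=s'=0$; as $$\sum_{t_1=\lceil t'/\ell'\rceil}^{\min\{\mu',t'\}}\ \sum_{\substack{\max\{t'-\ell'(t_1-1),1\}\le\delta\le\ell'\\ t_1\delta\le t'}}\frac1{\delta!}\prod_{i=1}^{\delta}\frac{\binom{\zeta}{t_1}_q}{\binom{s^{(1)}_i}{t_1}_q}\cdot\mathsf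 M\big(t'-\delta t_1,\ \ell'-\delta,\ \max\{t_1-1,0\},\ s'-S\big),$$ with $S=\min\{s'-(t'-\delta t_1),\delta\zeta\}$, $\mathbf s^{(1)}=\mathrm{scomp}_\zeta((t_1,\dots,t_1),S)$ (the vector has length $\delta$) and recursive calls for the values of $\mathsf M$, if $\ell'\ge1$, $t'\le\min\{s',\ell'\mu'\}$ and $s'\le\ell'\zeta$; and as $0$ otherwise; it stores and returns the entry. The coefficients $\frac1{\delta!}\prod_i\binom{\zeta}{t_1}_q/\binom{s^{(1)}_i}{t_1}_q$ are precomputed. All rational numbers are held exactly, as integer numerators over known common denominators. Then, for all outcomes of the random choices, the call with $(t,\ell,\mu,s)$ returns $\mathsf M(t,\ell,\mu,s)$, and $Q_{t,\ell,\mu}=\ell!\cdot\mathsf M(t,\ell,\mu,s)$, so that multiplication by $\ell!$ yields $Q_{t,\ell,\mu}$. Moreover, if $t\ge1$, the whole computation of $\mathsf M(t,\ell,\mu,s)$ and $Q_{t,\ell,\mu}$, including all precomputations and the initialization of the table, takes $$\tilde O\big(t\,s\,n^3\,\mu\,\zeta^2\log_2 q\big)$$ bit operations: integer arithmetic can be implemented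 by bit operations (binary Boolean gates) in such a way that, with absolute constants $C$ and $k$, the number of bit operations, including those for index arithmetic and for moving data, is at most $C\,N\,(\log(N+2))^k$, where $N=t\,s\,n^3\mu\,\zeta^2\log_2 q$. -/

import Mathlib

namespace SumRank

/-! ### Bit operations -/

/-- `StraightLine I k W`: starting from the Boolean quantities in `I` (functions of the unknown
input `x : X`), a straight-line program of `k` bit operations makes all quantities in `W`
available.  One bit operation applies an arbitrary binary Boolean gate to two available bits. -/
inductive StraightLine {X : Type} (I : Set (X → Bool)) : ℕ → Set (X → Bool) → Prop
  | start : StraightLine I 0 I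
  | gate {k : ℕ} {W : Set (X → Bool)} {u v : X → Bool} (g : Bool → Bool → Bool) :
      StraightLine I k W → u ∈ W → v ∈ W →
        StraightLine I (k + 1) (insert (fun x => g (u x) (v x)) W)

/-- Pairs consisting of an `a`-bit and a `b`-bit natural number. -/
abbrev Operands (a b : ℕ) : Type := {x : ℕ // x < 2 ^ a} × {y : ℕ // y < 2 ^ b}

/-- The bits of the two operands. -/
def operandBits (a b : ℕ) : Set (Operands a b → Bool) :=
  {w | ∃ i : ℕ, (w = fun p => p.1.1.testBit i) ∨ (w = fun p => p.2.1.testBit i)}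

/-- One and the same straight-line program of `k` bit operations computes all bits of `f x y`
from the bits of `x` and `y`, for all `a`-bit numbers `x` and all `b`-bit numbers `y`. -/
def ComputableWith (f : ℕ → ℕ → ℕ) (a b k : ℕ) : Prop :=
  ∃ W, StraightLine (operandBits a b) k W ∧
    ∀ i : ℕ, (fun p : Operands a b => (f p.1.1 p.2.1).testBit i) ∈ W

/-- The integer operations used by the algorithms below. -/
inductive Arith
  | add | sub | mul | le | eq

/-- Meaning of the integer operations; subtraction is truncated at `0`, comparisons return one
bit. -/
def Arith.eval : Arith → ℕ → ℕ → ℕ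
  | .add, x, y => x + y
  | .sub, x, y => x - y
  | .mul, x, y => x * y
  | .le, x, y => if x ≤ y then 1 else 0
  | .eq, x, y => if x = y then 1 else 0

/-- An implementation of integer arithmetic by bit operations: `gates o a b` bit operations carry
out the operation `o` on an `a`-bit and a `b`-bit operand. -/
structure BitArithmetic where
  gates : Arith → ℕ → ℕ → ℕ
  computes : ∀ (o : Arith) (a b : ℕ), ComputableWith o.eval a b (gates o a b)

/-- The elementary steps of a computation: an integer operation on operands of bit lengths
`a` and `b`, or moving `k` bits (memory addresses, memory contents, random bits). -/
inductive BitStep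
  | arith (o : Arith) (a b : ℕ)
  | move (k : ℕ)

/-- Number of bit operations of a step: the gates of the integer operation, plus one for every
bit that is read or moved, plus one. -/
def BitStep.cost (A : BitArithmetic) : BitStep → ℕ
  | .arith o a b => A.gates o a b + a + b + 1
  | .move k => k + 1

/-- The result of a computation, together with the list of the elementary steps executed. -/
def Run (α : Type) : Type := α × List BitStep

instance : Monad Run where
  pure a := (a, [])
  bind x f := ((f x.1).1, x.2 ++ (f x.1).2)

/-- The result of a computation. -/
def Run.val {α : Type} (r : Run α) : α := r.1

/-- The number of bit operations of a computation. -/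
def Run.bitOps {α : Type} (A : BitArithmetic) (r : Run α) : ℕ := (r.2.map (BitStep.cost A)).sum

/-- Execute an integer operation. -/
def op (o : Arith) (x y : ℕ) : Run ℕ := (o.eval x y, [.arith o x.size y.size])

/-- Move `k` bits. -/
def move (k : ℕ) : Run Unit := ((), [.move k])

def minimum (x y : ℕ) : Run ℕ := do
  if (← op .le x y) = 1 then pure x else pure y

def maximum (x y : ℕ) : Run ℕ := do
  if (← op .le x y) = 1 then pure y else pure x

/-- Names of the tables that the algorithms keep in memory. -/
inductive Tab
  | pow | gauss | factor | low | high | cof | choose | coeff | M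
  deriving DecidableEq

/-- Random access memory: every table maps an index to a natural number or to "not yet set". -/
abbrev Mem : Type := Tab → List ℕ → Option ℕ

/-- Computations with access to the memory. -/
abbrev Alg (α : Type) : Type := StateT Mem Run α

/-- Number of bits of a table index. -/
def indexBits (idx : List ℕ) : ℕ := (idx.map fun i => i.size + 1).sum

/-- Number of bits of a table entry. -/
def contentBits : Option ℕ → ℕ
  | none => 1
  | some v => v.size + 1

def load (T : Tab) (idx : List ℕ) : Alg (Option ℕ) := do
  let mem ← get
  move (indexBits idx + contentBits (mem T idx))
  pure (mem T idx)

def store (T : Tab) (idx : List ℕ) (v : Option ℕ) : Alg Unit := do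
  move (indexBits idx + contentBits v)
  modify fun mem T₁ idx₁ => if T₁ = T ∧ idx₁ = idx then v else mem T₁ idx₁

/-- The content of a table entry that has been set before. -/
def fetch (T : Tab) (idx : List ℕ) : Alg ℕ := do
  pure ((← load T idx).getD 0)

/-- `loopFrom hi body k i x`: the remaining `k` iterations of a loop, starting with index `i`. -/
def loopFrom {α : Type} (hi : ℕ) (body : ℕ → α → Alg α) : ℕ → ℕ → α → Alg α
  | 0, i, x => do
      let _ ← op .le i hi
      pure x
  | k + 1, i, x => do
      let _ ← op .le i hi
      let y ← body i x
      let j ← op .add i 1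
      loopFrom hi body k j y

/-- `for i = lo, …, hi do x ← body i x`; increments and tests of the loop index are steps. -/
def loop {α : Type} (lo hi : ℕ) (x : α) (body : ℕ → α → Alg α) : Alg α :=
  loopFrom hi body (hi + 1 - lo) lo x

/-! ### The completion `scomp` of a weight decomposition -/

/-- Arbitrary outcomes of the random choices made by `scomp`; the choice may depend on the input
vector, on the current vector and on the number of increments still to be done. -/
abbrev Coins : Type := (l : ℕ) → (Fin l → ℕ) → (Fin l → ℕ) → ℕ → ℕ

/-- The positions `i` in the list `J` with `v i = x` (if `b = 1`) or `v i ≠ x` (if `b = 0`). -/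
def select {l : ℕ} (b : ℕ) (v : Fin l → ℕ) (x : ℕ) : List (Fin l) → Run (List (Fin l))
  | [] => pure []
  | i :: J => do
      move (i.1.size + (v i).size)
      let c ← op .eq (v i) x
      let K ← select b v x J
      if c = b then pure (i :: K) else pure K

/-- `max` or `min` (the parameter `better`) of the values `v i` over the positions in a list. -/
def extremum {l : ℕ} (better : ℕ → ℕ → Run ℕ) (v : Fin l → ℕ) : List (Fin l) → Run ℕ
  | [] => pure 0
  | i :: J => J.foldlM (init := v i) fun x j => do
      move (j.1.size + (v j).size)
      better x (v j)

/-- The `while` loop of `scomp`: `d` further unit increments of the vector `v`.  Among the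
positions with `v i ≠ ζ`, take those with maximal `t i`, among these those with minimal `v i`,
and increment the entry at one of them, chosen at random. -/
def raise (χ : Coins) (ζ : ℕ) {l : ℕ} (t : Fin l → ℕ) : ℕ → (Fin l → ℕ) → Run (Fin l → ℕ)
  | 0, v => pure v
  | d + 1, v => do
      let J₁ ← select 0 v ζ (List.finRange l)
      let a ← extremum maximum t J₁
      let J₂ ← select 1 t a J₁
      let b ← extremum minimum v J₂
      let J₃ ← select 1 v b J₂
      match J₃ with
      | [] => pure v
      | j :: J => do
          move (J.length + 1)
          let h := (j :: J).get ⟨χ l t v (d + 1) % (J.length + 1), Nat.mod_lt _ (Nat.succ_pos _)⟩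
          let x ← op .add (v h) 1
          let _ ← op .sub (d + 1) 1
          raise χ ζ t d (Function.update v h x)

/-- `scomp χ ζ t s`: complete the vector `t` to a vector with entries at most `ζ` and sum `s`. -/
def scomp (χ : Coins) (ζ : ℕ) {l : ℕ} (t : Fin l → ℕ) (s : ℕ) : Run (Fin l → ℕ) := do
  let T ← (List.finRange l).foldlM (init := 0) fun x i => op .add x (t i)
  let d ← op .sub s T
  raise χ ζ t d t

/-! ### The quantities to be computed -/

/-- Gaussian binomial coefficient: the number of `b`-dimensional subspaces of `F ^ a`. -/
noncomputable def gaussBinom (F : Type) [Field F] (a b : ℕ) : ℕ :=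
  Nat.card {W : Submodule F (Fin a → F) // Module.finrank F W = b}

/-- Weight decompositions: vectors in `{0, …, μ} ^ l` with sum `t`. -/
def weightDecomps (t l μ : ℕ) : Finset (Fin l → ℕ) :=
  (Fintype.piFinset fun _ => Finset.range (μ + 1)).filter fun v => ∑ i, v i = t

/-- Non-increasing weight decompositions. -/
noncomputable def ordWeightDecomps (t l μ : ℕ) : Finset (Fin l → ℕ) :=
  open Classical in (weightDecomps t l μ).filter fun v => Antitone v

/-- The probability `ϱ(s, t)` that a random subspace tuple of dimensions `s i` of `F ^ ζ` contains
a given one of dimensions `t i`. -/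
noncomputable def rho (F : Type) [Field F] (ζ : ℕ) {l : ℕ} (s t : Fin l → ℕ) : ℚ :=
  ∏ i, (gaussBinom F (s i) (t i) : ℚ) / (gaussBinom F ζ (t i) : ℚ)

/-- `Q_{t,l,μ}`: the sum of `ϱ(scomp(t, s), t)⁻¹` over all weight decompositions `t`. -/
noncomputable def Q (F : Type) [Field F] (χ : Coins) (ζ s t l μ : ℕ) : ℚ :=
  ∑ v ∈ weightDecomps t l μ, (rho F ζ (scomp χ ζ v s).val v)⁻¹

/-- Number of occurrences of the value `i` in `v`. -/
def occurrences {l : ℕ} (v : Fin l → ℕ) (i : ℕ) : ℕ :=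
  (Finset.univ.filter fun j => v j = i).card

/-- `M(t, l, μ, s)`, the quantity tabulated by the algorithm. -/
noncomputable def M (F : Type) [Field F] (χ : Coins) (ζ t l μ s : ℕ) : ℚ :=
  if 1 ≤ l ∧ t ≤ min s (l * μ) ∧ s ≤ l * ζ then
    ∑ v ∈ ordWeightDecomps t l μ,
      (∏ i ∈ Finset.range (μ + 1), ((occurrences v i).factorial : ℚ))⁻¹ *
        ∏ i, (gaussBinom F ζ (v i) : ℚ) / (gaussBinom F ((scomp χ ζ v s).val i) (v i) : ℚ)
  else if l = 0 ∧ t = 0 ∧ s = 0 then 1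
  else 0

/-! ### The algorithm

With `A = min ζ s` and `R = (q ^ 1 - 1) ⋯ (q ^ A - 1)`, a rational number in
`(l! * R ^ l)⁻¹ ℤ` is held through its numerator with respect to the denominator `l! * R ^ l`.
The table entries `M(t', l', μ', s')` are of this form for `l = l'`, and the coefficient of the
recursion, `(1 / δ!) * ∏_{i ≤ δ} [ζ, t₁] / [s_i, t₁]`, is of this form for `l = δ`.  The product of
numbers with numerators `x` and `y` for `l - δ` and `δ` has the numerator `x * y * (l choose δ)`
for `l`. -/

/-- Powers `q ^ b` and Gaussian binomials `[a, b]` for `a ≤ ζ`, `b ≤ μ`. -/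
def fillGauss (q ζ μ : ℕ) : Alg Unit := do
  let _ ← loop 0 μ 1 fun b p => do
    store .pow [b] (some p)
    op .mul p q
  loop 0 ζ () fun a _ => loop 0 μ () fun b _ => do
    if (← op .eq b 0) = 1 then
      store .gauss [a, b] (some 1)
    else if (← op .eq a 0) = 1 then
      store .gauss [a, b] (some 0)
    else
      let a₁ ← op .sub a 1
      let b₁ ← op .sub b 1
      let x ← fetch .gauss [a₁, b₁]
      let y ← fetch .gauss [a₁, b]
      let p ← fetch .pow [b]
      let z ← op .mul p y
      let w ← op .add x z
      store .gauss [a, b] (some w)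

/-- The products `low[k] = (q ^ 1 - 1) ⋯ (q ^ k - 1)` and `high[k] = (q ^ (k + 1) - 1) ⋯ (q ^ A - 1)`
for `k ≤ A`, and `cof[a, b] = R / [a, b]` for `b ≤ min B a` and `a ≤ A`. -/
def fillCof (q A B : ℕ) : Alg Unit := do
  let _ ← loop 0 A (1, 1) fun k (p, x) => do
    store .low [k] (some x)
    let r ← op .mul p q
    let f ← op .sub r 1
    let k₁ ← op .add k 1
    store .factor [k₁] (some f)
    let y ← op .mul x f
    pure (r, y)
  let _ ← loop 0 A 1 fun i x => do
    let k ← op .sub A i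
    store .high [k] (some x)
    let f ← fetch .factor [k]
    op .mul x f
  loop 0 A () fun a _ => do
    let top ← minimum B a
    loop 0 top () fun b _ => do
      let c ← op .sub a b
      let x ← fetch .low [b]
      let y ← fetch .low [c]
      let z ← fetch .high [a]
      let w ← op .mul x y
      let u ← op .mul w z
      store .cof [a, b] (some u)

/-- Binomial coefficients `i choose j` for `i, j ≤ l`. -/
def fillChoose (l : ℕ) : Alg Unit :=
  loop 0 l () fun i _ => loop 0 l () fun j _ => do
    if (← op .eq j 0) = 1 then
      store .choose [i, j] (some 1)
    else if (← op .eq i 0) = 1 then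
      store .choose [i, j] (some 0)
    else
      let i₁ ← op .sub i 1
      let j₁ ← op .sub j 1
      let x ← fetch .choose [i₁, j₁]
      let y ← fetch .choose [i₁, j]
      let z ← op .add x y
      store .choose [i, j] (some z)

/-- For all `1 ≤ δ ≤ l`, `t₁ ≤ B` and `S ≤ s` with `t₁ * δ ≤ S ≤ ζ * δ`, the coefficient
`(1 / δ!) * [ζ, t₁] ^ δ * ∏_{i ≤ δ} [s_i, t₁]⁻¹`, where `(s_i)` is the output of `scomp` on the
constant vector `(t₁, …, t₁)` of length `δ` and on `S`. -/
def fillCoeff (χ : Coins) (ζ B l s : ℕ) : Alg Unit :=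
  loop 1 l () fun δ _ => loop 0 B () fun t₁ _ => loop 0 s () fun S _ => do
    let u ← op .mul t₁ δ
    let z ← op .mul ζ δ
    let c ← op .le u S
    let d ← op .le S z
    if c = 1 ∧ d = 1 then
      let v ← scomp χ ζ (fun _ : Fin δ => t₁) S
      let g ← fetch .gauss [ζ, t₁]
      let x ← (List.finRange δ).foldlM (init := 1) fun x i => do
        let f ← fetch .cof [v i, t₁]
        let y ← op .mul x g
        op .mul y f
      store .coeff [δ, t₁, S] (some x)
    else
      pure ()

/-- Mark all entries of the table `M` as not yet computed. -/
def clearM (t l μ s : ℕ) : Alg Unit :=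
  loop 0 t () fun t' _ => loop 0 l () fun l' _ => loop 0 μ () fun μ' _ => loop 0 s () fun s' _ =>
    store .M [t', l', μ', s'] none

/-- The memoized recursion `fillM ζ fuel t l μ s` for `M(t, l, μ, s)`.  The recursion depth is at
most `l + 1`, since `l` decreases in every recursive call; `fuel` is a bound on it.  The index `t₁`
runs over `⌈t / l⌉ ≤ t₁ ≤ min μ t`, and `δ` over
`max (t - l * (t₁ - 1)) 1 ≤ δ ≤ l` with `t₁ * δ ≤ t`.  (For `t₁ = 0` this leaves `t = 0` and
`δ = l`, and the third index of the recursive call, which then is about the empty vector, is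
immaterial.) -/
def fillM (ζ : ℕ) : ℕ → ℕ → ℕ → ℕ → ℕ → Alg ℕ
  | 0, _, _, _, _ => pure 0
  | fuel + 1, t, l, μ, s => do
    match (← load .M [t, l, μ, s]) with
    | some res => pure res
    | none => do
      let sum₁ ← op .add t l
      let sum₂ ← op .add sum₁ s
      let e ← op .eq sum₂ 0
      let lμ ← op .mul l μ
      let cap ← minimum s lμ
      let lζ ← op .mul l ζ
      let c₁ ← op .le 1 l
      let c₂ ← op .le t cap
      let c₃ ← op .le s lζ
      let res ←
        if e = 1 then
          pure 1
        else if c₁ = 1 ∧ c₂ = 1 ∧ c₃ = 1 then do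
          let top ← minimum μ t
          loop 0 top 0 fun t₁ acc => do
            let lt₁ ← op .mul l t₁
            if (← op .le t lt₁) = 1 then
              let tl ← op .add t l
              let diff ← op .sub tl lt₁
              let lo ← maximum diff 1
              loop lo l acc fun δ acc => do
                let u ← op .mul t₁ δ
                if (← op .le u t) = 1 then
                  let t₂ ← op .sub t u
                  let l₂ ← op .sub l δ
                  let μ₂ ← op .sub t₁ 1
                  let rest ← op .sub s t₂
                  let full ← op .mul δ ζ
                  let S ← minimum rest full
                  let s₂ ← op .sub s S
                  let x ← fillM ζ fuel t₂ l₂ μ₂ s₂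
                  let y ← fetch .coeff [δ, t₁, S]
                  let b ← fetch .choose [l, δ]
                  let xy ← op .mul x y
                  let z ← op .mul xy b
                  op .add acc z
                else
                  pure acc
            else
              pure acc
        else
          pure 0
      store .M [t, l, μ, s] (some res)
      pure res

/-- Output: numerators of `M` and of `Q` over a common denominator. -/
structure Output where
  numM : ℕ
  numQ : ℕ
  den : ℕ

/-- The whole computation: the auxiliary tables, the initialization of the table `M`, the memoized
recursion, and the passage from `M(t, l, μ, s)` to `Q = l! * M(t, l, μ, s)`. -/
def computeAlg (χ : Coins) (q ζ t l μ s : ℕ) : Alg Output := do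
  let A ← minimum ζ s
  let B ← minimum μ t
  fillGauss q ζ μ
  fillCof q A B
  fillChoose l
  fillCoeff χ ζ B l s
  clearM t l μ s
  let x ← fillM ζ (l + 1) t l μ s
  let R ← fetch .low [A]
  let D ← loop 1 l 1 fun _ y => op .mul y R
  let fact ← loop 1 l 1 fun i y => op .mul y i
  let y ← op .mul fact x
  let E ← op .mul fact D
  pure ⟨x, y, E⟩

/-- The computation, started on an empty memory. -/
def compute (χ : Coins) (q ζ t l μ s : ℕ) : Run Output := do
  let r ← (computeAlg χ q ζ t l μ s).run fun _ _ => none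
  pure r.1

end SumRank

/-! Correctness. The output of `scomp` depends on the coins, but it always satisfies `IsCompletion`:
it dominates v, is capped by ζ, has sum s, raises a position only if all positions with larger v are
full, and is balanced among positions with equal v. Look at the δ positions where v attains its
maximum t₁. Their total after completion is forced (`topSum`), balance then forces the multiset of
their values (`balancedProd`), and the other positions form a completion of the rest of v with the
remaining sum. By induction a product ∏ h(v_i, w_i) depends neither on the coins
(`IsCompletion.prod_unique`) nor on the order of the entries. Summing over all v, the choice of the
δ positions contributes l choose δ, which gives the recursion `vecSum` (`sum_vecs_eq_vecSum`). Every
non-increasing vector has l!/∏ δ_i! rearrangements, whence Q = l!·M.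

Rational numbers are avoided as follows. With R = (q-1)⋯(q^A-1) and A = min ζ s, every Gaussian
binomial [w, v] with v ≤ w ≤ A divides R. So [ζ, v]/[w, v] has the integer numerator `ratioNum` over
R, and for this h the number `vecSum` equals l!·R^l·M = R^l·Q.

Cost. Programs are treated in a small program logic (`RSpec`, `ASpec`) which proves result and cost
together. For the memoized recursion the potential is proportional to the number of unset table
entries: setting an entry pays for its double loop over t₁ and δ, so a recursive call costs, net,
one table access. In all there are about t·l·μ·s entries, each with about μ·l operations on numbers
of O(l·ζ²·log q) bits, up to logarithmic factors. As l·μ ≤ n, this is at most t·s·n³·μ·ζ²·log q. The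
precomputations are cheaper, provided that work on indices is charged with the short length of the
indices.

Arithmetic. What remains is a quasi-linear circuit for integer multiplication. The bits of a factor
are taken as coefficients of a polynomial, and products modulo z^N + 1 are computed recursively:
with N = m·r, x = z and y = z^m, one has bivariate polynomials of degree below m in x over
polynomials modulo y^r + 1. There y is a root of unity of order dividing 2r, so a fast Fourier
transform in x needs only additions and shifts (`exists_cyclic_mul`) and reduces the task to 2m
products modulo y^r + 1 with r about √N. Nothing is ever divided by 2; the accumulated power of 2 is
removed at the end by dropping low bits (`computes_nat_mul`). -/

namespace SumRank

/-! ### Straight-line programs over an arbitrary set of binary operations -/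

section Computes

variable {α β : Type*}

/-- `Computes ops W k V`: starting from the quantities in `W`, at most `k` applications of
operations in `ops` make all quantities in `V` available. -/
inductive Computes (ops : Set (α → α → α)) : Set α → ℕ → Set α → Prop
  | of_subset {W V : Set α} {k : ℕ} : V ⊆ W → Computes ops W k V
  | gate {W V : Set α} {k : ℕ} {f : α → α → α} {u v : α} :
      f ∈ ops → u ∈ W → v ∈ W → Computes ops (insert (f u v) W) k V → Computes ops W (k + 1) V

variable {ops : Set (α → α → α)} {W W' V V' : Set α} {k k' : ℕ}

theorem Computes.mono (h : Computes ops W k V) (hW : W ⊆ W') (hV : V' ⊆ V) (hk : k ≤ k') :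
    Computes ops W' k' V' := by
  induction h generalizing W' k' with
  | of_subset h => exact .of_subset (hV.trans (h.trans hW))
  | gate hf hu hv _ ih =>
    obtain ⟨k', rfl⟩ : ∃ j, k' = j + 1 := ⟨k' - 1, by omega⟩
    exact .gate hf (hW hu) (hW hv) (ih (Set.insert_subset_insert hW) hV (by omega))

/-- `Computes` may forget intermediate results; since no operation destroys anything, the inputs can
always be kept, which is what makes composition work. -/
theorem Computes.carry (h : Computes ops W k V) : Computes ops W k (W ∪ V) := by
  induction h with
  | of_subset h => exact .of_subset (Set.union_subset subset_rfl h)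
  | gate hf hu hv _ ih =>
    exact .gate hf hu hv (ih.mono subset_rfl
      (Set.union_subset_union_left _ (Set.subset_insert _ _)) le_rfl)

theorem Computes.trans (h : Computes ops W k V) (h' : Computes ops (W ∪ V) k' V') :
    Computes ops W (k + k') V' := by
  induction h with
  | of_subset h => exact h'.mono (Set.union_subset subset_rfl h) subset_rfl (by omega)
  | @gate W V k f u v hf hu hv _ ih =>
    have := ih (h'.mono (Set.union_subset_union_left _ (Set.subset_insert _ _)) subset_rfl le_rfl)
    exact (Computes.gate hf hu hv this).mono subset_rfl subset_rfl (by omega)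

theorem Computes.union (h : Computes ops W k V) (h' : Computes ops W k' V') :
    Computes ops W (k + k') (V ∪ V') := by
  refine h.trans ((h'.mono Set.subset_union_left subset_rfl le_rfl).carry.mono subset_rfl ?_ le_rfl)
  exact Set.union_subset_union_left _ Set.subset_union_right

theorem Computes.biUnion {ι : Type*} (s : Finset ι) {k : ℕ} {V : ι → Set α}
    (h : ∀ i ∈ s, Computes ops W k (V i)) : Computes ops W (s.card * k) (⋃ i ∈ s, V i) := by
  classical
  induction s using Finset.induction_on with
  | empty => exact .of_subset (by simp)
  | insert i s hi ih =>
    have := (ih fun j hj => h j (Finset.mem_insert_of_mem hj)).union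
      (h i (Finset.mem_insert_self i s))
    refine this.mono subset_rfl ?_ (by rw [Finset.card_insert_of_notMem hi]; ring_nf; rfl)
    rw [Finset.set_biUnion_insert, Set.union_comm]

/-- `n` quantities, each available for `k` operations. -/
theorem Computes.family (n : ℕ) {k : ℕ} {f : ℕ → α}
    (h : ∀ i < n, Computes ops W k {f i}) : Computes ops W (n * k) (f '' Set.Iio n) := by
  have := Computes.biUnion (Finset.range n) (V := fun i => {f i}) (W := W) (ops := ops) (k := k)
    fun i hi => h i (Finset.mem_range.1 hi)
  rw [Finset.card_range] at this
  refine this.mono subset_rfl ?_ le_rfl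
  rintro _ ⟨i, hi, rfl⟩
  simp only [Set.mem_iUnion]
  exact ⟨i, Finset.mem_range.2 hi, rfl⟩

/-- Simulation of one kind of operations by another one. -/
theorem Computes.simulate {ops' : Set (β → β → β)} (enc : α → Set β) (base : Set β) (c : ℕ)
    (hops : ∀ f ∈ ops, ∀ u v : α, ∀ W' : Set β, base ⊆ W' → enc u ⊆ W' → enc v ⊆ W' →
      Computes ops' W' c (enc (f u v)))
    (h : Computes ops W k V) {W' : Set β} (hbase : base ⊆ W') (hW : ∀ u ∈ W, enc u ⊆ W') :
    Computes ops' W' (k * c) (⋃ v ∈ V, enc v) := by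
  induction h generalizing W' with
  | of_subset h => exact .of_subset (Set.iUnion₂_subset fun v hv => hW v (h hv))
  | @gate W V k f u v hf hu hv _ ih =>
    have h1 := hops f hf u v W' hbase (hW u hu) (hW v hv)
    have h2 := ih (W' := W' ∪ enc (f u v)) (hbase.trans Set.subset_union_left) (by
      intro w hw
      rcases hw with rfl | hw
      · exact Set.subset_union_right
      · exact (hW w hw).trans Set.subset_union_left)
    exact (h1.trans h2).mono subset_rfl subset_rfl (by ring_nf; rfl)

end Computes

/-- Binary Boolean gates, applied pointwise. -/
def boolOps (X : Type) : Set ((X → Bool) → (X → Bool) → X → Bool) :=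
  Set.range fun (g : Bool → Bool → Bool) u v x => g (u x) (v x)

/-- `StraightLine` appends gates at the end and keeps everything, `Computes` prepends them and may
discard. Induction along `Computes` converts the convenient form into the official one. -/
theorem StraightLine.extend {X : Type} {I W V : Set (X → Bool)} {j k : ℕ}
    (hI : StraightLine I j W) (h : Computes (boolOps X) W k V) :
    ∃ i ≤ j + k, ∃ W', StraightLine I i W' ∧ V ⊆ W' := by
  induction h generalizing j with
  | of_subset h => exact ⟨j, by omega, _, hI, h⟩
  | gate hf hu hv _ ih =>
    obtain ⟨g, rfl⟩ := hf
    obtain ⟨i, hi, W', h1, h2⟩ := ih (hI.gate g hu hv)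
    exact ⟨i, by omega, W', h1, h2⟩

/-! ### Fast multiplication of polynomials modulo `x ^ N + 1` -/

section Ring

universe u
variable {R : Type u} [CommRing R]

/-- The ring operations. -/
def ringOps (R : Type u) [CommRing R] : Set (R → R → R) :=
  {fun x y => x + y, fun x y => x - y, fun x y => x * y}

theorem Computes.ring_add {W : Set R} {u v : R} (hu : u ∈ W) (hv : v ∈ W) :
    Computes (ringOps R) W 1 {u + v} :=
  .gate (f := fun x y => x + y) (by simp [ringOps]) hu hv (.of_subset (by simp))

theorem Computes.ring_sub {W : Set R} {u v : R} (hu : u ∈ W) (hv : v ∈ W) :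
    Computes (ringOps R) W 1 {u - v} :=
  .gate (f := fun x y => x - y) (by simp [ringOps]) hu hv (.of_subset (by simp))

theorem Computes.ring_mul {W : Set R} {u v : R} (hu : u ∈ W) (hv : v ∈ W) :
    Computes (ringOps R) W 1 {u * v} :=
  .gate (f := fun x y => x * y) (by simp [ringOps]) hu hv (.of_subset (by simp))

/-- The value of a polynomial with coefficients `a 0, …, a (n - 1)` at the point `y`. -/
def evalSeq {B : Type u} [CommRing B] (φ : R →+* B) (n : ℕ) (a : ℕ → R) (y : B) : B :=
  ∑ i ∈ Finset.range n, φ (a i) * y ^ i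

/-- The value of a bivariate polynomial. -/
def evalSeq₂ {B : Type u} [CommRing B] (φ : R →+* B) (n r : ℕ) (a : ℕ → ℕ → R) (x y : B) : B :=
  ∑ i ∈ Finset.range n, evalSeq φ r (a i) y * x ^ i

/-- The entry `a i` or `-a i`. -/
def signed (ε : Bool) (u : R) : R := if ε then u else -u

/-- Multiplication by a power of `y` modulo `y ^ r + 1` permutes the coefficients up to signs. -/
theorem exists_shift (r : ℕ) (hr : 0 < r) (s : ℕ) :
    ∃ (π : ℕ → ℕ) (ε : ℕ → Bool), (∀ i < r, π i < r) ∧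
      ∀ (a : ℕ → R) (B : Type u) [CommRing B] (φ : R →+* B) (y : B), y ^ r = -1 →
        evalSeq φ r (fun i => signed (ε i) (a (π i))) y = y ^ s * evalSeq φ r a y := by
  obtain ⟨r, rfl⟩ : ∃ k, r = k + 1 := ⟨r - 1, by omega⟩
  induction s with
  | zero => exact ⟨id, fun _ => true, fun i hi => hi, by simp [signed]⟩
  | succ s ih =>
    obtain ⟨π, ε, hπ, h⟩ := ih
    -- One more multiplication by y moves every coefficient up by one place; the top one wraps
    -- around to place 0 and changes sign because y^(r+1) = -1 for the current r.
    refine ⟨fun i => if i = 0 then π r else π (i - 1),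
      fun i => if i = 0 then !(ε r) else ε (i - 1), ?_, ?_⟩
    · intro i hi
      dsimp only
      split_ifs
      · exact hπ _ (by omega)
      · exact hπ _ (by omega)
    · intro a B _ φ y hy
      rw [pow_succ', mul_assoc, ← h a B φ y hy]
      unfold evalSeq
      rw [Finset.sum_range_succ', Finset.sum_range_succ, mul_add, Finset.mul_sum]
      congr 1
      · refine Finset.sum_congr rfl fun i _ => ?_
        simp only [Nat.add_eq_zero_iff, one_ne_zero, and_false, if_false, Nat.add_sub_cancel]
        ring
      · have : y * (φ (signed (ε r) (a (π r))) * y ^ r)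
            = φ (signed (ε r) (a (π r))) * y ^ (r + 1) := by ring
        rw [this, hy]
        cases ε r <;> simp [signed]

/-- The coefficients in a rectangle. -/
def entries (n r : ℕ) (a : ℕ → ℕ → R) : Set R := {u | ∃ i < n, ∃ j < r, u = a i j}

theorem mem_entries {R : Type*} {n r i j : ℕ} {a : ℕ → ℕ → R} (hi : i < n) (hj : j < r) :
    a i j ∈ entries n r a := ⟨i, hi, j, hj, rfl⟩

theorem entries_subset {R : Type*} {n r : ℕ} {a : ℕ → ℕ → R} {W : Set R}
    (h : ∀ i < n, ∀ j < r, a i j ∈ W) :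
    entries n r a ⊆ W := by
  rintro _ ⟨i, hi, j, hj, rfl⟩
  exact h i hi j hj

theorem Computes.entries {R : Type*} {ops : Set (R → R → R)} {W : Set R} {n r k : ℕ}
    {a : ℕ → ℕ → R}
    (h : ∀ i < n, ∀ j < r, Computes ops W k {a i j}) :
    Computes ops W (n * r * k) (entries n r a) := by
  have := Computes.biUnion (Finset.range n ×ˢ Finset.range r) (V := fun p => {a p.1 p.2})
    (W := W) (ops := ops) (k := k) (by
      rintro ⟨i, j⟩ hp
      simp only [Finset.mem_product, Finset.mem_range] at hp
      exact h i hp.1 j hp.2)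
  rw [Finset.card_product, Finset.card_range, Finset.card_range] at this
  refine this.mono subset_rfl (entries_subset fun i hi j hj => ?_) le_rfl
  simp only [Set.mem_iUnion]
  exact ⟨(i, j), by simp [hi, hj], rfl⟩

theorem evalSeq_add {B : Type u} [CommRing B] (φ : R →+* B) (n : ℕ) (a b : ℕ → R) (y : B) :
    evalSeq φ n (fun i => a i + b i) y = evalSeq φ n a y + evalSeq φ n b y := by
  simp [evalSeq, add_mul, Finset.sum_add_distrib]

theorem evalSeq₂_two_mul {B : Type u} [CommRing B] (φ : R →+* B) (h r : ℕ) (a : ℕ → ℕ → R)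
    (x y : B) : evalSeq₂ φ (h + h) r a x y =
      evalSeq₂ φ h r a x y + x ^ h * evalSeq₂ φ h r (fun i => a (h + i)) x y := by
  unfold evalSeq₂
  rw [Finset.sum_range_add, Finset.mul_sum]
  congr 1
  refine Finset.sum_congr rfl fun i _ => ?_
  ring

/-- The linear combination `a + y ^ s * b` of two rows of bivariate polynomials. -/
theorem exists_add_shift (n r : ℕ) (hr : 0 < r) (s : ℕ) (a b : ℕ → ℕ → R) :
    ∃ c : ℕ → ℕ → R, Computes (ringOps R) (entries n r a ∪ entries n r b) (n * r) (entries n r c) ∧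
      ∀ (B : Type u) [CommRing B] (φ : R →+* B) (x y : B), y ^ r = -1 →
        evalSeq₂ φ n r c x y = evalSeq₂ φ n r a x y + y ^ s * evalSeq₂ φ n r b x y := by
  obtain ⟨π, ε, hπ, h⟩ := exists_shift (R := R) r hr s
  refine ⟨fun i j => a i j + signed (ε j) (b i (π j)), ?_, ?_⟩
  · have : Computes (ringOps R) (entries n r a ∪ entries n r b) (n * r * 1)
        (entries n r fun i j => a i j + signed (ε j) (b i (π j))) := by
      refine Computes.entries fun i hi j hj => ?_
      have ha : a i j ∈ entries n r a ∪ entries n r b := Or.inl (mem_entries hi hj)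
      have hb : b i (π j) ∈ entries n r a ∪ entries n r b := Or.inr (mem_entries hi (hπ j hj))
      cases hε : ε j
      · simpa [signed, sub_eq_add_neg] using Computes.ring_sub ha hb
      · simpa [signed] using Computes.ring_add ha hb
    simpa using this
  · intro B _ φ x y hy
    unfold evalSeq₂
    rw [Finset.mul_sum, ← Finset.sum_add_distrib]
    refine Finset.sum_congr rfl fun i _ => ?_
    rw [evalSeq_add φ r (a i) (fun j => signed (ε j) (b i (π j))), h (b i) B φ y hy]
    ring

end Ring

end SumRank

/-! ### Fourier transform with powers of y as roots of unity. -/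

namespace SumRank

section Ring

universe u
variable {R : Type u} [CommRing R]

/-- `K` ring operations multiply polynomials of degree less than `r` modulo `y ^ r + 1`, up to the
factor `2 ^ e`. -/
def NegacyclicMul (R : Type u) [CommRing R] (r K e : ℕ) : Prop :=
  ∀ (a b : ℕ → R) (W : Set R), 0 ∈ W → a '' Set.Iio r ⊆ W → b '' Set.Iio r ⊆ W →
    ∃ c : ℕ → R, Computes (ringOps R) W K (c '' Set.Iio r) ∧
      ∀ (B : Type u) [CommRing B] (φ : R →+* B) (y : B), y ^ r = -1 →
        evalSeq φ r c y = 2 ^ e * (evalSeq φ r a y * evalSeq φ r b y)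

/-- Splitting `x ^ (2 * h) - c ^ 2 = (x ^ h - c) * (x ^ h + c)`. -/
theorem dvd_of_split {B : Type u} [CommRing B] {ξ c d P M Z a₀ a₁ b₀ b₁ E : B}
    (hcd : c * d = 1)
    (hP : ξ - c ∣ P - E * ((a₀ + c * a₁) * (b₀ + c * b₁)))
    (hM : ξ + c ∣ M - E * ((a₀ - c * a₁) * (b₀ - c * b₁)))
    (hZ : Z = (P + M) + ξ * (d * (P - M))) :
    ξ ^ 2 - c ^ 2 ∣ Z - 2 * E * ((a₀ + ξ * a₁) * (b₀ + ξ * b₁)) := by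
  have h1 : ξ - c ∣ P - E * ((a₀ + ξ * a₁) * (b₀ + ξ * b₁)) := by
    obtain ⟨w, hw⟩ := hP
    refine ⟨w - E * (a₁ * (b₀ + ξ * b₁) + (a₀ + c * a₁) * b₁), ?_⟩
    linear_combination hw
  have h2 : ξ + c ∣ M - E * ((a₀ + ξ * a₁) * (b₀ + ξ * b₁)) := by
    obtain ⟨w, hw⟩ := hM
    refine ⟨w - E * (a₁ * (b₀ + ξ * b₁) + (a₀ - c * a₁) * b₁), ?_⟩
    linear_combination hw
  obtain ⟨u, hu⟩ := h1
  obtain ⟨v, hv⟩ := h2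
  refine ⟨d * (u - v), ?_⟩
  rw [hZ]
  linear_combination (1 + ξ * d) * hu + (1 - ξ * d) * hv
    + ((-u) * (ξ - c) - v * (ξ + c)) * hcd

/-- Multiplication modulo `x ^ (2 ^ k) - y ^ (2 ^ k * σ)`, where `y ^ r = -1`. -/
theorem exists_cyclic_mul {r K e : ℕ} (hr : 0 < r) (hT : NegacyclicMul R r K e) (k : ℕ)
    (hk : 2 ^ k ∣ 2 * r) (σ : ℕ) (a b : ℕ → ℕ → R) (W : Set R) (h0 : 0 ∈ W)
    (ha : entries (2 ^ k) r a ⊆ W) (hb : entries (2 ^ k) r b ⊆ W) :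
    ∃ c : ℕ → ℕ → R, Computes (ringOps R) W (2 ^ k * (K + 4 * k * r)) (entries (2 ^ k) r c) ∧
      ∀ (B : Type u) [CommRing B] (φ : R →+* B) (x y : B), y ^ r = -1 →
        x ^ 2 ^ k - y ^ (2 ^ k * σ) ∣ evalSeq₂ φ (2 ^ k) r c x y -
          2 ^ (k + e) * (evalSeq₂ φ (2 ^ k) r a x y * evalSeq₂ φ (2 ^ k) r b x y) := by
  induction k generalizing σ a b W with
  | zero =>
    obtain ⟨c, hc, hc'⟩ := hT (a 0) (b 0) W h0
      (by rintro _ ⟨j, hj, rfl⟩; exact ha (mem_entries (by simp) hj))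
      (by rintro _ ⟨j, hj, rfl⟩; exact hb (mem_entries (by simp) hj))
    refine ⟨fun _ => c, hc.mono subset_rfl ?_ (by simp), ?_⟩
    · exact entries_subset fun i _ j hj => ⟨j, hj, rfl⟩
    · intro B _ φ x y hy
      simp [evalSeq₂, hc' B φ y hy]
  | succ k ih =>
    have hpow : 2 ^ (k + 1) = 2 ^ k + 2 ^ k := by ring
    have hkr : 2 ^ k ∣ r := by
      rw [pow_succ'] at hk
      exact Nat.dvd_of_mul_dvd_mul_left (by norm_num) hk
    have hk' : 2 ^ k ∣ 2 * r := hkr.mul_left 2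
    obtain ⟨ρ, hρ⟩ := hkr
    set h := 2 ^ k with hh
    rw [hpow] at ha hb ⊢
    have ha0 : entries h r a ⊆ W :=
      entries_subset fun i hi j hj => ha (mem_entries (by omega) hj)
    have ha1 : entries h r (fun i => a (h + i)) ⊆ W :=
      entries_subset fun i hi j hj => ha (mem_entries (by omega) hj)
    have hb0 : entries h r b ⊆ W :=
      entries_subset fun i hi j hj => hb (mem_entries (by omega) hj)
    have hb1 : entries h r (fun i => b (h + i)) ⊆ W :=
      entries_subset fun i hi j hj => hb (mem_entries (by omega) hj)
    -- Let c = y^(hσ). Reduction modulo x^h - c replaces x^h by c, and modulo x^h + c by -c. The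
    -- latter is again a power of y, namely y^(h(σ+ρ)), because hρ = r and y^r = -1. So both
    -- reductions are shifted additions.
    obtain ⟨a', ca', ea'⟩ := exists_add_shift h r hr (h * σ) a (fun i => a (h + i))
    obtain ⟨b', cb', eb'⟩ := exists_add_shift h r hr (h * σ) b (fun i => b (h + i))
    obtain ⟨a'', ca'', ea''⟩ := exists_add_shift h r hr (h * (σ + ρ)) a (fun i => a (h + i))
    obtain ⟨b'', cb'', eb''⟩ := exists_add_shift h r hr (h * (σ + ρ)) b (fun i => b (h + i))
    have c4 := ((ca'.mono (Set.union_subset ha0 ha1) subset_rfl le_rfl).union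
      (cb'.mono (Set.union_subset hb0 hb1) subset_rfl le_rfl)).union
      ((ca''.mono (Set.union_subset ha0 ha1) subset_rfl le_rfl).union
      (cb''.mono (Set.union_subset hb0 hb1) subset_rfl le_rfl))
    set V := (entries h r a' ∪ entries h r b') ∪ (entries h r a'' ∪ entries h r b'') with hV
    have hWV : W ⊆ W ∪ V := Set.subset_union_left
    have hVW : V ⊆ W ∪ V := Set.subset_union_right
    obtain ⟨p, cp, ep⟩ := ih hk' σ a' b' (W ∪ V) (hWV h0)
      ((Set.subset_union_left.trans Set.subset_union_left).trans hVW)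
      ((Set.subset_union_right.trans Set.subset_union_left).trans hVW)
    obtain ⟨m, cm, em⟩ := ih hk' (σ + ρ) a'' b'' (W ∪ V) (hWV h0)
      ((Set.subset_union_left.trans Set.subset_union_right).trans hVW)
      ((Set.subset_union_right.trans Set.subset_union_right).trans hVW)
    -- Recombination: lo = p + m, d = p - m (the shift by r is the change of sign), hi = d/c, where
    -- 1/c = c^(2r-1) since y^(2r) = 1. The halving that the exact formula would require is omitted;
    -- this costs a factor 2 per level and explains 2^(k+e).
    obtain ⟨lo, clo, elo⟩ := exists_add_shift h r hr 0 p m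
    obtain ⟨d, cd, ed⟩ := exists_add_shift h r hr r p m
    obtain ⟨hi, chi, ehi⟩ := exists_add_shift h r hr (h * σ * (2 * r - 1)) (fun _ _ => (0 : R)) d
    have c5 := c4.trans ((cp.union cm).trans (((clo.union cd).mono
      (W' := W ∪ V ∪ (entries h r p ∪ entries h r m)) Set.subset_union_right subset_rfl
      le_rfl).trans (chi.mono (W' := W ∪ V ∪ (entries h r p ∪ entries h r m) ∪
        (entries h r lo ∪ entries h r d)) (Set.union_subset
          (entries_subset fun _ _ _ _ => Or.inl (Or.inl (Or.inl h0)))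
          (Set.subset_union_right.trans Set.subset_union_right)) subset_rfl le_rfl).carry))
    refine ⟨fun i => if i < h then lo i else hi (i - h), c5.mono subset_rfl ?_ ?_, ?_⟩
    · refine entries_subset fun i hi' j hj => ?_
      by_cases hlt : i < h
      · simp only [hlt, if_true]
        exact Or.inl (Or.inr (Or.inl (mem_entries hlt hj)))
      · simp only [hlt, if_false]
        exact Or.inr (mem_entries (by omega) hj)
    · have e1 : h * r + h * r + (h * r + h * r) + (h * (K + 4 * k * r) + h * (K + 4 * k * r) +
          (h * r + h * r + h * r)) = 2 * (h * K) + 8 * (k * (h * r)) + 7 * (h * r) := by ring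
      have e2 : (h + h) * (K + 4 * (k + 1) * r) =
          2 * (h * K) + 8 * (k * (h * r)) + 8 * (h * r) := by ring
      rw [e1, e2]
      omega
    · intro B _ φ x y hy
      have hy2 : y ^ (2 * r) = 1 := by rw [mul_comm, pow_mul, hy]; ring
      have hc : y ^ (h * σ) * y ^ (h * σ * (2 * r - 1)) = 1 := by
        rw [← pow_add]
        have : h * σ + h * σ * (2 * r - 1) = 2 * r * (h * σ) := by
          obtain ⟨r', rfl⟩ : ∃ r', r = r' + 1 := ⟨r - 1, by omega⟩
          rw [show 2 * (r' + 1) - 1 = 2 * r' + 1 by omega]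
          ring
        rw [this, pow_mul, hy2, one_pow]
      have hneg : y ^ (h * (σ + ρ)) = -y ^ (h * σ) := by
        rw [mul_add, pow_add, ← hρ, hy]
        ring
      have hP := ep B φ x y hy
      have hM := em B φ x y hy
      rw [ea' B φ x y hy, eb' B φ x y hy] at hP
      rw [ea'' B φ x y hy, eb'' B φ x y hy, hneg, sub_neg_eq_add] at hM
      simp only [neg_mul, ← sub_eq_add_neg] at hM
      have hzero : evalSeq₂ φ h r (fun _ _ => (0 : R)) x y = 0 := by simp [evalSeq₂, evalSeq]
      have hlo : evalSeq₂ φ h r (fun i => if i < h then lo i else hi (i - h)) x y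
          = evalSeq₂ φ h r lo x y := by
        refine Finset.sum_congr rfl fun i hi => ?_
        simp [Finset.mem_range.1 hi]
      have key := dvd_of_split hc hP hM
        (Z := evalSeq₂ φ (h + h) r (fun i => if i < h then lo i else hi (i - h)) x y) (by
          rw [evalSeq₂_two_mul, hlo, elo B φ x y hy]
          simp only [Nat.not_lt.2 (Nat.le_add_right h _), if_false, Nat.add_sub_cancel_left]
          rw [ehi B φ x y hy, ed B φ x y hy, hy, hzero]
          ring)
      rw [evalSeq₂_two_mul φ h r a, evalSeq₂_two_mul φ h r b]
      convert key using 1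
      · rw [← pow_mul, ← pow_mul]
        congr 2 <;> ring
      · ring

end Ring
end SumRank

/-! ### Recursive multiplication modulo z^N + 1. -/

namespace SumRank

section Ring

open Polynomial

universe u
variable {R : Type u} [CommRing R]

theorem evalSeq_eq_evalSeq₂ {B : Type u} [CommRing B] (φ : R →+* B) (m r : ℕ) (a : ℕ → R) (z : B) :
    evalSeq φ (m * r) a z = evalSeq₂ φ m r (fun i j => a (i + m * j)) z (z ^ m) := by
  unfold evalSeq₂ evalSeq
  simp_rw [Finset.sum_mul]
  rw [Finset.sum_comm]
  induction r with
  | zero => simp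
  | succ r ih =>
    rw [mul_add_one, Finset.sum_range_add, Finset.sum_range_succ, ih]
    congr 1
    refine Finset.sum_congr rfl fun i _ => ?_
    rw [← pow_mul, pow_add, add_comm i]
    ring

theorem evalSeq_C {B : Type u} [CommRing B] (φ : R →+* B) (r : ℕ) (a : ℕ → R) (y : B) :
    evalSeq ((C : B →+* B[X]).comp φ) r a (C y) = C (evalSeq φ r a y) := by
  simp [evalSeq]

theorem evalSeq₂_degree_lt {B : Type u} [CommRing B] (φ : R →+* B) (n r : ℕ)
    (a : ℕ → ℕ → R) (y : B) :
    (evalSeq₂ ((C : B →+* B[X]).comp φ) n r a X (C y)).degree < n := by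
  unfold evalSeq₂
  refine (Polynomial.degree_sum_le _ _).trans_lt ((Finset.sup_lt_iff (by simp)).2 fun i hi => ?_)
  rw [evalSeq_C]
  refine (Polynomial.degree_C_mul_X_pow_le _ _).trans_lt ?_
  exact_mod_cast Finset.mem_range.1 hi

theorem eval_evalSeq₂ {B : Type u} [CommRing B] (φ : R →+* B) (n r : ℕ) (a : ℕ → ℕ → R) (x y : B) :
    (evalSeq₂ ((C : B →+* B[X]).comp φ) n r a X (C y)).eval x = evalSeq₂ φ n r a x y := by
  unfold evalSeq₂
  rw [Polynomial.eval_finsetSum]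
  refine Finset.sum_congr rfl fun i _ => ?_
  rw [evalSeq_C]
  simp

/-- A polynomial product of small degree is determined modulo `x ^ n - 1`. -/
theorem evalSeq₂_eq_of_dvd {B : Type u} [CommRing B] {φ : R →+* B} {m r : ℕ} {E : ℕ}
    (hm : 0 < m) {a b c : ℕ → ℕ → R} {y : B}
    (h : (X : B[X]) ^ (m + m) - 1 ∣ evalSeq₂ ((C : B →+* B[X]).comp φ) (m + m) r c X (C y) -
      2 ^ E * (evalSeq₂ ((C : B →+* B[X]).comp φ) m r a X (C y) *
        evalSeq₂ ((C : B →+* B[X]).comp φ) m r b X (C y))) (x : B) :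
    evalSeq₂ φ (m + m) r c x y = 2 ^ E * (evalSeq₂ φ m r a x y * evalSeq₂ φ m r b x y) := by
  nontriviality B
  have hmon : ((X : B[X]) ^ (m + m) - 1).Monic := by
    simpa using Polynomial.monic_X_pow_sub_C (1 : B) (n := m + m) (by omega)
  have hdeg : ((X : B[X]) ^ (m + m) - 1).degree = (m + m : ℕ) := by
    simpa using Polynomial.degree_X_pow_sub_C (n := m + m) (by omega) (1 : B)
  have h0 : evalSeq₂ ((C : B →+* B[X]).comp φ) (m + m) r c X (C y) -
      2 ^ E * (evalSeq₂ ((C : B →+* B[X]).comp φ) m r a X (C y) *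
        evalSeq₂ ((C : B →+* B[X]).comp φ) m r b X (C y)) = 0 := by
    by_contra hne
    refine hmon.not_dvd_of_degree_lt hne ?_ h
    rw [hdeg]
    refine (Polynomial.degree_sub_le _ _).trans_lt (max_lt (evalSeq₂_degree_lt φ _ r c y) ?_)
    have e2 : (2 ^ E : B[X]) = C (2 ^ E) := by rw [C_pow, C_ofNat]
    rw [e2, ← Polynomial.smul_eq_C_mul]
    refine (Polynomial.degree_smul_le _ _).trans_lt ((Polynomial.degree_mul_le _ _).trans_lt ?_)
    push_cast
    refine (add_le_add le_rfl (evalSeq₂_degree_lt φ m r b y).le).trans_lt ?_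
    exact WithBot.add_lt_add_right (WithBot.coe_ne_bot (a := m)) (evalSeq₂_degree_lt φ m r a y)
  have := congrArg (Polynomial.eval x) h0
  simp only [Polynomial.eval_sub, Polynomial.eval_mul, Polynomial.eval_pow, eval_evalSeq₂,
    Polynomial.eval_zero, Polynomial.eval_ofNat] at this
  exact sub_eq_zero.1 this

/-- Writing indices as i + m·j with m = 2^k turns a polynomial in z into one of degree below m in x
= z whose coefficients are polynomials in y = z^m modulo y^r + 1. The product has degree below 2m in
x, so it may be computed modulo x^(2m) - 1 by k + 1 levels of the transform; this needs 2^(k+1) ∣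
2r. The last m·r operations fold the upper half back by x^m = y. -/
theorem NegacyclicMul.mul {r K e : ℕ} (k : ℕ) (hr : 0 < r) (hk : 2 ^ k ∣ r)
    (hT : NegacyclicMul R r K e) :
    NegacyclicMul R (2 ^ k * r) (2 ^ (k + 1) * (K + 4 * (k + 1) * r) + 2 ^ k * r) (k + 1 + e) := by
  intro a b W h0 ha hb
  set m := 2 ^ k with hm
  have hm0 : 0 < m := by positivity
  have h2m : 2 ^ (k + 1) = m + m := by rw [hm]; ring
  have hlt : ∀ i < m, ∀ j < r, i + m * j < m * r := fun i hi j hj => by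
    calc i + m * j < m + m * j := by omega
      _ = m * (j + 1) := by ring
      _ ≤ m * r := Nat.mul_le_mul_left _ hj
  set pad : (ℕ → R) → ℕ → ℕ → R := fun a i j => if i < m then a (i + m * j) else 0 with hpad
  have hsub : ∀ a : ℕ → R, a '' Set.Iio (m * r) ⊆ W → entries (2 ^ (k + 1)) r (pad a) ⊆ W := by
    intro a ha
    refine entries_subset fun i hi j hj => ?_
    simp only [hpad]
    split_ifs with h
    · exact ha ⟨_, hlt i h j hj, rfl⟩
    · exact h0
  have hval : ∀ (a : ℕ → R) (B : Type u) [CommRing B] (φ : R →+* B) (x y : B),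
      evalSeq₂ φ (m + m) r (pad a) x y = evalSeq₂ φ m r (fun i j => a (i + m * j)) x y := by
    intro a B _ φ x y
    have e1 : evalSeq₂ φ m r (pad a) x y = evalSeq₂ φ m r (fun i j => a (i + m * j)) x y := by
      refine Finset.sum_congr rfl fun i hi => ?_
      simp [hpad, Finset.mem_range.1 hi]
    have e2 : evalSeq₂ φ m r (fun i => pad a (m + i)) x y = 0 := by
      simp [evalSeq₂, evalSeq, hpad]
    rw [evalSeq₂_two_mul, e1, e2, mul_zero, add_zero]
  obtain ⟨c, hc, hc'⟩ := exists_cyclic_mul hr hT (k + 1)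
    (by rw [pow_succ']; exact Nat.mul_dvd_mul_left 2 hk) 0 (pad a) (pad b) W h0 (hsub a ha)
    (hsub b hb)
  obtain ⟨d, hd, hd'⟩ := exists_add_shift m r hr 1 c (fun i => c (m + i))
  refine ⟨fun n => d (n % m) (n / m), ?_, ?_⟩
  · refine (hc.trans (hd.mono ?_ subset_rfl le_rfl)).mono subset_rfl ?_ le_rfl
    · refine Set.Subset.trans (Set.union_subset ?_ ?_) Set.subset_union_right
      · exact entries_subset fun i hi j hj => mem_entries (by omega) hj
      · exact entries_subset fun i hi j hj => mem_entries (by omega) hj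
    · rintro _ ⟨n, hn, rfl⟩
      exact mem_entries (Nat.mod_lt _ hm0) (Nat.div_lt_of_lt_mul hn)
  · intro B _ φ z hz
    have hy : (z ^ m) ^ r = -1 := by rw [← pow_mul, hz]
    -- The congruence is used over B[X], with x the variable, so that it determines the coefficients
    -- in x; x is specialized to z only afterwards. Quantifying over all target rings makes this
    -- possible.
    have h1 := hc' B[X] ((C : B →+* B[X]).comp φ) X (C (z ^ m)) (by rw [← C_pow, hy]; simp)
    rw [h2m, hval a, hval b, mul_zero, pow_zero] at h1
    have h2 := evalSeq₂_eq_of_dvd hm0 h1 z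
    rw [evalSeq_eq_evalSeq₂, evalSeq_eq_evalSeq₂, evalSeq_eq_evalSeq₂, ← h2, evalSeq₂_two_mul]
    have h3 : evalSeq₂ φ m r (fun i j => d ((i + m * j) % m) ((i + m * j) / m)) z (z ^ m)
        = evalSeq₂ φ m r d z (z ^ m) := by
      refine Finset.sum_congr rfl fun i hi => ?_
      have hi' := Finset.mem_range.1 hi
      have : (fun j => d ((i + m * j) % m) ((i + m * j) / m)) = d i := by
        funext j
        rw [Nat.add_mul_mod_self_left, Nat.mod_eq_of_lt hi', Nat.add_mul_div_left _ _ hm0,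
          Nat.div_eq_of_lt hi', zero_add]
      simp only [this]
    rw [h3, hd' B φ z (z ^ m) hy, pow_one]

theorem negacyclicMul_one : NegacyclicMul R 1 1 0 := by
  intro a b W _ ha hb
  refine ⟨fun _ => a 0 * b 0, (Computes.ring_mul (u := a 0) (v := b 0) (ha ⟨0, by simp, rfl⟩)
    (hb ⟨0, by simp, rfl⟩)).mono subset_rfl (by rintro _ ⟨_, _, rfl⟩; rfl) le_rfl, ?_⟩
  intro B _ φ y _
  simp [evalSeq]

theorem negacyclicMul_two : NegacyclicMul R 2 6 0 := by
  intro a b W _ ha hb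
  have ha0 : a 0 ∈ W := ha ⟨0, by simp, rfl⟩
  have ha1 : a 1 ∈ W := ha ⟨1, by simp, rfl⟩
  have hb0 : b 0 ∈ W := hb ⟨0, by simp, rfl⟩
  have hb1 : b 1 ∈ W := hb ⟨1, by simp, rfl⟩
  refine ⟨fun i => if i = 0 then a 0 * b 0 - a 1 * b 1 else a 0 * b 1 + a 1 * b 0, ?_, ?_⟩
  · have h := (((Computes.ring_mul ha0 hb0).union (Computes.ring_mul ha1 hb1)).trans
      (Computes.ring_sub (Or.inr (Or.inl rfl)) (Or.inr (Or.inr rfl)))).union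
      (((Computes.ring_mul ha0 hb1).union (Computes.ring_mul ha1 hb0)).trans
      (Computes.ring_add (Or.inr (Or.inl rfl)) (Or.inr (Or.inr rfl))))
    refine h.mono subset_rfl ?_ le_rfl
    rintro _ ⟨i, _, rfl⟩
    dsimp only
    split_ifs
    · exact Or.inl rfl
    · exact Or.inr rfl
  · intro B _ φ y hy
    simp only [evalSeq, Finset.sum_range_succ, Finset.sum_range_zero]
    simp
    linear_combination (-(φ (a 1) * φ (b 1))) * hy

/-- Quasi-linear multiplication of polynomials over an arbitrary commutative ring. -/
theorem exists_negacyclicMul (j : ℕ) : ∃ K e : ℕ, K ≤ 2 ^ j * (40 * (j + 1) ^ 3) ∧ e ≤ 2 * j ∧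
    ∀ (R : Type u) [CommRing R], NegacyclicMul R (2 ^ j) K e := by
  induction j using Nat.strong_induction_on with
  | _ j ih =>
    match j with
    | 0 => exact ⟨1, 0, by norm_num, by norm_num, fun R _ => by simpa using negacyclicMul_one⟩
    | 1 => exact ⟨6, 0, by norm_num, by norm_num, fun R _ => by simpa using negacyclicMul_two⟩
    | j + 2 =>
      -- The exponent is split into nearly equal halves: p ≤ q is the divisibility needed by the
      -- transform, and q about j/2 lets the cubic factor (q+1)^3 drop by almost 8, which absorbs
      -- the factor 2 coming from 2^(p+1) subproducts.
      obtain ⟨p, q, hpq, hp, hq⟩ : ∃ p q, p + q = j + 2 ∧ p ≤ q ∧ 2 * q ≤ j + 3 :=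
        ⟨(j + 2) / 2, (j + 3) / 2, by omega, by omega, by omega⟩
      obtain ⟨K, e, hK, he, h⟩ := ih q (by omega)
      have e1 : 2 ^ (j + 2) = 2 ^ p * 2 ^ q := by rw [← hpq, pow_add]
      refine ⟨2 ^ (p + 1) * (K + 4 * (p + 1) * 2 ^ q) + 2 ^ p * 2 ^ q, p + 1 + e, ?_, by omega,
        fun R _ => ?_⟩
      · have e2 : 2 ^ (p + 1) * (K + 4 * (p + 1) * 2 ^ q) + 2 ^ p * 2 ^ q =
            2 * 2 ^ p * K + 2 ^ p * 2 ^ q * (8 * (p + 1) + 1) := by ring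
        have e3 : 2 * 2 ^ p * K ≤ 2 ^ p * 2 ^ q * (80 * (q + 1) ^ 3) := by
          calc 2 * 2 ^ p * K ≤ 2 * 2 ^ p * (2 ^ q * (40 * (q + 1) ^ 3)) :=
                Nat.mul_le_mul_left _ hK
            _ = _ := by ring
        rw [e1, e2]
        have e4 : 80 * (q + 1) ^ 3 + (8 * (p + 1) + 1) ≤ 40 * (j + 2 + 1) ^ 3 := by
          have h3 : (2 * (q + 1)) ^ 3 ≤ (j + 5) ^ 3 := Nat.pow_le_pow_left (by omega) 3
          have hp8 : 8 * (p + 1) + 1 ≤ 4 * j + 21 := by omega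
          -- The estimate 2(q+1) ≤ j+5 is too lossy for j = 0, where q = 1 is inserted directly.
          rcases Nat.eq_zero_or_pos j with rfl | hj
          · have hq1 : q = 1 := by omega
            subst hq1
            omega
          · obtain ⟨i, rfl⟩ : ∃ i, j = i + 1 := ⟨j - 1, by omega⟩
            have h4 : 80 * (q + 1) ^ 3 = 10 * (2 * (q + 1)) ^ 3 := by ring
            have h5 : 10 * (i + 1 + 5) ^ 3 + (4 * (i + 1) + 21) ≤ 40 * (i + 1 + 2 + 1) ^ 3 := by
              nlinarith [Nat.zero_le (i ^ 3), Nat.zero_le (i ^ 2)]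
            rw [h4]
            omega
        calc _ ≤ 2 ^ p * 2 ^ q * (80 * (q + 1) ^ 3) + 2 ^ p * 2 ^ q * (8 * (p + 1) + 1) := by
              omega
          _ = 2 ^ p * 2 ^ q * (80 * (q + 1) ^ 3 + (8 * (p + 1) + 1)) := by ring
          _ ≤ _ := Nat.mul_le_mul_left _ e4
      · rw [e1]
        exact (h R).mul p (by positivity) (pow_dvd_pow 2 hp)

end Ring
end SumRank

namespace SumRank

/-! ### Boolean circuits for the arithmetic of bit vectors -/

section Circuits

variable {X : Type} {W : Set (X → Bool)}

/-- The constant bits. -/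
def constBits (X : Type) : Set (X → Bool) := {fun _ => false, fun _ => true}

theorem false_mem (hW : constBits X ⊆ W) : (fun _ => false) ∈ W := hW (Or.inl rfl)

theorem true_mem (hW : constBits X ⊆ W) : (fun _ => true) ∈ W := hW (Or.inr rfl)

theorem Computes.of_mem {α : Type*} {ops : Set (α → α → α)} {W : Set α} {u : α} (hu : u ∈ W)
    (k : ℕ) : Computes ops W k {u} := .of_subset (Set.singleton_subset_iff.2 hu)

theorem Computes.append {α : Type*} {ops : Set (α → α → α)} {W V V' : Set α} {k k' : ℕ}
    (h : Computes ops W k V) (h' : Computes ops (W ∪ V) k' V') :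
    Computes ops W (k + k') (V ∪ V') :=
  h.trans (h'.carry.mono subset_rfl
    (Set.union_subset_union_left _ Set.subset_union_right) le_rfl)

theorem Computes.bool {k k' : ℕ} {u v : X → Bool} (g : Bool → Bool → Bool)
    (hu : Computes (boolOps X) W k {u}) (hv : Computes (boolOps X) W k' {v}) :
    Computes (boolOps X) W (k + k' + 1) {fun x => g (u x) (v x)} :=
  (hu.union hv).trans (.gate (f := fun u v x => g (u x) (v x)) ⟨g, rfl⟩ (Or.inr (Or.inl rfl))
    (Or.inr (Or.inr rfl)) (.of_subset (by simp)))

/-- The bits of a bit vector depending on the input. -/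
def vecBits {w : ℕ} (f : X → BitVec w) : Set (X → Bool) :=
  (fun i x => (f x).getLsbD i) '' Set.Iio w

theorem mem_vecBits {w i : ℕ} (f : X → BitVec w) (hi : i < w) :
    (fun x => (f x).getLsbD i) ∈ vecBits f := ⟨i, hi, rfl⟩

/-- The next carry is (f ∧ g) ∨ (c ∧ (f ∨ g)), four gates. All carries are retained: addition reads
every one of them, comparison the last one. -/
theorem computes_carry {w : ℕ} {f g : X → BitVec w} {c : X → Bool} (hf : vecBits f ⊆ W)
    (hg : vecBits g ⊆ W) (hc : c ∈ W) (n : ℕ) (hn : n ≤ w) :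
    Computes (boolOps X) W (4 * n) ((fun i x => (f x).carry i (g x) (c x)) '' Set.Iic n) := by
  induction n with
  | zero =>
    refine .of_subset ?_
    rintro _ ⟨i, hi, rfl⟩
    obtain rfl : i = 0 := by simpa using hi
    simpa using hc
  | succ n ih =>
    have hn' : n < w := hn
    have h1 := ih hn'.le
    have h2 : Computes (boolOps X) (W ∪ (fun i x => (f x).carry i (g x) (c x)) '' Set.Iic n) 4
        {fun x => (f x).carry (n + 1) (g x) (c x)} := by
      have hfn := Computes.of_mem (ops := boolOps X) (W := W ∪ (fun i x => (f x).carry i (g x) (c x))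
        '' Set.Iic n) (Or.inl (hf (mem_vecBits f hn'))) 0
      have hgn := Computes.of_mem (ops := boolOps X) (W := W ∪ (fun i x => (f x).carry i (g x) (c x))
        '' Set.Iic n) (Or.inl (hg (mem_vecBits g hn'))) 0
      have hcn := Computes.of_mem (ops := boolOps X) (W := W ∪ (fun i x => (f x).carry i (g x) (c x))
        '' Set.Iic n) (Or.inr ⟨n, by simp, rfl⟩) 0
      convert Computes.bool or (Computes.bool and hfn hgn)
        (Computes.bool and hcn (Computes.bool or hfn hgn)) using 3 with x
      rw [BitVec.carry_succ]
      cases (f x).getLsbD n <;> cases (g x).getLsbD n <;> simp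
    refine (h1.append h2).mono subset_rfl ?_ le_rfl
    rintro _ ⟨i, hi, rfl⟩
    rcases Nat.lt_or_ge i (n + 1) with h | h
    · exact Or.inl ⟨i, Nat.le_of_lt_succ h, rfl⟩
    · obtain rfl : i = n + 1 := le_antisymm hi h
      exact Or.inr rfl

/-- Ripple-carry addition. -/
theorem computes_adc {w : ℕ} {f g : X → BitVec w} {c : X → Bool} (hf : vecBits f ⊆ W)
    (hg : vecBits g ⊆ W) (hc : c ∈ W) : Computes (boolOps X) W (6 * w)
      (vecBits fun x => f x + g x + BitVec.setWidth w (BitVec.ofBool (c x))) := by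
  refine ((computes_carry hf hg hc w le_rfl).trans (Computes.family w (k := 2) fun i hi => ?_)).mono
    subset_rfl subset_rfl (by omega)
  have h1 := Computes.of_mem (ops := boolOps X) (W := W ∪ (fun i x => (f x).carry i (g x) (c x))
    '' Set.Iic w) (Or.inl (hf (mem_vecBits f hi))) 0
  have h2 := Computes.of_mem (ops := boolOps X) (W := W ∪ (fun i x => (f x).carry i (g x) (c x))
    '' Set.Iic w) (Or.inl (hg (mem_vecBits g hi))) 0
  have h3 := Computes.of_mem (ops := boolOps X) (W := W ∪ (fun i x => (f x).carry i (g x) (c x))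
    '' Set.Iic w) (Or.inr ⟨i, hi.le, rfl⟩) 0
  convert Computes.bool xor h1 (Computes.bool xor h2 h3) using 3 with x
  rw [BitVec.getLsbD_add_add_bool hi]

theorem computes_add {w : ℕ} {f g : X → BitVec w} (hW : constBits X ⊆ W) (hf : vecBits f ⊆ W)
    (hg : vecBits g ⊆ W) : Computes (boolOps X) W (6 * w) (vecBits fun x => f x + g x) := by
  simpa using computes_adc hf hg (false_mem hW)

theorem computes_not {w : ℕ} {f : X → BitVec w} (hf : vecBits f ⊆ W) :
    Computes (boolOps X) W w (vecBits fun x => ~~~(f x)) := by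
  refine (Computes.family w (k := 1) fun i hi => ?_).mono subset_rfl subset_rfl (by omega)
  have h := Computes.of_mem (ops := boolOps X) (hf (mem_vecBits f hi)) 0
  convert Computes.bool (fun a _ => !a) h h using 3 with x
  simp [hi]

theorem computes_sub {w : ℕ} {f g : X → BitVec w} (hW : constBits X ⊆ W) (hf : vecBits f ⊆ W)
    (hg : vecBits g ⊆ W) : Computes (boolOps X) W (7 * w) (vecBits fun x => f x - g x) := by
  -- Two's complement: f - g = f + ~g + 1, the 1 being the incoming carry.
  have h := (computes_not hg).trans (computes_adc (hf.trans Set.subset_union_left)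
    Set.subset_union_right (Or.inl (true_mem hW)))
  refine h.mono subset_rfl (Eq.subset ?_) (by omega)
  congr 1
  funext x
  rw [BitVec.sub_eq_add_neg, BitVec.neg_eq_not_add, BitVec.add_assoc]
  congr 2
  rcases Nat.eq_zero_or_pos w with rfl | hw
  · exact Subsingleton.elim _ _
  · apply BitVec.eq_of_toNat_eq
    simp

theorem computes_ite {w : ℕ} {f : X → BitVec w} {c : X → Bool} (hf : vecBits f ⊆ W) (hc : c ∈ W) :
    Computes (boolOps X) W w (vecBits fun x => if c x then f x else 0) := by
  refine (Computes.family w (k := 1) fun i hi => ?_).mono subset_rfl subset_rfl (by omega)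
  have h := Computes.of_mem (ops := boolOps X) (hf (mem_vecBits f hi)) 0
  convert Computes.bool and (.of_mem hc 0) h using 3 with x
  by_cases hx : c x = true <;> simp [hx]

/-- A shift by a fixed amount only relabels wires and inserts constants, so it needs no gate. -/
theorem vecBits_shift {w : ℕ} {f : X → BitVec w} (hW : constBits X ⊆ W) (hf : vecBits f ⊆ W)
    (n : ℕ) : vecBits (fun x => f x <<< n) ⊆ W := by
  rintro _ ⟨i, hi, rfl⟩
  have hi' : i < w := hi
  by_cases h : i < n
  · simpa [hi', h] using false_mem hW
  · convert hf (mem_vecBits f (show i - n < w by omega)) using 2 with x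
    simp only [BitVec.getLsbD_shiftLeft, hi', h, decide_true, decide_false, Bool.not_false,
      Bool.true_and]

theorem computes_mulRec {w : ℕ} {f g : X → BitVec w} (hW : constBits X ⊆ W) (hf : vecBits f ⊆ W)
    (hg : vecBits g ⊆ W) (n : ℕ) :
    Computes (boolOps X) W ((n + 1) * (7 * w)) (vecBits fun x => (f x).mulRec (g x) n) := by
  have hbit : ∀ i, (fun x => (g x).getLsbD i) ∈ W := by
    intro i
    by_cases hi : i < w
    · exact hg (mem_vecBits g hi)
    · convert false_mem hW using 2 with x
      exact BitVec.getLsbD_of_ge _ _ (by omega)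
  induction n with
  | zero =>
    simp only [BitVec.mulRec_zero_eq]
    exact (computes_ite hf (hbit 0)).mono subset_rfl subset_rfl (by omega)
  | succ n ih =>
    simp only [BitVec.mulRec_succ_eq]
    refine ((ih.union (computes_ite (vecBits_shift hW hf (n + 1)) (hbit (n + 1)))).trans
      (computes_add (hW.trans Set.subset_union_left) ?_ ?_)).mono subset_rfl subset_rfl ?_
    · exact Set.subset_union_left.trans Set.subset_union_right
    · exact Set.subset_union_right.trans Set.subset_union_right
    · ring_nf
      omega

/-- Schoolbook multiplication suffices here: it is applied only to coefficients, whose width is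
logarithmic in the length of the integers to be multiplied. -/
theorem computes_mul {w : ℕ} {f g : X → BitVec w} (hW : constBits X ⊆ W) (hf : vecBits f ⊆ W)
    (hg : vecBits g ⊆ W) :
    Computes (boolOps X) W ((w + 1) * (7 * w)) (vecBits fun x => f x * g x) := by
  simpa only [BitVec.mul_eq_mulRec] using computes_mulRec hW hf hg w

theorem computes_ule {w : ℕ} {f g : X → BitVec w} (hW : constBits X ⊆ W) (hf : vecBits f ⊆ W)
    (hg : vecBits g ⊆ W) : Computes (boolOps X) W (5 * w) {fun x => (f x).ule (g x)} := by
  have h := (computes_not hf).trans (computes_carry (hg.trans Set.subset_union_left)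
    Set.subset_union_right (Or.inl (true_mem hW)) w le_rfl)
  refine h.mono subset_rfl ?_ (by omega)
  rintro _ rfl
  exact ⟨w, by simp, by simp [BitVec.ule_eq_carry]⟩

/-- Ring programs over bit vectors are simulated by circuits. -/
theorem Computes.of_ring {w k : ℕ} {A V : Set (X → BitVec w)} (h : Computes (ringOps _) A k V)
    (hW : constBits X ⊆ W) (hA : ∀ f ∈ A, vecBits f ⊆ W) :
    Computes (boolOps X) W (k * ((w + 1) * (7 * w))) (⋃ f ∈ V, vecBits f) := by
  refine h.simulate vecBits (constBits X) _ ?_ hW hA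
  rintro _ (rfl | rfl | rfl) u v W' h0 hu hv
  · exact (computes_add h0 hu hv).mono subset_rfl subset_rfl (by nlinarith)
  · exact (computes_sub h0 hu hv).mono subset_rfl subset_rfl (by nlinarith)
  · exact computes_mul h0 hu hv

/-! ### Circuits for the arithmetic of natural numbers -/

/-- The bits of a natural number depending on the input. -/
def natBits (f : X → ℕ) : Set (X → Bool) := Set.range fun i x => (f x).testBit i

theorem vecBits_ofNat_subset {f : X → ℕ} (hf : natBits f ⊆ W) (w : ℕ) :
    vecBits (fun x => BitVec.ofNat w (f x)) ⊆ W := by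
  rintro _ ⟨i, hi, rfl⟩
  have hi' : i < w := hi
  convert hf ⟨i, rfl⟩ using 2 with x
  simp only [BitVec.getLsbD_ofNat, hi', decide_true, Bool.true_and]

/-- `natBits` asks for the bits at all positions; those beyond the width are constantly false and
hence available. -/
theorem natBits_toNat_subset {w : ℕ} {f : X → BitVec w} (hW : constBits X ⊆ W)
    (hf : vecBits f ⊆ W) : natBits (fun x => (f x).toNat) ⊆ W := by
  rintro _ ⟨i, rfl⟩
  by_cases hi : i < w
  · exact hf (mem_vecBits f hi)
  · convert false_mem hW using 2 with x
    exact BitVec.getLsbD_of_ge _ _ (by omega)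

theorem Computes.natBits_of_vecBits {w k : ℕ} {f : X → BitVec w} {g : X → ℕ}
    (hW : constBits X ⊆ W) (h : Computes (boolOps X) W k (vecBits f))
    (hg : ∀ x, g x = (f x).toNat) : Computes (boolOps X) W k (natBits g) := by
  obtain rfl : g = fun x => (f x).toNat := funext hg
  exact h.carry.mono subset_rfl (natBits_toNat_subset (hW.trans Set.subset_union_left)
    Set.subset_union_right) le_rfl |>.mono subset_rfl subset_rfl le_rfl

theorem computes_nat_add {w : ℕ} {f g : X → ℕ} (hW : constBits X ⊆ W) (hf : natBits f ⊆ W)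
    (hg : natBits g ⊆ W) (hf' : ∀ x, f x < 2 ^ w) (hg' : ∀ x, g x < 2 ^ w) :
    Computes (boolOps X) W (6 * (w + 1)) (natBits fun x => f x + g x) := by
  refine (computes_add hW (vecBits_ofNat_subset hf (w + 1))
    (vecBits_ofNat_subset hg (w + 1))).natBits_of_vecBits hW fun x => ?_
  rw [BitVec.toNat_add, BitVec.toNat_ofNat, BitVec.toNat_ofNat, ← Nat.add_mod,
    Nat.mod_eq_of_lt]
  have := hf' x
  have := hg' x
  rw [pow_succ]
  omega

theorem computes_nat_le {w : ℕ} {f g : X → ℕ} (hW : constBits X ⊆ W) (hf : natBits f ⊆ W)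
    (hg : natBits g ⊆ W) (hf' : ∀ x, f x < 2 ^ w) (hg' : ∀ x, g x < 2 ^ w) :
    Computes (boolOps X) W (5 * w) {fun x => decide (f x ≤ g x)} := by
  convert computes_ule hW (vecBits_ofNat_subset hf w) (vecBits_ofNat_subset hg w) using 3 with x
  rw [BitVec.ule, BitVec.toNat_ofNat, BitVec.toNat_ofNat, Nat.mod_eq_of_lt (hf' x),
    Nat.mod_eq_of_lt (hg' x)]

theorem Computes.nat_of_bool {k : ℕ} {c : X → Prop} [DecidablePred c] (hW : constBits X ⊆ W)
    (h : Computes (boolOps X) W k {fun x => decide (c x)}) :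
    Computes (boolOps X) W k (natBits fun x => if c x then 1 else 0) := by
  refine h.carry.mono subset_rfl ?_ le_rfl
  rintro _ ⟨i, rfl⟩
  cases i with
  | zero =>
    refine Or.inr ?_
    simp only [Set.mem_singleton_iff]
    funext x
    split_ifs with h <;> simp [h]
  | succ i =>
    refine Or.inl ?_
    convert false_mem hW using 2 with x
    by_cases hx : c x <;> simp [hx, Nat.testBit_succ]

theorem computes_nat_sub {w : ℕ} {f g : X → ℕ} (hW : constBits X ⊆ W) (hf : natBits f ⊆ W)
    (hg : natBits g ⊆ W) (hf' : ∀ x, f x < 2 ^ w) (hg' : ∀ x, g x < 2 ^ w) :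
    Computes (boolOps X) W (13 * w) (natBits fun x => f x - g x) := by
  -- The wrapped difference is masked with the bit g ≤ f, which realizes truncation at 0.
  have h1 := (computes_nat_le hW hg hf hg' hf').union
    (computes_sub hW (vecBits_ofNat_subset hf w) (vecBits_ofNat_subset hg w))
  have h2 := h1.trans (computes_ite (Set.subset_union_right.trans Set.subset_union_right)
    (Or.inr (Or.inl rfl)))
  refine (h2.mono subset_rfl subset_rfl (k' := 13 * w) (by omega)).natBits_of_vecBits hW
    fun x => ?_
  have hfx := hf' x
  have hgx := hg' x
  by_cases h : g x ≤ f x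
  · rw [decide_eq_true h, if_pos rfl, BitVec.toNat_sub, BitVec.toNat_ofNat, BitVec.toNat_ofNat,
      Nat.mod_eq_of_lt hfx, Nat.mod_eq_of_lt hgx,
      show 2 ^ w - g x + f x = f x - g x + 2 ^ w by omega, Nat.add_mod_right,
      Nat.mod_eq_of_lt (by omega)]
  · rw [decide_eq_false h]
    simp
    omega

theorem natBits_shift {f : X → ℕ} (hW : constBits X ⊆ W) (hf : natBits f ⊆ W) (n : ℕ) :
    natBits (fun x => 2 ^ n * f x) ⊆ W := by
  rintro _ ⟨i, rfl⟩
  by_cases h : n ≤ i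
  · simpa [Nat.testBit_two_pow_mul, h] using hf ⟨i - n, rfl⟩
  · simpa [Nat.testBit_two_pow_mul, h] using false_mem hW

theorem sum_shift_lt {L : ℕ} {f : ℕ → ℕ} (hf : ∀ i, f i < 2 ^ L) (n : ℕ) :
    ∑ i ∈ Finset.range n, 2 ^ i * f i < 2 ^ (n + L) := by
  -- The bound 2^(n+L) alone is not inductive; the slack 2^L absorbs the next summand.
  have key : ∑ i ∈ Finset.range n, 2 ^ i * f i + 2 ^ L ≤ 2 ^ n * 2 ^ L := by
    induction n with
    | zero => simp
    | succ n ih =>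
      rw [Finset.sum_range_succ, pow_succ]
      have := Nat.mul_le_mul_left (2 ^ n) (hf n).le
      linarith
  rw [pow_add]
  have : 0 < 2 ^ L := by positivity
  omega

/-- Summation of numbers at consecutive bit positions. -/
theorem computes_sum_shift {L : ℕ} (hW : constBits X ⊆ W) (j : ℕ) (f : ℕ → X → ℕ)
    (hf : ∀ i < 2 ^ j, natBits (f i) ⊆ W) (hf' : ∀ i x, f i x < 2 ^ L) :
    Computes (boolOps X) W (2 ^ j * (6 * (j + 1) * (L + 2)))
      (natBits fun x => ∑ i ∈ Finset.range (2 ^ j), 2 ^ i * f i x) := by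
  induction j generalizing f with
  | zero =>
    exact .of_subset (by simpa using hf 0 (by simp))
  | succ j ih =>
    have hpow : 2 ^ (j + 1) = 2 ^ j + 2 ^ j := by ring
    -- Balanced splitting: the two half sums are merged by one long addition, so each of the j
    -- levels costs about 2^j + L gates per node, with node lengths halving. Adding the terms one
    -- after another would be quadratic.
    have h1 := ih f (fun i hi => hf i (by omega)) hf'
    have h2 := ih (fun i => f (2 ^ j + i)) (fun i hi => hf _ (by omega))
      (fun i => hf' _)
    have hsum : ∀ x, ∑ i ∈ Finset.range (2 ^ (j + 1)), 2 ^ i * f i x =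
        ∑ i ∈ Finset.range (2 ^ j), 2 ^ i * f i x +
          2 ^ 2 ^ j * ∑ i ∈ Finset.range (2 ^ j), 2 ^ i * f (2 ^ j + i) x := by
      intro x
      rw [hpow, Finset.sum_range_add, Finset.mul_sum]
      congr 1
      refine Finset.sum_congr rfl fun i _ => ?_
      rw [pow_add, mul_assoc]
    have hlo : ∀ x, ∑ i ∈ Finset.range (2 ^ j), 2 ^ i * f i x < 2 ^ (2 ^ (j + 1) + L) :=
      fun x => (sum_shift_lt (fun i => hf' i x) _).trans_le (Nat.pow_le_pow_right (by norm_num)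
        (Nat.add_le_add_right (Nat.pow_le_pow_right (by norm_num) (by omega)) L))
    have hhi : ∀ x, 2 ^ 2 ^ j * ∑ i ∈ Finset.range (2 ^ j), 2 ^ i * f (2 ^ j + i) x <
        2 ^ (2 ^ (j + 1) + L) := fun x => by
      rw [hpow, add_assoc, pow_add]
      exact Nat.mul_lt_mul_of_pos_left (sum_shift_lt (fun i => hf' _ x) _) (by positivity)
    simp only [hsum]
    refine ((h1.union h2).trans (computes_nat_add (hW.trans Set.subset_union_left)
      (Set.subset_union_left.trans Set.subset_union_right)
      (natBits_shift (hW.trans Set.subset_union_left)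
        (Set.subset_union_right.trans Set.subset_union_right) (2 ^ j)) hlo hhi)).mono subset_rfl
      subset_rfl ?_
    have hJ : 1 ≤ 2 ^ j := Nat.one_le_two_pow
    rw [hpow]
    nlinarith

end Circuits
end SumRank

/-! ### From polynomial products to integer products. -/

namespace SumRank

section Multiplication

open Polynomial

/-- The polynomial whose coefficients are the `n` lowest bits of `m`. -/
noncomputable def bitPoly (m n : ℕ) : ℕ[X] :=
  ∑ i ∈ Finset.range n, C (m.testBit i).toNat * X ^ i

theorem eval_bitPoly {m n : ℕ} (h : m < 2 ^ n) : (bitPoly m n).eval 2 = m := by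
  have key : (bitPoly m n).eval 2 = m % 2 ^ n := by
    unfold bitPoly
    clear h
    induction n with
    | zero => simp [Nat.mod_one]
    | succ n ih =>
      rw [Finset.sum_range_succ, eval_add, ih, Nat.mod_pow_succ]
      simp [mul_comm, Nat.toNat_testBit]
  rw [key, Nat.mod_eq_of_lt h]

theorem bitPoly_natDegree_lt {m n : ℕ} (hn : 0 < n) : (bitPoly m n).natDegree < n := by
  unfold bitPoly
  refine (Polynomial.natDegree_sum_le _ _).trans_lt ?_
  rw [Finset.fold_max_lt]
  exact ⟨hn, fun i hi => (Polynomial.natDegree_C_mul_X_pow_le _ _).trans_lt (Finset.mem_range.1 hi)⟩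

theorem bitPoly_coeff_le (m n i : ℕ) : (bitPoly m n).coeff i ≤ 1 := by
  unfold bitPoly
  simp only [finsetSum_coeff, coeff_C_mul, coeff_X_pow, mul_ite, mul_one, mul_zero]
  rw [Finset.sum_ite_eq]
  split_ifs
  · exact Bool.toNat_le _
  · exact Nat.zero_le _

/-- Coefficient i collects i + 1 products of two bits. For i < 2^j it therefore fits into j + 1
bits. -/
theorem bitPoly_mul_coeff_le (m m' n i : ℕ) : (bitPoly m n * bitPoly m' n).coeff i ≤ i + 1 := by
  rw [coeff_mul]
  calc _ ≤ ∑ _p ∈ Finset.HasAntidiagonal.antidiagonal i, 1 := Finset.sum_le_sum fun p _ =>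
        Nat.mul_le_mul (bitPoly_coeff_le m n p.1) (bitPoly_coeff_le m' n p.2)
    _ = i + 1 := by simp

/-- A polynomial product of degree less than `N` is determined modulo `x ^ N + 1`. -/
theorem coeff_of_negacyclic {S : Type} [CommRing S] {N e : ℕ} (hN : 0 < N) (c : ℕ → S) (p : S[X])
    (hp : p.degree < N)
    (h : (X : S[X]) ^ N + 1 ∣ ∑ i ∈ Finset.range N, C (c i) * X ^ i - 2 ^ e * p) {i : ℕ}
    (hi : i < N) : c i = 2 ^ e * p.coeff i := by
  nontriviality S
  have hmon : ((X : S[X]) ^ N + 1).Monic := by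
    simpa using Polynomial.monic_X_pow_add_C (1 : S) (n := N) (by omega)
  have hdeg : ((X : S[X]) ^ N + 1).degree = N := by
    simpa using Polynomial.degree_X_pow_add_C (n := N) (by omega) (1 : S)
  have h0 : ∑ i ∈ Finset.range N, C (c i) * X ^ i - 2 ^ e * p = 0 := by
    by_contra hne
    refine hmon.not_dvd_of_degree_lt hne ?_ h
    rw [hdeg]
    refine (Polynomial.degree_sub_le _ _).trans_lt (max_lt ?_ ?_)
    · refine (Polynomial.degree_sum_le _ _).trans_lt ((Finset.sup_lt_iff (by simp)).2 fun i hi => ?_)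
      refine (Polynomial.degree_C_mul_X_pow_le _ _).trans_lt ?_
      exact_mod_cast Finset.mem_range.1 hi
    · have e2 : (2 ^ e : S[X]) = C (2 ^ e) := by rw [C_pow, C_ofNat]
      rw [e2, ← Polynomial.smul_eq_C_mul]
      exact (Polynomial.degree_smul_le _ _).trans_lt hp
  have h1 := congrArg (fun q => coeff q i) (sub_eq_zero.1 h0)
  have e2 : (2 ^ e : S[X]) = C (2 ^ e) := by rw [C_pow, C_ofNat]
  simp only [finsetSum_coeff, coeff_C_mul, coeff_X_pow, mul_ite, mul_one, mul_zero, e2] at h1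
  rwa [Finset.sum_ite_eq, if_pos (Finset.mem_range.2 hi)] at h1

variable {X₀ : Type} {W : Set (X₀ → Bool)}

/-- Quasi-linear multiplication of integers. -/
theorem computes_nat_mul {j n : ℕ} {f g : X₀ → ℕ} (hW : constBits X₀ ⊆ W) (hf : natBits f ⊆ W)
    (hg : natBits g ⊆ W) (hn : 0 < n) (hj : 2 * n ≤ 2 ^ j) (hf' : ∀ x, f x < 2 ^ n)
    (hg' : ∀ x, g x < 2 ^ n) :
    Computes (boolOps X₀) W (2 ^ j * (2600 * (j + 1) ^ 5)) (natBits fun x => f x * g x) := by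
  obtain ⟨K, e, hK, he, hmul⟩ := exists_negacyclicMul j
  -- The transform returns each product coefficient multiplied by 2^e. Coefficients are below
  -- 2^(j+1), so with e + j + 1 bits nothing wraps around, and dropping the e low bits recovers them
  -- although 2 is not invertible modulo 2^w.
  set w := e + (j + 1) with hw
  set N := 2 ^ j with hN
  set coef : (X₀ → ℕ) → ℕ → X₀ → BitVec w := fun f i x =>
    if i < n then BitVec.ofNat w ((f x).testBit i).toNat else 0 with hcoef
  have hbits : ∀ f : X₀ → ℕ, natBits f ⊆ W → ∀ i, vecBits (coef f i) ⊆ W := by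
    rintro f hf i _ ⟨k, hk, rfl⟩
    have hk' : k < w := hk
    simp only [hcoef]
    by_cases hi : i < n
    · simp only [hi, if_true, BitVec.getLsbD_ofNat, hk', decide_true, Bool.true_and]
      cases k with
      | zero =>
        convert hf ⟨i, rfl⟩ using 2 with x
        cases h : (f x).testBit i <;> simp [h]
      | succ k =>
        convert false_mem hW using 2 with x
        cases (f x).testBit i <;> simp [Nat.testBit_succ]
    · simpa [hi] using false_mem hW
  -- Functions from inputs to bit vectors form a commutative ring. One ring program over it treats
  -- all inputs simultaneously, which is exactly what a circuit has to do.
  obtain ⟨c, hc, hc'⟩ := hmul (X₀ → BitVec w) (coef f) (coef g)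
    (insert 0 (Set.range (coef f) ∪ Set.range (coef g))) (Set.mem_insert _ _)
    ((Set.image_subset_range _ _).trans (Set.subset_union_left.trans (Set.subset_insert _ _)))
    ((Set.image_subset_range _ _).trans (Set.subset_union_right.trans (Set.subset_insert _ _)))
  have hring := hc.of_ring hW (by
    rintro _ (rfl | ⟨i, rfl⟩ | ⟨i, rfl⟩)
    · rintro _ ⟨k, -, rfl⟩
      simpa using false_mem hW
    · exact hbits f hf i
    · exact hbits g hg i)
  have hval : ∀ i < N, ∀ x, (c i x).toNat / 2 ^ e = (bitPoly (f x) n * bitPoly (g x) n).coeff i := by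
    intro i hi x
    have hpoly : ∀ f : X₀ → ℕ, ∑ i ∈ Finset.range N, C (coef f i x) * X ^ i =
        (bitPoly (f x) n).map (Nat.castRingHom (BitVec w)) := by
      intro f
      have hnN : n ≤ N := by omega
      rw [← Finset.sum_subset (Finset.range_mono hnN)]
      · unfold bitPoly
        rw [Polynomial.map_sum]
        refine Finset.sum_congr rfl fun i hi => ?_
        simp only [hcoef, Finset.mem_range.1 hi, if_true, Polynomial.map_mul, Polynomial.map_pow,
          map_X, map_C, Nat.coe_castRingHom]
        rfl
      · intro i _ hi
        have h0 : coef f i x = 0 := if_neg (Finset.mem_range.not.1 hi)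
        rw [h0, C_0, zero_mul]
    have hdvd : (X : (BitVec w)[X]) ^ N + 1 ∣ ∑ i ∈ Finset.range N, C (c i x) * X ^ i -
        2 ^ e * (bitPoly (f x) n * bitPoly (g x) n).map (Nat.castRingHom (BitVec w)) := by
      -- In this quotient the class of X satisfies y^N = -1, and an identity at that point is a
      -- congruence modulo X^N + 1.
      set I : Ideal (BitVec w)[X] := Ideal.span {X ^ N + 1} with hI
      set φ : (X₀ → BitVec w) →+* (BitVec w)[X] ⧸ I :=
        (Ideal.Quotient.mk I).comp (C.comp (Pi.evalRingHom _ x)) with hφ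
      have hev : ∀ a : ℕ → X₀ → BitVec w, evalSeq φ N a (Ideal.Quotient.mk I X) =
          Ideal.Quotient.mk I (∑ i ∈ Finset.range N, C (a i x) * X ^ i) := by
        intro a
        simp [evalSeq, hφ]
      have h := hc' _ φ (Ideal.Quotient.mk I X) (by
        rw [← map_pow, ← sub_eq_zero, sub_neg_eq_add, ← map_one (Ideal.Quotient.mk I), ← map_add]
        exact Ideal.Quotient.eq_zero_iff_mem.2 (Ideal.subset_span rfl))
      rw [hev, hev, hev, hpoly f, hpoly g] at h
      rw [← Ideal.mem_span_singleton, ← Ideal.Quotient.eq_zero_iff_mem, map_sub, h]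
      rw [Polynomial.map_mul, map_mul, map_mul, map_pow, map_ofNat, sub_self]
    have hdeg : ((bitPoly (f x) n * bitPoly (g x) n).map (Nat.castRingHom (BitVec w))).degree
        < N := by
      refine (Polynomial.degree_le_natDegree).trans_lt ?_
      have h1 := bitPoly_natDegree_lt (m := f x) hn
      have h2 := bitPoly_natDegree_lt (m := g x) hn
      have h3 := Polynomial.natDegree_map_le (f := Nat.castRingHom (BitVec w))
        (p := bitPoly (f x) n * bitPoly (g x) n)
      have h4 := Polynomial.natDegree_mul_le (p := bitPoly (f x) n) (q := bitPoly (g x) n)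
      exact_mod_cast (by omega : _ < N)
    have h := coeff_of_negacyclic (by positivity) (fun i => c i x) _ hdeg hdvd hi
    have hle := bitPoly_mul_coeff_le (f x) (g x) n i
    set v := (bitPoly (f x) n * bitPoly (g x) n).coeff i with hv
    rw [Polynomial.coeff_map, ← hv] at h
    have h' : c i x = ((2 ^ e * v : ℕ) : BitVec w) := by
      rw [h]
      push_cast
      rfl
    have hlt : 2 ^ e * v < 2 ^ w := by
      rw [hw, pow_add]
      refine Nat.mul_lt_mul_of_pos_left ?_ (by positivity)
      rw [pow_succ]
      omega
    rw [h', BitVec.natCast_eq_ofNat, BitVec.toNat_ofNat, Nat.mod_eq_of_lt hlt,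
      Nat.mul_div_cancel_left _ (by positivity)]
  have hsum : ∀ x, f x * g x = ∑ i ∈ Finset.range N, 2 ^ i * ((c i x).toNat / 2 ^ e) := by
    intro x
    have h1 := bitPoly_natDegree_lt (m := f x) hn
    have h2 := bitPoly_natDegree_lt (m := g x) hn
    have h4 := Polynomial.natDegree_mul_le (p := bitPoly (f x) n) (q := bitPoly (g x) n)
    conv_lhs => rw [← eval_bitPoly (hf' x), ← eval_bitPoly (hg' x), ← eval_mul]
    rw [Polynomial.eval_eq_sum_range' (n := N) (by omega)]
    refine Finset.sum_congr rfl fun i hi => ?_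
    rw [hval i (Finset.mem_range.1 hi) x, mul_comm]
  have hfin := hring.trans (computes_sum_shift (L := j + 1)
    (W := W ∪ ⋃ f ∈ c '' Set.Iio (2 ^ j), vecBits f)
    (hW.trans Set.subset_union_left) j (fun i x => (c i x).toNat / 2 ^ e) ?_ ?_)
  · refine (hfin.mono subset_rfl (Eq.subset ?_) ?_)
    · congr 1
      funext x
      exact hsum x
    · have h1 : (w + 1) * (7 * w) ≤ 63 * (j + 1) ^ 2 := by
        calc (w + 1) * (7 * w) ≤ (3 * (j + 1)) * (7 * (3 * (j + 1))) :=
              Nat.mul_le_mul (by omega) (by omega)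
          _ = _ := by ring
      calc K * ((w + 1) * (7 * w)) + N * (6 * (j + 1) * (j + 1 + 2))
          ≤ (N * (40 * (j + 1) ^ 3)) * (63 * (j + 1) ^ 2) + N * (6 * (j + 1) * (3 * (j + 1))) := by
            gcongr
            omega
        _ = N * (2520 * (j + 1) ^ 5 + 18 * (j + 1) ^ 2) := by ring
        _ ≤ N * (2520 * (j + 1) ^ 5 + 80 * (j + 1) ^ 5) := by
            gcongr <;> omega
        _ = _ := by ring
  · rintro i hi _ ⟨k, rfl⟩
    have := natBits_toNat_subset (f := c i) (hW.trans Set.subset_union_left)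
      (W := W ∪ ⋃ f ∈ c '' Set.Iio (2 ^ j), vecBits f)
      ((Set.subset_biUnion_of_mem (s := c '' Set.Iio (2 ^ j)) (u := vecBits) (Set.mem_image_of_mem c hi)).trans Set.subset_union_right)
    convert this ⟨e + k, rfl⟩ using 2
    exact funext fun x => by beta_reduce; rw [Nat.testBit_div_two_pow, add_comm]
  · intro i x
    rw [Nat.div_lt_iff_lt_mul (by positivity), ← pow_add, add_comm]
    exact (c i x).isLt

end Multiplication

/-! ### An efficient implementation of integer arithmetic -/

/-- The constants are not among the operand bits; two gates that ignore their inputs provide them.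
Bit 0 of the first operand exists as a function even if a = 0. -/
theorem exists_computableWith {f : ℕ → ℕ → ℕ} {a b k : ℕ}
    (h : ∀ W : Set (Operands a b → Bool), constBits _ ⊆ W →
      natBits (fun p : Operands a b => p.1.1) ⊆ W → natBits (fun p : Operands a b => p.2.1) ⊆ W →
      Computes (boolOps _) W k (natBits fun p => f p.1.1 p.2.1)) :
    ∃ k' ≤ k + 2, ComputableWith f a b k' := by
  have hmem : (fun p : Operands a b => p.1.1.testBit 0) ∈ operandBits a b := ⟨0, Or.inl rfl⟩
  have h0 := ((StraightLine.start (I := operandBits a b)).gate (fun _ _ => false) hmem hmem).gate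
    (fun _ _ => true) (Set.mem_insert_of_mem _ hmem) (Set.mem_insert_of_mem _ hmem)
  obtain ⟨i, hi, W, hW, hsub⟩ := h0.extend (h _ (by
      rintro _ (rfl | rfl)
      · exact Set.mem_insert_of_mem _ (Set.mem_insert _ _)
      · exact Set.mem_insert _ _)
    (by
      rintro _ ⟨i, rfl⟩
      exact Set.mem_insert_of_mem _ (Set.mem_insert_of_mem _ ⟨i, Or.inl rfl⟩))
    (by
      rintro _ ⟨i, rfl⟩
      exact Set.mem_insert_of_mem _ (Set.mem_insert_of_mem _ ⟨i, Or.inr rfl⟩)))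
  exact ⟨i, by omega, W, hW, fun i => hsub ⟨i, rfl⟩⟩

/-- A quasi-linear bound for the number of gates. -/
def gateBound (n : ℕ) : ℕ := n * (100000 * (n.size + 3) ^ 5)

theorem exists_gates (o : Arith) (a b : ℕ) :
    ∃ k ≤ gateBound (a + b + 1), ComputableWith o.eval a b k := by
  set n := a + b + 1 with hn
  have hx : ∀ p : Operands a b, p.1.1 < 2 ^ n := fun p =>
    p.1.2.trans_le (Nat.pow_le_pow_right (by norm_num) (by omega))
  have hy : ∀ p : Operands a b, p.2.1 < 2 ^ n := fun p =>
    p.2.2.trans_le (Nat.pow_le_pow_right (by norm_num) (by omega))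
  have hn0 : 0 < n := by omega
  have hlin : n * 100 ≤ gateBound n := by
    unfold gateBound
    refine Nat.mul_le_mul_left _ ?_
    have : 1 ≤ (n.size + 3) ^ 5 := Nat.one_le_pow _ _ (by omega)
    omega
  suffices h : ∃ k, k + 2 ≤ gateBound n ∧ ∀ W : Set (Operands a b → Bool), constBits _ ⊆ W →
      natBits (fun p : Operands a b => p.1.1) ⊆ W → natBits (fun p : Operands a b => p.2.1) ⊆ W →
      Computes (boolOps _) W k (natBits fun p => o.eval p.1.1 p.2.1) by
    obtain ⟨k, hk, h⟩ := h
    obtain ⟨k', hk', h'⟩ := exists_computableWith h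
    exact ⟨k', by omega, h'⟩
  cases o with
  | add => exact ⟨6 * (n + 1), by omega, fun W h0 h1 h2 => computes_nat_add h0 h1 h2 hx hy⟩
  | sub => exact ⟨13 * n, by omega, fun W h0 h1 h2 => computes_nat_sub h0 h1 h2 hx hy⟩
  | mul =>
    -- The length 2^(size n + 1) lies between 2n, needed for the product polynomial, and 4n, needed
    -- for linear size.
    refine ⟨2 ^ (n.size + 1) * (2600 * (n.size + 1 + 1) ^ 5), ?_, fun W h0 h1 h2 =>
      computes_nat_mul h0 h1 h2 hn0 ?_ hx hy⟩
    · have hs : 2 ^ (n.size + 1) ≤ 4 * n := by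
        have h1 : 2 ^ (n.size - 1) ≤ n := Nat.lt_size.1 (by have := Nat.size_pos.2 hn0; omega)
        have h2 : n.size + 1 = n.size - 1 + 2 := by have := Nat.size_pos.2 hn0; omega
        rw [h2, pow_add]
        omega
      have h3 : (n.size + 1 + 1) ^ 5 ≤ (n.size + 3) ^ 5 := Nat.pow_le_pow_left (by omega) 5
      have h4 : 1 ≤ (n.size + 3) ^ 5 := Nat.one_le_pow _ _ (by omega)
      calc 2 ^ (n.size + 1) * (2600 * (n.size + 1 + 1) ^ 5) + 2
          ≤ 4 * n * (2600 * (n.size + 3) ^ 5) + 2 := by gcongr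
        _ ≤ 4 * n * (2600 * (n.size + 3) ^ 5) + 2 * (n * (n.size + 3) ^ 5) := by
            have : 1 ≤ n * (n.size + 3) ^ 5 := Nat.mul_pos hn0 h4
            omega
        _ = n * (10402 * (n.size + 3) ^ 5) := by ring
        _ ≤ _ := Nat.mul_le_mul_left _ (Nat.mul_le_mul_right _ (by norm_num))
    · rw [pow_succ']
      exact Nat.mul_le_mul_left 2 (Nat.lt_size_self n).le
  | le => exact ⟨5 * n, by omega, fun W h0 h1 h2 => (computes_nat_le h0 h1 h2 hx hy).nat_of_bool h0⟩
  | eq =>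
    refine ⟨5 * n + 5 * n + 1, by omega, fun W h0 h1 h2 => Computes.nat_of_bool h0 ?_⟩
    convert Computes.bool and (computes_nat_le h0 h1 h2 hx hy) (computes_nat_le h0 h2 h1 hy hx)
      using 3 with p
    rw [← Bool.decide_and]
    exact decide_eq_decide.2 le_antisymm_iff

/-- Integer arithmetic with a quasi-linear number of gates. -/
noncomputable def fastArithmetic : BitArithmetic where
  gates o a b := (exists_gates o a b).choose
  computes o a b := (exists_gates o a b).choose_spec.2

theorem fastArithmetic_gates_le (o : Arith) (a b : ℕ) :
    fastArithmetic.gates o a b ≤ gateBound (a + b + 1) := (exists_gates o a b).choose_spec.1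

end SumRank

namespace SumRank

/-! ### Gaussian binomial coefficients -/

/-- The `q`-Pascal recursion. -/
def qBinom (q : ℕ) : ℕ → ℕ → ℕ
  | _, 0 => 1
  | 0, _ + 1 => 0
  | a + 1, b + 1 => qBinom q a b + q ^ (b + 1) * qBinom q a (b + 1)

/-- The product `(q ^ 1 - 1) ⋯ (q ^ k - 1)`. -/
def qFact (q k : ℕ) : ℕ := ∏ i ∈ Finset.range k, (q ^ (i + 1) - 1)

theorem qFact_succ (q k : ℕ) : qFact q (k + 1) = qFact q k * (q ^ (k + 1) - 1) :=
  Finset.prod_range_succ _ _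

theorem qFact_pos {q : ℕ} (hq : 2 ≤ q) (k : ℕ) : 0 < qFact q k :=
  Finset.prod_pos fun i _ => Nat.sub_pos_of_lt (Nat.one_lt_pow (by omega) (by omega))

@[simp] theorem qBinom_zero_right (q a : ℕ) : qBinom q a 0 = 1 := by cases a <;> rfl

theorem qBinom_eq_zero (q : ℕ) {a b : ℕ} (h : a < b) : qBinom q a b = 0 := by
  induction a generalizing b with
  | zero => cases b with
    | zero => omega
    | succ b => rfl
  | succ a ih => cases b with
    | zero => omega
    | succ b => rw [qBinom, ih (by omega), ih (by omega)]; simp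

theorem qBinom_self (q a : ℕ) : qBinom q a a = 1 := by
  induction a with
  | zero => rfl
  | succ a ih => rw [qBinom, ih, qBinom_eq_zero q (Nat.lt_succ_self a)]; simp

/-- The Pascal recursion matches the factorial quotient because q^(b+c+2) - 1 = (q^(b+1) - 1) +
q^(b+1)·(q^(c+1) - 1). -/
theorem qBinom_mul_qFact {q : ℕ} (hq : 2 ≤ q) (b c : ℕ) :
    qBinom q (b + c) b * (qFact q b * qFact q c) = qFact q (b + c) := by
  induction hn : b + c generalizing b c with
  | zero =>
    obtain ⟨rfl, rfl⟩ : b = 0 ∧ c = 0 := by omega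
    simp [qFact]
  | succ n ih =>
    rcases b with _ | b
    · obtain rfl : c = n + 1 := by omega
      simp [qFact]
    rcases c with _ | c
    · obtain rfl : b = n := by omega
      rw [qBinom_self]
      simp [qFact]
    obtain rfl : n = b + c + 1 := by omega
    have h1 := ih b (c + 1) (by omega)
    have h2 := ih (b + 1) c (by omega)
    rw [qBinom, qFact_succ q (b + c + 1)]
    have hb : 1 ≤ q ^ (b + 1) := Nat.one_le_pow _ _ (by omega)
    have hc : 1 ≤ q ^ (c + 1) := Nat.one_le_pow _ _ (by omega)
    have hbc : 1 ≤ q ^ (b + c + 1 + 1) := Nat.one_le_pow _ _ (by omega)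
    rw [qFact_succ q c] at h1 ⊢
    rw [qFact_succ q b] at h2 ⊢
    zify [hb, hc, hbc] at h1 h2 ⊢
    rw [show b + c + 1 + 1 = (b + 1) + (c + 1) by ring, pow_add]
    linear_combination ((q : ℤ) ^ (b + 1) - 1) * h1 + q ^ (b + 1) * ((q : ℤ) ^ (c + 1) - 1) * h2

/-- Each factor is q^i·(q^(b+c-i) - 1); the second parts are the top b factors of `qFact q (b + c)`.
-/
theorem prod_sub_mul_qFact (q b c : ℕ) :
    (∏ i ∈ Finset.range b, (q ^ (b + c) - q ^ i)) * qFact q c =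
      (∏ i ∈ Finset.range b, q ^ i) * qFact q (b + c) := by
  induction b with
  | zero => simp
  | succ b ih =>
    have h1 : ∀ i, q ^ (b + 1 + c) - q ^ (i + 1) = q * (q ^ (b + c) - q ^ i) := by
      intro i
      rw [Nat.mul_sub]
      congr 1 <;> ring
    rw [Finset.prod_range_succ', Finset.prod_congr rfl fun i _ => h1 i, Finset.prod_mul_distrib,
      Finset.prod_const, Finset.card_range, Finset.prod_range_succ,
      show b + 1 + c = b + c + 1 by ring, qFact_succ, pow_zero]
    linear_combination (q ^ b * (q ^ (b + c + 1) - 1)) * ih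

section Count

variable (F : Type) [Field F] [Fintype F]

/-- A linearly independent family is a basis of its span. -/
noncomputable def linearIndependentEquiv (a b : ℕ) :
    {s : Fin b → Fin a → F // LinearIndependent F s} ≃
      Σ W : {W : Submodule F (Fin a → F) // Module.finrank F W = b},
        {s : Fin b → W.1 // LinearIndependent F s} where
  toFun s := ⟨⟨Submodule.span F (Set.range s.1), by
      rw [finrank_span_eq_card s.2, Fintype.card_fin]⟩,
    ⟨fun i => ⟨s.1 i, Submodule.subset_span ⟨i, rfl⟩⟩, by
      rw [← LinearMap.linearIndependent_iff (Submodule.subtype _) (Submodule.ker_subtype _)]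
      exact s.2⟩⟩
  invFun p := ⟨fun i => (p.2.1 i : Fin a → F), by
    exact p.2.2.map' (Submodule.subtype _) (Submodule.ker_subtype _)⟩
  left_inv s := rfl
  right_inv := by
    rintro ⟨⟨W, hW⟩, ⟨s, hs⟩⟩
    have hspan : Submodule.span F (Set.range fun i => (s i : Fin a → F)) = W := by
      have hs' : LinearIndependent F fun i => (s i : Fin a → F) :=
        hs.map' (Submodule.subtype _) (Submodule.ker_subtype _)
      refine Submodule.eq_of_le_of_finrank_eq ?_ ?_
      · rw [Submodule.span_le]
        rintro _ ⟨i, rfl⟩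
        exact (s i).2
      · rw [finrank_span_eq_card hs', Fintype.card_fin, hW]
    -- The span equals W only propositionally, and the second component depends on it; the equality
    -- of pairs is proved for a general W' so that W' can be substituted away.
    have key : ∀ (W' : Submodule F (Fin a → F)) (hW' : Module.finrank F W' = b)
        (s' : Fin b → W') (hs' : LinearIndependent F s'), W' = W →
        (∀ i, (s' i : Fin a → F) = s i) →
        (⟨⟨W', hW'⟩, ⟨s', hs'⟩⟩ : Σ W : {W : Submodule F (Fin a → F) // Module.finrank F W = b},
          {s : Fin b → W.1 // LinearIndependent F s}) = ⟨⟨W, hW⟩, ⟨s, hs⟩⟩ := by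
      rintro W' hW' s' hs' rfl h
      obtain rfl : s' = s := funext fun i => Subtype.ext (h i)
      rfl
    exact key _ _ _ _ hspan fun i => rfl

/-- Linearly independent b-tuples are counted twice: directly, and grouped by the subspace they
span, where each subspace has the same number of bases. -/
theorem gaussBinom_mul_prod {a b : ℕ} (h : b ≤ a) :
    gaussBinom F a b * ∏ i ∈ Finset.range b, (Fintype.card F ^ b - Fintype.card F ^ i) =
      ∏ i ∈ Finset.range b, (Fintype.card F ^ a - Fintype.card F ^ i) := by
  classical
  have h1 := Nat.card_congr (linearIndependentEquiv F a b)
  rw [card_linearIndependent (by simpa using h), Nat.card_sigma] at h1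
  have h2 : ∀ W : {W : Submodule F (Fin a → F) // Module.finrank F W = b},
      Nat.card {s : Fin b → W.1 // LinearIndependent F s} =
        ∏ i ∈ Finset.range b, (Fintype.card F ^ b - Fintype.card F ^ i) := by
    intro W
    rw [card_linearIndependent W.2.ge, W.2, Finset.prod_range]
  rw [Finset.sum_congr rfl fun W _ => h2 W, Finset.sum_const, smul_eq_mul, Finset.card_univ,
    Module.finrank_fin_fun] at h1
  have h3 := Nat.card_eq_fintype_card (α := {W : Submodule F (Fin a → F) // Module.finrank F W = b})
  rw [← h3] at h1
  rw [gaussBinom, ← h1, Finset.prod_range]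

/-- For b ≤ a both numbers agree after multiplication by (∏ q^i)·`qFact q b`·`qFact q (a - b)`. This
links the counting definition with the table filled by the Pascal recursion. -/
theorem gaussBinom_eq_qBinom (a b : ℕ) : gaussBinom F a b = qBinom (Fintype.card F) a b := by
  have hq : 2 ≤ Fintype.card F := Fintype.one_lt_card
  rcases Nat.lt_or_ge a b with h | h
  · rw [qBinom_eq_zero _ h, gaussBinom]
    refine Nat.card_eq_zero.2 (Or.inl ⟨fun W => ?_⟩)
    have := Submodule.finrank_le W.1
    rw [W.2, Module.finrank_fin_fun] at this
    omega
  · obtain ⟨c, rfl⟩ := Nat.exists_eq_add_of_le h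
    set q := Fintype.card F
    have h1 := gaussBinom_mul_prod F (a := b + c) (b := b) h
    have h2 := prod_sub_mul_qFact q b c
    have h3 := prod_sub_mul_qFact q b 0
    have h4 := qBinom_mul_qFact hq b c
    rw [add_zero, show qFact q 0 = 1 by simp [qFact], mul_one] at h3
    have hpos : 0 < (∏ i ∈ Finset.range b, q ^ i) * (qFact q b * qFact q c) :=
      Nat.mul_pos (Finset.prod_pos fun i _ => by positivity)
        (Nat.mul_pos (qFact_pos hq b) (qFact_pos hq c))
    refine Nat.eq_of_mul_eq_mul_right hpos ?_
    rw [← h1, h3] at h2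
    linear_combination h2 - (∏ i ∈ Finset.range b, q ^ i) * h4

end Count

end SumRank

namespace SumRank

/-! ### Completions of weight decompositions -/

section Completion

variable {ι : Type*} [DecidableEq ι]

/-- The possible results of the procedure `scomp` on the positions in `E`. -/
structure IsCompletion (ζ : ℕ) (E : Finset ι) (v : ι → ℕ) (s : ℕ) (w : ι → ℕ) : Prop where
  le : ∀ i ∈ E, v i ≤ w i
  le_cap : ∀ i ∈ E, w i ≤ ζ
  sum_eq : ∑ i ∈ E, w i = s
  priority : ∀ i ∈ E, ∀ j ∈ E, v j < v i → v j < w j → w i = ζ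
  balance : ∀ i ∈ E, ∀ j ∈ E, v i = v j → w i ≤ w j + 1

/-- The product of `h (w i)` for a balanced vector `w` of length `δ` and sum `S`. -/
def balancedProd {𝕂 : Type*} [CommMonoid 𝕂] (h : ℕ → 𝕂) (δ S : ℕ) : 𝕂 :=
  h (S / δ + 1) ^ (S % δ) * h (S / δ) ^ (δ - S % δ)

/-- If entries differ by at most 1, they take only the values c and c + 1; division of the sum by
the number of entries with remainder determines c and how often c + 1 occurs. -/
theorem prod_eq_balancedProd {𝕂 : Type*} [CommMonoid 𝕂] (h : ℕ → 𝕂) {D : Finset ι}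
    (hD : D.Nonempty) {w : ι → ℕ} (hw : ∀ i ∈ D, ∀ j ∈ D, w i ≤ w j + 1) :
    ∏ i ∈ D, h (w i) = balancedProd h D.card (∑ i ∈ D, w i) := by
  obtain ⟨i₀, hi₀, hmin⟩ := D.exists_min_image w hD
  set c := w i₀ with hc
  set U := D.filter fun i => w i = c + 1 with hU
  have hcases : ∀ i ∈ D, i ∉ U → w i = c := by
    intro i hi hiU
    have h1 := hmin i hi
    have h2 := hw i hi i₀ hi₀
    have h3 : w i ≠ c + 1 := fun h => hiU (Finset.mem_filter.2 ⟨hi, h⟩)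
    omega
  have hUD : U ⊆ D := Finset.filter_subset _ _
  have hUw : ∀ i ∈ U, w i = c + 1 := fun i hi => (Finset.mem_filter.1 hi).2
  have hlt : U.card < D.card := Finset.card_lt_card ⟨hUD, fun hh => by
    have := hUw i₀ (hh hi₀)
    omega⟩
  have hsd : (D \ U).card = D.card - U.card := Finset.card_sdiff_of_subset hUD
  have hsum : ∑ i ∈ D, w i = U.card + D.card * c := by
    rw [← Finset.sum_sdiff hUD, Finset.sum_congr rfl hUw,
      Finset.sum_congr rfl fun i hi => hcases i (Finset.mem_sdiff.1 hi).1 (Finset.mem_sdiff.1 hi).2]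
    simp only [Finset.sum_const, smul_eq_mul, hsd]
    obtain ⟨k, hk⟩ := Nat.exists_eq_add_of_lt hlt
    rw [hk, show U.card + k + 1 - U.card = k + 1 by omega]
    ring
  have hdiv : (∑ i ∈ D, w i) / D.card = c := by
    rw [hsum, Nat.add_mul_div_left _ _ (by omega), Nat.div_eq_of_lt hlt, zero_add]
  have hmod : (∑ i ∈ D, w i) % D.card = U.card := by
    rw [hsum, Nat.add_mul_mod_self_left, Nat.mod_eq_of_lt hlt]
  rw [balancedProd, hdiv, hmod, ← Finset.prod_sdiff hUD,
    Finset.prod_congr rfl fun i hi => congrArg h (hUw i hi),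
    Finset.prod_congr rfl fun i hi => congrArg h
      (hcases i (Finset.mem_sdiff.1 hi).1 (Finset.mem_sdiff.1 hi).2)]
  simp only [Finset.prod_const, hsd]
  rw [mul_comm]

/-- The part of the sum `s` that is used for the `δ` positions with the maximal value `t₁`. -/
def topSum (ζ t δ t₁ s : ℕ) : ℕ := min (s - (t - t₁ * δ)) (δ * ζ)

variable {ζ s t₁ : ℕ} {E D : Finset ι} {v w : ι → ℕ}

/-- Either some lower position was raised, and by priority all top positions are full; or no lower
position was raised, and the top positions receive everything except the original lower sum. The
minimum in `topSum` covers both cases. -/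
theorem IsCompletion.sum_top (h : IsCompletion ζ E v s w) (hDE : D ⊆ E)
    (hv : ∀ i ∈ D, v i = t₁) (hv' : ∀ i ∈ E \ D, v i < t₁) :
    ∑ i ∈ D, w i = topSum ζ (∑ i ∈ E, v i) D.card t₁ s := by
  have h1 := h.sum_eq
  rw [← Finset.sum_sdiff hDE] at h1
  have h2 : ∑ i ∈ E, v i = ∑ i ∈ E \ D, v i + t₁ * D.card := by
    rw [← Finset.sum_sdiff hDE, Finset.sum_congr rfl hv, Finset.sum_const, smul_eq_mul, mul_comm]
  rw [topSum, h2, Nat.add_sub_cancel]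
  have h3 : ∑ i ∈ D, w i ≤ D.card * ζ := by
    rw [← smul_eq_mul]
    exact Finset.sum_le_card_nsmul _ _ _ fun i hi => h.le_cap i (hDE hi)
  have h4 : ∑ i ∈ E \ D, v i ≤ ∑ i ∈ E \ D, w i :=
    Finset.sum_le_sum fun i hi => h.le i (Finset.mem_sdiff.1 hi).1
  by_cases hex : ∃ j ∈ E \ D, v j < w j
  · obtain ⟨j, hj, hlt⟩ := hex
    have h5 : ∑ i ∈ D, w i = D.card * ζ := by
      rw [← smul_eq_mul, ← Finset.sum_const]
      exact Finset.sum_congr rfl fun i hi => h.priority i (hDE hi) j (Finset.mem_sdiff.1 hj).1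
        (by rw [hv i hi]; exact hv' j hj) hlt
    omega
  · push Not at hex
    have h5 : ∑ i ∈ E \ D, w i ≤ ∑ i ∈ E \ D, v i := Finset.sum_le_sum hex
    omega

/-- The conditions other than the sum are inherited by subsets of positions, so the structure
recurses. The sum follows from `IsCompletion.sum_top`. -/
theorem IsCompletion.sdiff (h : IsCompletion ζ E v s w) (hDE : D ⊆ E)
    (hv : ∀ i ∈ D, v i = t₁) (hv' : ∀ i ∈ E \ D, v i < t₁) :
    IsCompletion ζ (E \ D) v (s - topSum ζ (∑ i ∈ E, v i) D.card t₁ s) w := by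
  have hsub : ∀ i ∈ E \ D, i ∈ E := fun i hi => (Finset.mem_sdiff.1 hi).1
  refine ⟨fun i hi => h.le i (hsub i hi), fun i hi => h.le_cap i (hsub i hi), ?_,
    fun i hi j hj => h.priority i (hsub i hi) j (hsub j hj),
    fun i hi j hj => h.balance i (hsub i hi) j (hsub j hj)⟩
  have h1 := h.sum_eq
  rw [← Finset.sum_sdiff hDE] at h1
  rw [← h.sum_top hDE hv hv']
  omega

theorem IsCompletion.congr {ι : Type*} {E : Finset ι} {v w v' w' : ι → ℕ}
    (h : IsCompletion ζ E v s w) (hv : ∀ i ∈ E, v i = v' i)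
    (hw : ∀ i ∈ E, w i = w' i) : IsCompletion ζ E v' s w' where
  le i hi := by rw [← hv i hi, ← hw i hi]; exact h.le i hi
  le_cap i hi := by rw [← hw i hi]; exact h.le_cap i hi
  sum_eq := by rw [← Finset.sum_congr rfl hw]; exact h.sum_eq
  priority i hi j hj := by
    rw [← hv i hi, ← hw i hi, ← hv j hj, ← hw j hj]; exact h.priority i hi j hj
  balance i hi j hj := by
    rw [← hv i hi, ← hw i hi, ← hv j hj, ← hw j hj]; exact h.balance i hi j hj

theorem IsCompletion.prod_top {𝕂 : Type*} [CommMonoid 𝕂] (h : ℕ → ℕ → 𝕂)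
    (hw : IsCompletion ζ E v s w) (hDE : D ⊆ E) (hD : D.Nonempty)
    (hv : ∀ i ∈ D, v i = t₁) (hv' : ∀ i ∈ E \ D, v i < t₁) :
    ∏ i ∈ E, h (v i) (w i) =
      balancedProd (h t₁) D.card (topSum ζ (∑ i ∈ E, v i) D.card t₁ s) *
        ∏ i ∈ E \ D, h (v i) (w i) := by
  rw [← Finset.prod_sdiff hDE, mul_comm]
  congr 1
  rw [Finset.prod_congr rfl fun i hi => by rw [hv i hi],
    prod_eq_balancedProd (h t₁) hD fun i hi j hj =>
      hw.balance i (hDE hi) j (hDE hj) (by rw [hv i hi, hv j hj]),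
    hw.sum_top hDE hv hv']

/-- The maximal value and the positions where it is attained. -/
def topOf (E : Finset ι) (v : ι → ℕ) : ℕ × Finset ι := (E.sup v, E.filter fun i => v i = E.sup v)

theorem topOf_spec (hE : E.Nonempty) (v : ι → ℕ) :
    (topOf E v).2 ⊆ E ∧ (topOf E v).2.Nonempty ∧ (∀ i ∈ (topOf E v).2, v i = (topOf E v).1) ∧
      ∀ i ∈ E \ (topOf E v).2, v i < (topOf E v).1 := by
  refine ⟨Finset.filter_subset _ _, ?_, fun i hi => (Finset.mem_filter.1 hi).2, fun i hi => ?_⟩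
  · obtain ⟨i, hi, h⟩ := Finset.exists_mem_eq_sup E hE v
    exact ⟨i, Finset.mem_filter.2 ⟨hi, h.symm⟩⟩
  · rw [Finset.mem_sdiff] at hi
    refine lt_of_le_of_ne (Finset.le_sup hi.1) fun h => hi.2 (Finset.mem_filter.2 ⟨hi.1, h⟩)

theorem topOf_eq {d : ℕ} (hDE : D ⊆ E) (hD : D.Nonempty) (hv : ∀ i ∈ D, v i = d)
    (hv' : ∀ i ∈ E \ D, v i < d) : topOf E v = (d, D) := by
  have hsup : E.sup v = d := by
    refine le_antisymm (Finset.sup_le fun i hi => ?_) ?_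
    · by_cases h : i ∈ D
      · exact (hv i h).le
      · exact (hv' i (Finset.mem_sdiff.2 ⟨hi, h⟩)).le
    · obtain ⟨i, hi⟩ := hD
      rw [← hv i hi]
      exact Finset.le_sup (hDE hi)
  rw [topOf, hsup]
  congr 1
  ext i
  rw [Finset.mem_filter]
  refine ⟨fun h => ?_, fun h => ⟨hDE h, hv i h⟩⟩
  by_contra hi
  exact (hv' i (Finset.mem_sdiff.2 ⟨h.1, hi⟩)).ne h.2

/-- The weight of a vector does not depend on the choice of its completion. -/
theorem IsCompletion.prod_unique {𝕂 : Type*} [CommMonoid 𝕂] (h : ℕ → ℕ → 𝕂) {w' : ι → ℕ}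
    (hw : IsCompletion ζ E v s w) (hw' : IsCompletion ζ E v s w') :
    ∏ i ∈ E, h (v i) (w i) = ∏ i ∈ E, h (v i) (w' i) := by
  induction hn : E.card using Nat.strong_induction_on generalizing E s with
  | _ n ih =>
    rcases E.eq_empty_or_nonempty with rfl | hE
    · simp
    obtain ⟨h1, h2, h3, h4⟩ := topOf_spec hE v
    rw [hw.prod_top h h1 h2 h3 h4, hw'.prod_top h h1 h2 h3 h4]
    congr 1
    refine ih _ ?_ (hw.sdiff h1 h3 h4) (hw'.sdiff h1 h3 h4) rfl
    rw [← hn]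
    exact Finset.card_lt_card (Finset.sdiff_ssubset h1 h2)

/-! ### The recursion over the maximal value -/

/-- The sum over all vectors of length `l` with sum `t` and entries less than `m`, computed by
splitting off the positions with the maximal value. -/
def vecSum (h : ℕ → ℕ → ℕ) (ζ : ℕ) (t l m s : ℕ) : ℕ :=
  if l = 0 then if t = 0 then 1 else 0
  else ∑ t₁ ∈ Finset.range m, ∑ j : Fin l, if t₁ * (j.1 + 1) ≤ t then
    l.choose (j.1 + 1) * (balancedProd (h t₁) (j.1 + 1) (topSum ζ t (j.1 + 1) t₁ s) *
      vecSum h ζ (t - t₁ * (j.1 + 1)) (l - (j.1 + 1)) t₁ (s - topSum ζ t (j.1 + 1) t₁ s)) else 0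
termination_by l
decreasing_by
  have := j.2
  omega

theorem vecSum_zero (h : ℕ → ℕ → ℕ) (ζ t m s : ℕ) :
    vecSum h ζ t 0 m s = if t = 0 then 1 else 0 := by
  rw [vecSum, if_pos rfl]

/-- The definition runs over `Fin l` with δ = j + 1 only to make termination visible; this is the
form that is used. -/
theorem vecSum_of_pos (h : ℕ → ℕ → ℕ) (ζ t : ℕ) {l : ℕ} (hl : 0 < l) (m s : ℕ) :
    vecSum h ζ t l m s = ∑ t₁ ∈ Finset.range m, ∑ δ ∈ Finset.Icc 1 l, if t₁ * δ ≤ t then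
      l.choose δ * (balancedProd (h t₁) δ (topSum ζ t δ t₁ s) *
        vecSum h ζ (t - t₁ * δ) (l - δ) t₁ (s - topSum ζ t δ t₁ s)) else 0 := by
  rw [vecSum, if_neg hl.ne']
  refine Finset.sum_congr rfl fun t₁ _ => ?_
  rw [Finset.sum_fin_eq_sum_range, Finset.range_eq_Ico, Finset.sum_congr rfl (g := fun j =>
    if t₁ * (j + 1) ≤ t then l.choose (j + 1) * (balancedProd (h t₁) (j + 1)
      (topSum ζ t (j + 1) t₁ s) * vecSum h ζ (t - t₁ * (j + 1)) (l - (j + 1)) t₁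
        (s - topSum ζ t (j + 1) t₁ s)) else 0) (fun j hj => dif_pos (Finset.mem_Ico.1 hj).2)]
  rw [Finset.sum_Ico_add' (fun δ => if t₁ * δ ≤ t then l.choose δ * (balancedProd (h t₁) δ
      (topSum ζ t δ t₁ s) * vecSum h ζ (t - t₁ * δ) (l - δ) t₁
        (s - topSum ζ t δ t₁ s)) else 0) 0 l 1]
  rfl

/-- Vectors supported on `E` with sum `t` and entries less than `m`. -/
def vecs [Fintype ι] (E : Finset ι) (t m : ℕ) : Finset (ι → ℕ) :=
  (Fintype.piFinset fun i => if i ∈ E then Finset.range m else {0}).filter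
    fun v => ∑ i ∈ E, v i = t

theorem mem_vecs [Fintype ι] {t m : ℕ} :
    v ∈ vecs E t m ↔ (∀ i ∈ E, v i < m) ∧ (∀ i ∉ E, v i = 0) ∧ ∑ i ∈ E, v i = t := by
  rw [vecs, Finset.mem_filter, Fintype.mem_piFinset, ← and_assoc]
  refine and_congr_left fun _ => ⟨fun h => ⟨fun i hi => ?_, fun i hi => ?_⟩, fun h i => ?_⟩
  · have := h i
    rwa [if_pos hi, Finset.mem_range] at this
  · have := h i
    rwa [if_neg hi, Finset.mem_singleton] at this
  · split_ifs with hi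
    · exact Finset.mem_range.2 (h.1 i hi)
    · exact Finset.mem_singleton.2 (h.2 i hi)

/-- Put the value `d` at the positions in `D`. -/
def fillTop (D : Finset ι) (d : ℕ) (u : ι → ℕ) : ι → ℕ := fun i => if i ∈ D then d else u i

theorem fillTop_of_mem {d : ℕ} {i : ι} {u : ι → ℕ} (h : i ∈ D) : fillTop D d u i = d := if_pos h

theorem fillTop_of_notMem {d : ℕ} {i : ι} {u : ι → ℕ} (h : i ∉ D) : fillTop D d u i = u i :=
  if_neg h

theorem sum_fillTop (hDE : D ⊆ E) (d : ℕ) (u : ι → ℕ) :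
    ∑ i ∈ E, fillTop D d u i = ∑ i ∈ E \ D, u i + d * D.card := by
  rw [← Finset.sum_sdiff hDE, Finset.sum_congr rfl fun i hi =>
    fillTop_of_notMem (Finset.mem_sdiff.1 hi).2, Finset.sum_congr rfl fun i hi => fillTop_of_mem hi]
  simp [mul_comm]

/-- Once the maximal value d and the set D of its positions are fixed, what remains is an arbitrary
vector on E \ D with entries below d. Vectors vanish outside their support, so erasing D is inverse
to filling it. -/
theorem sum_vecs_top [Fintype ι] {𝕂 : Type*} [AddCommMonoid 𝕂] (f : (ι → ℕ) → 𝕂) {t m d : ℕ}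
    (hDE : D ⊆ E) (hD : D.Nonempty) (hd : d < m) (ht : d * D.card ≤ t) :
    ∑ v ∈ (vecs E t m).filter (fun v => topOf E v = (d, D)), f v =
      ∑ u ∈ vecs (E \ D) (t - d * D.card) d, f (fillTop D d u) := by
  have hE : E.Nonempty := hD.mono hDE
  symm
  refine Finset.sum_bij' (fun u _ => fillTop D d u) (fun v _ => fillTop D 0 v) ?_ ?_ ?_ ?_ ?_
  · intro u hu
    obtain ⟨h1, h2, h3⟩ := mem_vecs.1 hu
    rw [Finset.mem_filter, mem_vecs]
    refine ⟨⟨fun i hi => ?_, fun i hi => ?_, ?_⟩, topOf_eq hDE hD (fun i hi => if_pos hi)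
      fun i hi => ?_⟩
    · unfold fillTop
      split_ifs with h
      · exact hd
      · exact (h1 i (Finset.mem_sdiff.2 ⟨hi, h⟩)).trans hd
    · unfold fillTop
      rw [if_neg fun h => hi (hDE h)]
      exact h2 i fun h => hi (Finset.mem_sdiff.1 h).1
    · rw [sum_fillTop hDE, h3]
      omega
    · rw [fillTop, if_neg (Finset.mem_sdiff.1 hi).2]
      exact h1 i hi
  · intro v hv
    rw [Finset.mem_filter, mem_vecs] at hv
    obtain ⟨⟨h1, h2, h3⟩, h4⟩ := hv
    obtain ⟨_, _, h5, h6⟩ := topOf_spec hE v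
    rw [h4] at h5 h6
    refine mem_vecs.2 ⟨fun i hi => ?_, fun i hi => ?_, ?_⟩
    · rw [fillTop, if_neg (Finset.mem_sdiff.1 hi).2]
      exact h6 i hi
    · unfold fillTop
      split_ifs with h
      · rfl
      · exact h2 i fun hE => hi (Finset.mem_sdiff.2 ⟨hE, h⟩)
    · have h7 : ∑ i ∈ E, v i = ∑ i ∈ E \ D, v i + d * D.card := by
        rw [← Finset.sum_sdiff hDE, Finset.sum_congr rfl h5]
        simp [mul_comm]
      rw [Finset.sum_congr rfl fun i hi => fillTop_of_notMem (Finset.mem_sdiff.1 hi).2]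
      omega
  · intro u hu
    obtain ⟨-, h2, -⟩ := mem_vecs.1 hu
    funext i
    unfold fillTop
    split_ifs with h
    · exact (h2 i fun hi => (Finset.mem_sdiff.1 hi).2 h).symm
    · rfl
  · intro v hv
    rw [Finset.mem_filter] at hv
    obtain ⟨-, -, h5, -⟩ := topOf_spec hE v
    rw [hv.2] at h5
    funext i
    unfold fillTop
    split_ifs with h
    · exact (h5 i h).symm
    · rfl
  · intro u hu
    rfl

/-- The sum of the weights of all vectors satisfies the recursion. -/
theorem sum_vecs_eq_vecSum [Fintype ι] (h : ℕ → ℕ → ℕ) (E : Finset ι) (t m s : ℕ)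
    (W : (ι → ℕ) → ι → ℕ) (hW : ∀ v ∈ vecs E t m, IsCompletion ζ E v s (W v)) :
    ∑ v ∈ vecs E t m, ∏ i ∈ E, h (v i) (W v i) = vecSum h ζ t E.card m s := by
  induction hn : E.card using Nat.strong_induction_on generalizing E t m s W with
  | _ n ih =>
    rcases E.eq_empty_or_nonempty with rfl | hE
    · obtain rfl : n = 0 := by simpa using hn.symm
      rw [vecSum_zero]
      simp only [Finset.prod_empty, Finset.sum_const, smul_eq_mul, mul_one]
      split_ifs with ht
      · rw [Finset.card_eq_one]
        refine ⟨0, Finset.eq_singleton_iff_unique_mem.2 ⟨mem_vecs.2 (by simp [ht]), fun v hv => ?_⟩⟩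
        exact funext fun i => (mem_vecs.1 hv).2.1 i (by simp)
      · rw [Finset.card_eq_zero, Finset.eq_empty_iff_forall_notMem]
        intro v hv
        exact ht (by simpa using (mem_vecs.1 hv).2.2.symm)
    -- The sum is split according to the maximal value and the set of positions attaining it.
    have hmaps : ∀ v ∈ vecs E t m, topOf E v ∈ Finset.range m ×ˢ E.powerset := by
      intro v hv
      obtain ⟨h1, h2, h3, -⟩ := topOf_spec hE v
      rw [Finset.mem_product, Finset.mem_range, Finset.mem_powerset]
      refine ⟨?_, h1⟩
      obtain ⟨i, hi⟩ := h2
      rw [← h3 i hi]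
      exact (mem_vecs.1 hv).1 i (h1 hi)
    have hn0 : 0 < n := by rw [← hn]; exact hE.card_pos
    rw [← Finset.sum_fiberwise_of_maps_to hmaps, Finset.sum_product, vecSum_of_pos h ζ t hn0]
    refine Finset.sum_congr rfl fun d hd => ?_
    rw [Finset.mem_range] at hd
    -- The contribution of a set D depends on its cardinality only, so the sum over all D produces
    -- the binomial coefficient.
    set g : ℕ → ℕ := fun δ => if 1 ≤ δ ∧ d * δ ≤ t then
      balancedProd (h d) δ (topSum ζ t δ d s) *
        vecSum h ζ (t - d * δ) (n - δ) d (s - topSum ζ t δ d s) else 0 with hg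
    have hinner : ∀ D ∈ E.powerset, ∑ v ∈ (vecs E t m).filter (fun v => topOf E v = (d, D)),
        ∏ i ∈ E, h (v i) (W v i) = g D.card := by
      intro D hDE
      rw [Finset.mem_powerset] at hDE
      simp only [hg]
      split_ifs with hcond
      · have hD : D.Nonempty := Finset.card_pos.1 hcond.1
        rw [sum_vecs_top _ hDE hD hd hcond.2]
        have hu : ∀ u ∈ vecs (E \ D) (t - d * D.card) d,
            IsCompletion ζ E (fillTop D d u) s (W (fillTop D d u)) ∧
            (∑ i ∈ E, fillTop D d u i = t) ∧ (∀ i ∈ D, fillTop D d u i = d) ∧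
            (∀ i ∈ E \ D, fillTop D d u i = u i) ∧ ∀ i ∈ E \ D, fillTop D d u i < d := by
          intro u hu
          obtain ⟨h1, h2, h3⟩ := mem_vecs.1 hu
          have e1 : ∑ i ∈ E, fillTop D d u i = t := by
            rw [sum_fillTop hDE, h3]
            omega
          have e2 : ∀ i ∈ E \ D, fillTop D d u i = u i := fun i hi =>
            if_neg (Finset.mem_sdiff.1 hi).2
          refine ⟨hW _ (mem_vecs.2 ⟨fun i hi => ?_, fun i hi => ?_, e1⟩), e1,
            fun i hi => if_pos hi, e2, fun i hi => by rw [e2 i hi]; exact h1 i hi⟩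
          · by_cases hiD : i ∈ D
            · rw [fillTop, if_pos hiD]
              exact hd
            · rw [e2 i (Finset.mem_sdiff.2 ⟨hi, hiD⟩)]
              exact (h1 i (Finset.mem_sdiff.2 ⟨hi, hiD⟩)).trans hd
          · rw [fillTop, if_neg fun hh => hi (hDE hh)]
            exact h2 i fun hh => hi (Finset.mem_sdiff.1 hh).1
        have hcard : (E \ D).card = n - D.card := by
          rw [Finset.card_sdiff_of_subset hDE, hn]
        have hD0 := hD.card_pos
        rw [← ih (n - D.card) (by omega) (E \ D) (t - d * D.card) d (s - topSum ζ t D.card d s)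
          (fun u => W (fillTop D d u)) ?_ hcard, Finset.mul_sum]
        · refine Finset.sum_congr rfl fun u hu' => ?_
          obtain ⟨c1, c2, c3, c4, c5⟩ := hu u hu'
          rw [c1.prod_top h hDE hD c3 c5, c2]
          congr 1
          exact Finset.prod_congr rfl fun i hi => by rw [c4 i hi]
        · intro u hu'
          obtain ⟨c1, c2, c3, c4, c5⟩ := hu u hu'
          have := c1.sdiff hDE c3 c5
          rw [c2] at this
          exact this.congr c4 fun _ _ => rfl
      -- Otherwise the fibre is empty: the set of maximal positions is nonempty, and its entries
      -- already sum to d·|D| ≤ t.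
      · refine Finset.sum_eq_zero fun v hv => absurd ?_ hcond
        rw [Finset.mem_filter] at hv
        obtain ⟨-, h2, h3, -⟩ := topOf_spec hE v
        rw [hv.2] at h2 h3
        refine ⟨h2.card_pos, ?_⟩
        rw [← (mem_vecs.1 hv.1).2.2, ← Finset.sum_sdiff hDE, Finset.sum_congr rfl h3]
        simp [mul_comm]
    rw [Finset.sum_congr rfl hinner, Finset.sum_powerset_apply_card, hn, Finset.range_eq_Ico,
      Finset.sum_eq_sum_Ico_succ_bot (by omega)]
    simp only [hg, smul_eq_mul]
    rw [if_neg (by omega), mul_zero, zero_add]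
    refine Finset.sum_congr rfl fun δ hδ => ?_
    have hδ1 : 1 ≤ δ := (Finset.mem_Ico.1 hδ).1
    simp only [hδ1, true_and]
    split_ifs <;> simp

end Completion

end SumRank

/-! ### Range of the recursion and admissible arguments. -/

namespace SumRank

section Recursion

variable {h : ℕ → ℕ → ℕ} {ζ : ℕ}

theorem vecs_univ (t l μ : ℕ) : vecs (Finset.univ : Finset (Fin l)) t (μ + 1) = weightDecomps t l μ := by
  simp [vecs, weightDecomps]

/-- No l entries below m can sum to more than l(m - 1); the hypothesis states this without
subtraction. -/
theorem vecSum_eq_zero {t l m : ℕ} (s : ℕ) (hlt : l * m < t + l) : vecSum h ζ t l m s = 0 := by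
  have hempty : vecs (Finset.univ : Finset (Fin l)) t m = ∅ := by
    rw [Finset.eq_empty_iff_forall_notMem]
    intro v hv
    obtain ⟨h1, -, h3⟩ := mem_vecs.1 hv
    have : ∑ i : Fin l, (v i + 1) ≤ ∑ _i : Fin l, m := Finset.sum_le_sum fun i hi => h1 i hi
    rw [Finset.sum_add_distrib, h3] at this
    simp at this
    omega
  -- There are no vectors, so the completions need not exist and any function may stand for them.
  have := sum_vecs_eq_vecSum (ζ := ζ) h (Finset.univ : Finset (Fin l)) t m s (fun v => v)
    (by simp [hempty])
  rw [hempty, Finset.sum_empty, Finset.card_univ, Fintype.card_fin] at this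
  exact this.symm

/-- Arguments of the recursion for which the tabulated quantity is not zero. -/
structure Admissible (ζ t l μ s : ℕ) : Prop where
  le_mul : t ≤ l * μ
  le_s : t ≤ s
  s_le : s ≤ l * ζ
  le_cap : μ ≤ ζ

/-- The range of the recursion. -/
structure SplitRange (t l μ t₁ δ : ℕ) : Prop where
  le_μ : t₁ ≤ μ
  le_mul : t ≤ l * t₁
  lo_le : t + l ≤ l * t₁ + δ
  pos : 1 ≤ δ
  le_l : δ ≤ l
  mul_le : t₁ * δ ≤ t

section

variable {t l μ s t₁ δ : ℕ}

/-- The lower limit for δ is exactly the condition that the rest of the weight fits into l - δ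
positions with entries at most t₁ - 1. -/
theorem SplitRange.rest_le (hr : SplitRange t l μ t₁ δ) : t - t₁ * δ ≤ (l - δ) * (t₁ - 1) := by
  obtain ⟨k, rfl⟩ := Nat.exists_eq_add_of_le hr.le_l
  obtain ⟨r, rfl⟩ := Nat.exists_eq_add_of_le hr.mul_le
  have h1 := hr.lo_le
  rw [Nat.add_sub_cancel_left, Nat.add_sub_cancel_left]
  rcases t₁ with _ | t₁
  · simp at h1 ⊢
    omega
  · rw [Nat.add_sub_cancel]
    have e1 : (δ + k) * (t₁ + 1) = (t₁ + 1) * δ + k * t₁ + k := by ring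
    omega

/-- These are the conditions under which the coefficient table has an entry for (δ, t₁, S). -/
theorem Admissible.topSum_bounds (ha : Admissible ζ t l μ s) (hr : SplitRange t l μ t₁ δ) :
    t₁ * δ ≤ topSum ζ t δ t₁ s ∧ topSum ζ t δ t₁ s ≤ ζ * δ ∧ topSum ζ t δ t₁ s ≤ s := by
  have h1 := hr.mul_le
  have h2 := ha.le_s
  have h3 : δ * t₁ ≤ δ * ζ := Nat.mul_le_mul_left _ (hr.le_μ.trans ha.le_cap)
  rw [mul_comm δ t₁] at h3
  have h4 : ζ * δ = δ * ζ := mul_comm _ _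
  unfold topSum
  omega

/-- Recursive calls stay admissible, so starting from admissible arguments the branch returning 0 is
never entered. -/
theorem Admissible.split (ha : Admissible ζ t l μ s) (hr : SplitRange t l μ t₁ δ) :
    Admissible ζ (t - t₁ * δ) (l - δ) (t₁ - 1) (s - topSum ζ t δ t₁ s) := by
  have h0 := hr.rest_le
  have h1 := hr.mul_le
  have h2 := ha.le_s
  have h5 := ha.s_le
  have h6 := ha.le_cap
  have h7 := hr.le_μ
  have h8 : (l - δ) * ζ + δ * ζ = l * ζ := by rw [← add_mul, Nat.sub_add_cancel hr.le_l]
  have h9 : (l - δ) * (t₁ - 1) ≤ (l - δ) * ζ := Nat.mul_le_mul_left _ (by omega)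
  refine ⟨h0, ?_, ?_, by omega⟩
  · unfold topSum
    omega
  · unfold topSum
    omega

/-- The recursion, restricted to the terms that do not vanish. -/
theorem vecSum_eq_sum (hl : 0 < l) (s : ℕ) :
    vecSum h ζ t l (μ + 1) s = ∑ t₁ ∈ Finset.Ico 0 (min μ t + 1),
      if t ≤ l * t₁ then ∑ δ ∈ Finset.Ico (max (t + l - l * t₁) 1) (l + 1), if t₁ * δ ≤ t then
        vecSum h ζ (t - t₁ * δ) (l - δ) (t₁ - 1 + 1) (s - topSum ζ t δ t₁ s) *
          balancedProd (h t₁) δ (topSum ζ t δ t₁ s) * l.choose δ else 0 else 0 := by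
  rw [vecSum_of_pos h ζ t hl]
  have hsub : Finset.Ico 0 (min μ t + 1) ⊆ Finset.range (μ + 1) := by
    intro i hi
    rw [Finset.mem_Ico] at hi
    rw [Finset.mem_range]
    omega
  rw [← Finset.sum_subset hsub]
  · refine Finset.sum_congr rfl fun t₁ _ => ?_
    split_ifs with ht
    · have hsub' : Finset.Ico (max (t + l - l * t₁) 1) (l + 1) ⊆ Finset.Icc 1 l := by
        intro i hi
        rw [Finset.mem_Ico] at hi
        rw [Finset.mem_Icc]
        omega
      rw [← Finset.sum_subset hsub']
      · refine Finset.sum_congr rfl fun δ hδ => ?_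
        rw [Finset.mem_Ico] at hδ
        split_ifs with hle
        · have hv : vecSum h ζ (t - t₁ * δ) (l - δ) t₁ (s - topSum ζ t δ t₁ s) =
              vecSum h ζ (t - t₁ * δ) (l - δ) (t₁ - 1 + 1) (s - topSum ζ t δ t₁ s) := by
            -- For t₁ = 0 the bounds t₁ and t₁ - 1 + 1 differ, but then δ = l and the remaining
            -- vector is empty.
            rcases t₁ with _ | t₁
            · rw [show l - δ = 0 by omega, vecSum_zero, vecSum_zero]
            · rfl
          rw [hv]
          ring
        · rfl
      · intro δ hδ hδ'
        rw [Finset.mem_Icc] at hδ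
        rw [Finset.mem_Ico] at hδ'
        split_ifs with hle
        -- With so few maximal positions the rest cannot be distributed with entries below t₁.
        · rw [vecSum_eq_zero, mul_zero, mul_zero]
          obtain ⟨k, rfl⟩ := Nat.exists_eq_add_of_le hδ.2
          obtain ⟨r, rfl⟩ := Nat.exists_eq_add_of_le hle
          have e1 : (δ + k) * t₁ = t₁ * δ + k * t₁ := by ring
          rw [Nat.add_sub_cancel_left, Nat.add_sub_cancel_left]
          omega
        · rfl
    · refine Finset.sum_eq_zero fun δ hδ => ?_
      rw [Finset.mem_Icc] at hδ
      split_ifs with hle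
      · rw [vecSum_eq_zero, mul_zero, mul_zero]
        obtain ⟨k, rfl⟩ := Nat.exists_eq_add_of_le hδ.2
        obtain ⟨r, rfl⟩ := Nat.exists_eq_add_of_le hle
        have e1 : (δ + k) * t₁ = t₁ * δ + k * t₁ := by ring
        rw [Nat.add_sub_cancel_left, Nat.add_sub_cancel_left]
        omega
      · rfl
  · intro t₁ ht₁ ht₁'
    rw [Finset.mem_range] at ht₁
    rw [Finset.mem_Ico] at ht₁'
    refine Finset.sum_eq_zero fun δ hδ => if_neg ?_
    rw [Finset.mem_Icc] at hδ
    have : t₁ * 1 ≤ t₁ * δ := Nat.mul_le_mul_left _ hδ.1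
    omega

end

end Recursion

/-! ### Sums over non-increasing vectors -/

section Sorted

variable {l : ℕ}

theorem exists_antitone_comp (u : Fin l → ℕ) : ∃ σ : Equiv.Perm (Fin l), Antitone (u ∘ σ) :=
  ⟨Tuple.sort (OrderDual.toDual ∘ u), fun _ _ hij =>
    Tuple.monotone_sort (OrderDual.toDual ∘ u) hij⟩

/-- A non-increasing rearrangement is unique, so the permutations sorting u form a coset of the
stabilizer of u, whose order is the product of the factorials of the multiplicities. -/
theorem card_antitone_perms (u : Fin l → ℕ) {n : ℕ} (hu : ∀ i, u i < n) :
    Nat.card {σ : Equiv.Perm (Fin l) // Antitone (u ∘ σ)} =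
      ∏ i ∈ Finset.range n, (occurrences u i).factorial := by
  obtain ⟨σ₀, h₀⟩ := exists_antitone_comp u
  have e : {σ : Equiv.Perm (Fin l) // Antitone (u ∘ σ)} ≃
      {σ : Equiv.Perm (Fin l) // u ∘ σ = u} :=
    (Equiv.mulRight σ₀⁻¹).subtypeEquiv fun σ => by
      constructor
      · intro hσ
        have h1 : u ∘ σ = u ∘ σ₀ := Tuple.unique_antitone hσ h₀
        funext i
        have := congrFun h1 (σ₀⁻¹ i)
        simpa using this
      · intro hσ
        have h1 : u ∘ σ = u ∘ σ₀ := by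
          funext i
          have := congrFun hσ (σ₀ i)
          simpa using this
        rw [h1]
        exact h₀
  rw [Nat.card_congr e, Nat.card_eq_fintype_card, DomMulAct.stabilizer_card']
  have hocc : ∀ i, Fintype.card {a // u a = i} = occurrences u i := fun i => Fintype.card_subtype _
  simp only [hocc]
  refine Finset.prod_subset (fun i hi => ?_) fun i _ hi => ?_
  · obtain ⟨j, -, rfl⟩ := Finset.mem_image.1 hi
    exact Finset.mem_range.2 (hu j)
  · have : occurrences u i = 0 := by
      rw [occurrences, Finset.card_eq_zero, Finset.filter_eq_empty_iff]
      intro j _ hj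
      exact hi (Finset.mem_image.2 ⟨j, Finset.mem_univ j, hj⟩)
    rw [this, Nat.factorial_zero]

theorem comp_mem_weightDecomps {t μ : ℕ} {v : Fin l → ℕ} (hv : v ∈ weightDecomps t l μ)
    (σ : Equiv.Perm (Fin l)) : v ∘ σ ∈ weightDecomps t l μ := by
  simp only [weightDecomps, Finset.mem_filter, Fintype.mem_piFinset] at hv ⊢
  exact ⟨fun i => hv.1 (σ i), by rw [← hv.2]; exact Equiv.sum_comp σ v⟩

theorem occurrences_comp (v : Fin l → ℕ) (σ : Equiv.Perm (Fin l)) (i : ℕ) :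
    occurrences (v ∘ σ) i = occurrences v i := by
  unfold occurrences
  refine Finset.card_bij (fun j _ => σ j) ?_ ?_ ?_
  · intro j hj
    simpa using hj
  · intro a _ b _ hab
    exact σ.injective hab
  · intro j hj
    exact ⟨σ.symm j, by simpa using hj, by simp⟩

/-- Every non-increasing vector has `l! / ∏ δ_i!` rearrangements. -/
theorem sum_weightDecomps_eq (t μ : ℕ) (f : (Fin l → ℕ) → ℚ)
    (hf : ∀ v ∈ weightDecomps t l μ, ∀ σ : Equiv.Perm (Fin l), f (v ∘ σ) = f v) :
    ∑ v ∈ weightDecomps t l μ, f v = l.factorial * ∑ v ∈ ordWeightDecomps t l μ,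
      (∏ i ∈ Finset.range (μ + 1), ((occurrences v i).factorial : ℚ))⁻¹ * f v := by
  classical
  set c : (Fin l → ℕ) → ℚ := fun v => ∏ i ∈ Finset.range (μ + 1), ((occurrences v i).factorial : ℚ)
    with hc
  have hc0 : ∀ v, c v ≠ 0 := fun v =>
    Finset.prod_ne_zero_iff.2 fun i _ => Nat.cast_ne_zero.2 (Nat.factorial_ne_zero _)
  -- The term of u is spread evenly over the c(u) permutations that sort u. For a fixed permutation,
  -- u ↦ u ∘ σ is a bijection onto the non-increasing vectors, so each of the l! permutations
  -- contributes the same sum.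
  have h1 : ∀ u ∈ weightDecomps t l μ, f u =
      ∑ σ : Equiv.Perm (Fin l), if Antitone (u ∘ σ) then (c u)⁻¹ * f u else 0 := by
    intro u hu
    rw [← Finset.sum_filter, Finset.sum_const, nsmul_eq_mul]
    have hcard := card_antitone_perms u (n := μ + 1) (by
      simp only [weightDecomps, Finset.mem_filter, Fintype.mem_piFinset, Finset.mem_range] at hu
      exact hu.1)
    rw [Nat.card_eq_fintype_card, Fintype.card_subtype] at hcard
    rw [hcard, Nat.cast_prod, ← mul_assoc, mul_inv_cancel₀ (hc0 u), one_mul]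
  rw [Finset.sum_congr rfl h1, Finset.sum_comm]
  have h2 : ∀ σ : Equiv.Perm (Fin l),
      (∑ u ∈ weightDecomps t l μ, if Antitone (u ∘ σ) then (c u)⁻¹ * f u else 0) =
        ∑ v ∈ ordWeightDecomps t l μ, (c v)⁻¹ * f v := by
    intro σ
    rw [← Finset.sum_filter]
    refine Finset.sum_bij' (fun u _ => u ∘ σ) (fun v _ => v ∘ σ.symm) ?_ ?_ ?_ ?_ ?_
    · intro u hu
      rw [Finset.mem_filter] at hu
      simp only [ordWeightDecomps, Finset.mem_filter]
      exact ⟨comp_mem_weightDecomps hu.1 σ, hu.2⟩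
    · intro v hv
      simp only [ordWeightDecomps, Finset.mem_filter] at hv
      rw [Finset.mem_filter]
      refine ⟨comp_mem_weightDecomps hv.1 _, ?_⟩
      have : (v ∘ σ.symm) ∘ σ = v := by
        funext i
        simp
      rw [this]
      exact hv.2
    · intro u _
      funext i
      simp
    · intro v _
      funext i
      simp
    · intro u hu
      rw [Finset.mem_filter] at hu
      rw [hf u hu.1 σ]
      simp only [hc, occurrences_comp]
  rw [Finset.sum_congr rfl fun σ _ => h2 σ, Finset.sum_const, nsmul_eq_mul, Finset.card_univ,
    Fintype.card_perm, Fintype.card_fin]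

end Sorted

end SumRank

namespace SumRank

/-! ### Specifications of computations with cost bounds -/

/-- `u β` bounds the cost of an integer operation on operands of at most `β` bits. -/
structure CostBound (κ : BitStep → ℕ) (u : ℕ → ℕ) : Prop where
  arith : ∀ (o : Arith) (a b β : ℕ), a ≤ β → b ≤ β → κ (.arith o a b) ≤ u β
  move : ∀ k, κ (.move k) ≤ k + 1
  le : ∀ β, 8 * β + 9 ≤ u β

section Run

variable {α γ : Type} {κ : BitStep → ℕ} {u : ℕ → ℕ}

/-- The result satisfies `Q`, and the cost is at most `c`. -/
def RSpec (κ : BitStep → ℕ) (r : Run α) (c : ℤ) (Q : α → Prop) : Prop :=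
  Q r.val ∧ ((r.2.map κ).sum : ℤ) ≤ c

variable {r : Run α} {f : α → Run γ} {c c' : ℤ} {Q Q' : α → Prop} {P : γ → Prop}

theorem RSpec.pure {a : α} (h : Q a) (hc : 0 ≤ c) : RSpec κ (pure a : Run α) c Q := ⟨h, hc⟩

theorem RSpec.mono (h : RSpec κ r c Q) (hQ : ∀ a, Q a → Q' a) (hc : c ≤ c') : RSpec κ r c' Q' :=
  ⟨hQ _ h.1, h.2.trans hc⟩

/-- Budgets are integers, so the remainder c - c' can be passed on without a side condition;
nonnegativity is checked once, at the end of a program. -/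
theorem RSpec.bind (h : RSpec κ r c' Q) (h' : ∀ a, Q a → RSpec κ (f a) (c - c') P) :
    RSpec κ (r >>= f) c P := by
  obtain ⟨h1, h2⟩ := h' _ h.1
  refine ⟨h1, ?_⟩
  have h3 := h.2
  change (((r.2 ++ (f r.1).2).map κ).sum : ℤ) ≤ c
  rw [List.map_append, List.sum_append, Nat.cast_add]
  change (((f r.1).2.map κ).sum : ℤ) ≤ c - c' at h2
  linarith

theorem RSpec.op (hκ : CostBound κ u) (o : Arith) {x y β : ℕ} (hx : x < 2 ^ β) (hy : y < 2 ^ β) :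
    RSpec κ (op o x y) (u β) (fun z => z = o.eval x y) := by
  refine ⟨rfl, ?_⟩
  have := hκ.arith o x.size y.size β (Nat.size_le.2 hx) (Nat.size_le.2 hy)
  simp only [SumRank.op, List.map_cons, List.map_nil, List.sum_cons, List.sum_nil, add_zero]
  exact_mod_cast this

theorem RSpec.op_bind (hκ : CostBound κ u) {o : Arith} {x y β : ℕ} {f : ℕ → Run γ}
    (hx : x < 2 ^ β) (hy : y < 2 ^ β) (h : RSpec κ (f (o.eval x y)) (c - u β) P) :
    RSpec κ (SumRank.op o x y >>= f) c P :=
  (RSpec.op hκ o hx hy).bind fun a ha => by rw [ha]; exact h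

theorem RSpec.move (hκ : CostBound κ u) (k : ℕ) : RSpec κ (move k) (k + 1) (fun _ => True) := by
  refine ⟨trivial, ?_⟩
  have := hκ.move k
  simp only [SumRank.move, List.map_cons, List.map_nil, List.sum_cons, List.sum_nil, add_zero]
  exact_mod_cast this

theorem RSpec.move_bind (hκ : CostBound κ u) {k : ℕ} {f : Unit → Run γ}
    (h : RSpec κ (f ()) (c - (k + 1)) P) : RSpec κ (SumRank.move k >>= f) c P :=
  (RSpec.move hκ k).bind fun _ _ => h

theorem RSpec.foldlM {ι : Type} {body : α → ι → Run α} {Inv : List ι → α → Prop} {c : ℤ}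
    (h : ∀ i L x, Inv (i :: L) x → RSpec κ (body x i) c (Inv L)) :
    ∀ (L : List ι) (x : α), Inv L x → RSpec κ (L.foldlM body x) (L.length * c) (Inv [])
  | [], _, hx => RSpec.pure hx (by simp)
  | i :: L, x, hx => by
    rw [List.foldlM_cons]
    refine (h i L x hx).bind fun a ha => (RSpec.foldlM h L a ha).mono (fun _ h => h) ?_
    push_cast [List.length_cons]
    linarith

theorem RSpec.minimum (hκ : CostBound κ u) {x y β : ℕ} (hx : x < 2 ^ β) (hy : y < 2 ^ β) :
    RSpec κ (minimum x y) (u β) (fun z => z = min x y) := by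
  refine RSpec.op_bind hκ hx hy ?_
  simp only [Arith.eval]
  by_cases h : x ≤ y
  · simpa [h] using RSpec.pure (κ := κ) (Q := fun z => z = x) rfl le_rfl
  · simpa [h, (not_le.1 h).le] using RSpec.pure (κ := κ) (Q := fun z => z = y) rfl le_rfl

theorem RSpec.maximum (hκ : CostBound κ u) {x y β : ℕ} (hx : x < 2 ^ β) (hy : y < 2 ^ β) :
    RSpec κ (maximum x y) (u β) (fun z => z = max x y) := by
  refine RSpec.op_bind hκ hx hy ?_
  simp only [Arith.eval]
  by_cases h : x ≤ y
  · simpa [h] using RSpec.pure (κ := κ) (Q := fun z => z = y) rfl le_rfl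
  · simpa [h, (not_le.1 h).le] using RSpec.pure (κ := κ) (Q := fun z => z = x) rfl le_rfl

end Run

section Alg

variable {α γ : Type} {κ : BitStep → ℕ} {u : ℕ → ℕ} {Φ : Mem → ℤ}

/-- The result and the final memory satisfy `Q`, and the cost, amortized by means of the potential
`Φ`, is at most `c`. -/
def ASpec (κ : BitStep → ℕ) (Φ : Mem → ℤ) (p : Alg α) (σ : Mem) (c : ℤ) (Q : α → Mem → Prop) :
    Prop :=
  Q (p.run σ).val.1 (p.run σ).val.2 ∧
    (((p.run σ).2.map κ).sum : ℤ) + Φ (p.run σ).val.2 ≤ c + Φ σ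

variable {p : Alg α} {f : α → Alg γ} {σ : Mem} {c c' : ℤ} {Q Q' : α → Mem → Prop}
  {P : γ → Mem → Prop}

theorem ASpec.pure {a : α} (h : Q a σ) (hc : 0 ≤ c) : ASpec κ Φ (pure a : Alg α) σ c Q :=
  ⟨h, by
    change ((([] : List BitStep).map κ).sum : ℤ) + Φ σ ≤ c + Φ σ
    simpa using hc⟩

theorem ASpec.mono (h : ASpec κ Φ p σ c Q) (hQ : ∀ a σ', Q a σ' → Q' a σ') (hc : c ≤ c') :
    ASpec κ Φ p σ c' Q' := ⟨hQ _ _ h.1, h.2.trans (by linarith)⟩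

theorem ASpec.bind (h : ASpec κ Φ p σ c' Q)
    (h' : ∀ a σ', Q a σ' → ASpec κ Φ (f a) σ' (c - c') P) : ASpec κ Φ (p >>= f) σ c P := by
  obtain ⟨h1, h2⟩ := h' _ _ h.1
  refine ⟨h1, ?_⟩
  have h3 := h.2
  have h4 : (((p >>= f).run σ).2.map κ).sum = (((p.run σ).2).map κ).sum +
      ((((f (p.run σ).val.1).run (p.run σ).val.2).2).map κ).sum := by
    rw [← List.sum_append, ← List.map_append]
    rfl
  rw [h4]
  have h5 : ((p >>= f).run σ).val.2 = ((f (p.run σ).val.1).run (p.run σ).val.2).val.2 := rfl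
  rw [h5, Nat.cast_add]
  linarith

theorem ASpec.lift {r : Run α} {R : α → Prop} (h : RSpec κ r c R) :
    ASpec κ Φ (liftM r : Alg α) σ c (fun a σ' => R a ∧ σ' = σ) := by
  refine ⟨⟨h.1, rfl⟩, ?_⟩
  have h1 : ((liftM r : Alg α).run σ).2 = r.2 ++ [] := rfl
  have h2 : ((liftM r : Alg α).run σ).val.2 = σ := rfl
  rw [h1, h2, List.append_nil]
  linarith [h.2]

theorem ASpec.lift_bind {r : Run α} {R : α → Prop} (h : RSpec κ r c' R)
    (h' : ∀ a, R a → ASpec κ Φ (f a) σ (c - c') P) : ASpec κ Φ ((liftM r : Alg α) >>= f) σ c P :=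
  (ASpec.lift h).bind fun a σ' ha => by rw [ha.2]; exact h' a ha.1

theorem ASpec.op_bind (hκ : CostBound κ u) {o : Arith} {x y β : ℕ} {f : ℕ → Alg γ}
    (hx : x < 2 ^ β) (hy : y < 2 ^ β) (h : ASpec κ Φ (f (o.eval x y)) σ (c - u β) P) :
    ASpec κ Φ ((liftM (op o x y) : Alg ℕ) >>= f) σ c P :=
  ASpec.lift_bind (RSpec.op hκ o hx hy) fun a ha => by rw [ha]; exact h

theorem ASpec.op (hκ : CostBound κ u) {o : Arith} {x y β : ℕ} {P : ℕ → Mem → Prop}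
    (hx : x < 2 ^ β) (hy : y < 2 ^ β) (h : P (o.eval x y) σ) (hc : u β ≤ c) :
    ASpec κ Φ (liftM (SumRank.op o x y) : Alg ℕ) σ c P :=
  (ASpec.lift (RSpec.op hκ o hx hy)).mono (fun a σ' ha => by rw [ha.1, ha.2]; exact h) hc

/-- All components of a table index are less than `2 ^ β`. -/
def IndexLt (β : ℕ) (idx : List ℕ) : Prop := idx.length ≤ 4 ∧ ∀ i ∈ idx, i < 2 ^ β

theorem IndexLt.indexBits_le {β : ℕ} {idx : List ℕ} (h : IndexLt β idx) :
    indexBits idx ≤ 4 * (β + 1) := by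
  have h1 := List.sum_le_card_nsmul (idx.map fun i => i.size + 1) (β + 1) (by
    intro x hx
    obtain ⟨i, hi, rfl⟩ := List.mem_map.1 hx
    exact Nat.succ_le_succ (Nat.size_le.2 (h.2 i hi)))
  rw [List.length_map, smul_eq_mul] at h1
  exact h1.trans (Nat.mul_le_mul_right _ h.1)

theorem contentBits_le {β : ℕ} {o : Option ℕ} (h : ∀ v, o = some v → v < 2 ^ β) :
    contentBits o ≤ β + 1 := by
  cases o with
  | none => simp [contentBits]
  | some v => exact Nat.succ_le_succ (Nat.size_le.2 (h v rfl))

theorem ASpec.load (hκ : CostBound κ u) {T : Tab} {idx : List ℕ} {β : ℕ} (hidx : IndexLt β idx)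
    (hv : ∀ v, σ T idx = some v → v < 2 ^ β) :
    ASpec κ Φ (load T idx) σ (u β) (fun o σ' => o = σ T idx ∧ σ' = σ) := by
  refine ⟨⟨rfl, rfl⟩, ?_⟩
  have h1 : ((SumRank.load T idx).run σ).2 = [.move (indexBits idx + contentBits (σ T idx))] := rfl
  have h2 : ((SumRank.load T idx).run σ).val.2 = σ := rfl
  rw [h1, h2]
  have h3 := hκ.move (indexBits idx + contentBits (σ T idx))
  have h4 := hκ.le β
  have h5 := hidx.indexBits_le
  have h6 := contentBits_le hv
  simp only [List.map_cons, List.map_nil, List.sum_cons, List.sum_nil, add_zero]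
  have : κ (.move (indexBits idx + contentBits (σ T idx))) ≤ u β := by omega
  have : (κ (.move (indexBits idx + contentBits (σ T idx))) : ℤ) ≤ u β := by exact_mod_cast this
  linarith

theorem ASpec.fetch_bind (hκ : CostBound κ u) {T : Tab} {idx : List ℕ} {β v : ℕ} {f : ℕ → Alg γ}
    (hidx : IndexLt β idx) (hv : σ T idx = some v) (hlt : v < 2 ^ β)
    (h : ASpec κ Φ (f v) σ (c - u β) P) : ASpec κ Φ (fetch T idx >>= f) σ c P := by
  have h1 : ASpec κ Φ (fetch T idx) σ (u β) (fun a σ' => a = v ∧ σ' = σ) := by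
    refine (ASpec.load hκ hidx (β := β) ?_).bind fun a σ' ha =>
      ASpec.pure ⟨by rw [ha.1, hv]; rfl, ha.2⟩ (by simp)
    intro v' hv'
    rw [hv] at hv'
    rwa [← Option.some.inj hv']
  exact h1.bind fun a σ' ha => by rw [ha.1, ha.2]; exact h

/-- The memory after storing a table entry. -/
def Mem.set (σ : Mem) (T : Tab) (idx : List ℕ) (v : Option ℕ) : Mem :=
  fun T₁ idx₁ => if T₁ = T ∧ idx₁ = idx then v else σ T₁ idx₁

theorem Mem.set_same (σ : Mem) (T : Tab) (idx : List ℕ) (v : Option ℕ) :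
    σ.set T idx v T idx = v := if_pos ⟨rfl, rfl⟩

theorem Mem.set_of_tab_ne (σ : Mem) {T T' : Tab} (h : T' ≠ T) (idx : List ℕ) (v : Option ℕ) :
    σ.set T idx v T' = σ T' := funext fun _ => if_neg fun hh => h hh.1

theorem Mem.set_of_idx_ne (σ : Mem) {T T' : Tab} {idx idx' : List ℕ} (h : idx' ≠ idx)
    (v : Option ℕ) : σ.set T idx v T' idx' = σ T' idx' := if_neg fun hh => h hh.2

theorem ASpec.store (hκ : CostBound κ u) {T : Tab} {idx : List ℕ} {β : ℕ} {v : Option ℕ}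
    {Q : Unit → Mem → Prop} (hidx : IndexLt β idx) (hv : ∀ x, v = some x → x < 2 ^ β)
    (hQ : Q () (σ.set T idx v)) (hc : u β + Φ (σ.set T idx v) - Φ σ ≤ c) :
    ASpec κ Φ (store T idx v) σ c Q := by
  refine ⟨hQ, ?_⟩
  have h1 : ((SumRank.store T idx v).run σ).2 = [.move (indexBits idx + contentBits v)] := rfl
  have h2 : ((SumRank.store T idx v).run σ).val.2 = σ.set T idx v := rfl
  rw [h1, h2]
  have h3 := hκ.move (indexBits idx + contentBits v)
  have h4 := hκ.le β
  have h5 := hidx.indexBits_le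
  have h6 := contentBits_le hv
  simp only [List.map_cons, List.map_nil, List.sum_cons, List.sum_nil, add_zero]
  have : κ (.move (indexBits idx + contentBits v)) ≤ u β := by omega
  have : (κ (.move (indexBits idx + contentBits v)) : ℤ) ≤ u β := by exact_mod_cast this
  linarith

theorem ASpec.store_bind (hκ : CostBound κ u) {T : Tab} {idx : List ℕ} {β : ℕ} {v : Option ℕ}
    {f : Unit → Alg γ} (hidx : IndexLt β idx) (hv : ∀ x, v = some x → x < 2 ^ β)
    (h : ASpec κ Φ (f ()) (σ.set T idx v) (c - (u β + Φ (σ.set T idx v) - Φ σ)) P) :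
    ASpec κ Φ (SumRank.store T idx v >>= f) σ c P :=
  (ASpec.store (Q := fun _ σ' => σ' = σ.set T idx v) hκ hidx hv rfl le_rfl).bind
    fun _ σ' hσ => by rw [hσ]; exact h

theorem ASpec.foldlM {ι : Type} {body : α → ι → Alg α} {Inv : List ι → α → Mem → Prop} {c : ℤ}
    (h : ∀ i L x σ, Inv (i :: L) x σ → ASpec κ Φ (body x i) σ c (Inv L)) :
    ∀ (L : List ι) (x : α) (σ : Mem), Inv L x σ →
      ASpec κ Φ (L.foldlM body x) σ (L.length * c) (Inv [])
  | [], _, _, hx => ASpec.pure hx (by simp)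
  | i :: L, x, σ, hx => by
    rw [List.foldlM_cons]
    refine (h i L x σ hx).bind fun a σ' ha => (ASpec.foldlM h L a σ' ha).mono (fun _ _ h => h) ?_
    push_cast [List.length_cons]
    linarith

theorem ASpec.loopFrom (hκ : CostBound κ u) {β hi : ℕ} {body : ℕ → α → Alg α}
    {Inv : ℕ → α → Mem → Prop} {c : ℤ} (hhi : hi + 1 < 2 ^ β)
    (hbody : ∀ i x σ, i ≤ hi → Inv i x σ → ASpec κ Φ (body i x) σ c (Inv (i + 1))) :
    ∀ (k i : ℕ) (x : α) (σ : Mem), i + k = hi + 1 → Inv i x σ →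
      ASpec κ Φ (loopFrom hi body k i x) σ (k * (c + 2 * u β) + u β) (Inv (hi + 1))
  | 0, i, x, σ, hik, hx => by
    obtain rfl : i = hi + 1 := by omega
    exact ASpec.op_bind hκ hhi (by omega) (ASpec.pure hx (by simp))
  | k + 1, i, x, σ, hik, hx => by
    refine ASpec.op_bind hκ (β := β) (by omega) (by omega) ((hbody i x σ (by omega) hx).bind
      fun a σ' ha => ASpec.op_bind hκ (β := β) (by omega) (by omega)
        ((ASpec.loopFrom hκ hhi hbody k (i + 1) a σ' (by omega) ha).mono (fun _ _ h => h) ?_))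
    push_cast
    linarith

theorem ASpec.loop (hκ : CostBound κ u) {β lo hi : ℕ} {body : ℕ → α → Alg α} {x : α}
    (Inv : ℕ → α → Mem → Prop) (c : ℤ) (hlo : lo ≤ hi + 1) (hhi : hi + 1 < 2 ^ β)
    (h0 : Inv lo x σ)
    (hbody : ∀ i x σ, lo ≤ i → i ≤ hi → Inv i x σ → ASpec κ Φ (body i x) σ c (Inv (i + 1))) :
    ASpec κ Φ (loop lo hi x body) σ ((hi + 1 - lo : ℕ) * (c + 2 * u β) + u β) (Inv (hi + 1)) :=
  ((ASpec.loopFrom (Inv := fun i x σ => lo ≤ i ∧ Inv i x σ) hκ hhi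
    (fun i x σ hi h => (hbody i x σ h.1 hi h.2).mono (fun _ _ h' => ⟨by omega, h'⟩) le_rfl)
    (hi + 1 - lo) lo x σ (by omega) ⟨le_rfl, h0⟩)).mono (fun _ _ h => h.2) le_rfl

end Alg

end SumRank

namespace SumRank

/-! ### The procedure `scomp` -/

theorem IsCompletion.refl {ι : Type*} {ζ : ℕ} (E : Finset ι) {v : ι → ℕ} (hv : ∀ i ∈ E, v i ≤ ζ) :
    IsCompletion ζ E v (∑ i ∈ E, v i) v where
  le _ _ := le_rfl
  le_cap := hv
  sum_eq := rfl
  priority _ _ _ _ _ h := absurd h (lt_irrefl _)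
  balance _ _ _ _ h := h.le.trans (Nat.le_succ _)

/-- Priority survives because h has maximal v among the positions that are not full, and balance
because w h is minimal among those with the same v; a full position is at least as large as anything
capped by ζ. -/
theorem IsCompletion.step {ι : Type*} [DecidableEq ι] {ζ k : ℕ} {E : Finset ι} {v w : ι → ℕ}
    (hw : IsCompletion ζ E v k w) {h : ι} (hE : h ∈ E) (hζ : w h ≠ ζ)
    (hmax : ∀ i ∈ E, w i ≠ ζ → v i ≤ v h)
    (hmin : ∀ i ∈ E, w i ≠ ζ → v i = v h → w h ≤ w i) :
    IsCompletion ζ E v (k + 1) (Function.update w h (w h + 1)) where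
  le i hi := by
    have := hw.le i hi
    rcases eq_or_ne i h with rfl | hih
    · simp; omega
    · simpa [hih] using this
  le_cap i hi := by
    have := hw.le_cap i hi
    rcases eq_or_ne i h with rfl | hih
    · simp; omega
    · simpa [hih] using this
  sum_eq := by
    rw [Finset.sum_update_of_mem hE, ← hw.sum_eq, ← Finset.add_sum_erase E w hE,
      Finset.sdiff_singleton_eq_erase]
    ring
  priority i hi j hj hlt hj' := by
    rcases eq_or_ne i h with rfl | hih
    · have hji : j ≠ i := by rintro rfl; omega
      rw [Function.update_of_ne hji] at hj'
      exact absurd (hw.priority i hi j hj hlt hj') hζ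
    · rw [Function.update_of_ne hih]
      rcases eq_or_ne j h with rfl | hjh
      · by_contra hne
        have := hmax i hi hne
        omega
      · rw [Function.update_of_ne hjh] at hj'
        exact hw.priority i hi j hj hlt hj'
  balance i hi j hj hij := by
    have h0 := hw.balance i hi j hj hij
    rcases eq_or_ne i h with rfl | hih
    · rcases eq_or_ne j i with rfl | hji
      · omega
      · rw [Function.update_self, Function.update_of_ne hji]
        by_cases hjζ : w j = ζ
        · have := hw.le_cap i hi
          omega
        · have := hmin j hj hjζ hij.symm
          omega
    · rw [Function.update_of_ne hih]
      rcases eq_or_ne j h with rfl | hjh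
      · rw [Function.update_self]
        omega
      · rwa [Function.update_of_ne hjh]

section Scomp

variable {κ : BitStep → ℕ} {u : ℕ → ℕ} {l β n : ℕ} {v : Fin l → ℕ}

theorem size_add_size_le {x y β : ℕ} (hx : x < 2 ^ β) (hy : y < 2 ^ β) :
    x.size + y.size ≤ 2 * β := by
  have := Nat.size_le.2 hx
  have := Nat.size_le.2 hy
  omega

theorem RSpec.select (hκ : CostBound κ u) (hl : l < 2 ^ β) (hv : ∀ i, v i < 2 ^ β) {x : ℕ}
    (hx : x < 2 ^ β) (b : ℕ) (J : List (Fin l)) (hJ : J.length ≤ n) :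
    RSpec κ (select b v x J) (n * (2 * u β)) (fun K => K.length ≤ n ∧
      ∀ i, i ∈ K ↔ i ∈ J ∧ (if v i = x then 1 else 0) = b) := by
  induction J generalizing n with
  | nil => exact RSpec.pure (by simp) (by positivity)
  | cons i J ih =>
    obtain ⟨n, rfl⟩ : ∃ m, n = m + 1 := ⟨n - 1, by rw [List.length_cons] at hJ; omega⟩
    rw [List.length_cons] at hJ
    have hmove : (((i.1.size + (v i).size : ℕ) : ℤ) + 1) ≤ u β := by
      have h1 := size_add_size_le (i.2.trans hl) (hv i)
      have h2 := hκ.le β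
      exact_mod_cast (by omega : i.1.size + (v i).size + 1 ≤ u β)
    refine RSpec.move_bind hκ (RSpec.op_bind hκ (hv i) hx ((ih (n := n) (by omega)).bind
      fun K hK => ?_))
    have hc : (0 : ℤ) ≤ ((n + 1 : ℕ) : ℤ) * (2 * u β) - (((i.1.size + (v i).size : ℕ) : ℤ) + 1) -
        u β - n * (2 * u β) := by
      push_cast at hmove ⊢
      linarith
    by_cases hb : Arith.eq.eval (v i) x = b
    · rw [if_pos hb]
      refine RSpec.pure ⟨by simpa using hK.1, fun j => ?_⟩ hc
      rw [List.mem_cons, List.mem_cons, hK.2]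
      constructor
      · rintro (rfl | h)
        · exact ⟨Or.inl rfl, hb⟩
        · exact ⟨Or.inr h.1, h.2⟩
      · rintro ⟨rfl | h, h'⟩
        · exact Or.inl rfl
        · exact Or.inr ⟨h, h'⟩
    · rw [if_neg hb]
      refine RSpec.pure ⟨hK.1.trans (Nat.le_succ _), fun j => ?_⟩ hc
      rw [List.mem_cons, hK.2]
      constructor
      · exact fun h => ⟨Or.inr h.1, h.2⟩
      · rintro ⟨rfl | h, h'⟩
        · exact absurd h' hb
        · exact ⟨h, h'⟩

/-- Maximum and minimum are treated at once: `rel` is the order or its converse. -/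
theorem RSpec.extremum (hκ : CostBound κ u) (hl : l < 2 ^ β) (hv : ∀ i, v i < 2 ^ β)
    {better : ℕ → ℕ → Run ℕ} (rel : ℕ → ℕ → Prop) (hrefl : ∀ x, rel x x)
    (htrans : ∀ x y z, rel x y → rel y z → rel x z)
    (hb : ∀ x y, x < 2 ^ β → y < 2 ^ β → RSpec κ (better x y) (u β)
      (fun z => (z = x ∨ z = y) ∧ rel z x ∧ rel z y))
    (J : List (Fin l)) (hJ : J.length ≤ n) (hJ0 : J ≠ []) :
    RSpec κ (extremum better v J) (n * (2 * u β))
      (fun a => (∃ i ∈ J, v i = a) ∧ ∀ j ∈ J, rel a (v j)) := by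
  cases J with
  | nil => exact absurd rfl hJ0
  | cons i J =>
    have h := RSpec.foldlM (κ := κ) (c := 2 * u β)
      (body := fun x j => do
        SumRank.move (j.1.size + (v j).size)
        better x (v j))
      (Inv := fun L x => (∃ j ∈ i :: J, v j = x) ∧ (∀ j ∈ L, j ∈ i :: J) ∧
        ∀ j ∈ i :: J, j ∈ L ∨ rel x (v j)) (by
        rintro j L x ⟨⟨k, hk, rfl⟩, h2, h3⟩
        refine RSpec.move_bind hκ ((hb (v k) (v j) (hv k) (hv j)).mono ?_ ?_)
        · rintro z ⟨hz1, hz2, hz3⟩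
          refine ⟨?_, fun m hm => h2 m (List.mem_cons_of_mem _ hm), fun m hm => ?_⟩
          · rcases hz1 with rfl | rfl
            · exact ⟨k, hk, rfl⟩
            · exact ⟨j, h2 j (List.mem_cons_self), rfl⟩
          · rcases h3 m hm with h | h
            · rcases List.mem_cons.1 h with rfl | h
              · exact Or.inr hz3
              · exact Or.inl h
            · exact Or.inr (htrans _ _ _ hz2 h)
        · have h1 := size_add_size_le (j.2.trans hl) (hv j)
          have h2 := hκ.le β
          have : (((j.1.size + (v j).size : ℕ) : ℤ) + 1) ≤ u β := by
            exact_mod_cast (by omega : j.1.size + (v j).size + 1 ≤ u β)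
          linarith)
      J (v i) ⟨⟨i, List.mem_cons_self, rfl⟩, fun j hj => List.mem_cons_of_mem _ hj, fun j hj => by
        rcases List.mem_cons.1 hj with rfl | h
        · exact Or.inr (hrefl _)
        · exact Or.inl h⟩
    refine RSpec.mono h (fun a ha => ⟨ha.1, fun j hj => (ha.2.2 j hj).resolve_left (by simp)⟩) ?_
    rw [List.length_cons] at hJ
    have : (J.length : ℤ) ≤ n := by exact_mod_cast (by omega : J.length ≤ n)
    exact mul_le_mul_of_nonneg_right this (by positivity)

/-- The invariant is that the current vector is a completion of t for its own sum. An increment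
costs 13·l·u β: five passes over lists of length at most l, each 2·l·u β, one move and two
operations. -/
theorem RSpec.raise (hκ : CostBound κ u) (χ : Coins) {ζ : ℕ} {t : Fin l → ℕ} (hl : l < 2 ^ β)
    (hζ : ζ + 1 < 2 ^ β) (ht : ∀ i, t i ≤ ζ) (d k : ℕ) (v : Fin l → ℕ)
    (hv : IsCompletion ζ Finset.univ t k v) (hk : k + d ≤ l * ζ) (hd : d < 2 ^ β) :
    RSpec κ (raise χ ζ t d v) (d * (l * (13 * u β)))
      (fun w => IsCompletion ζ Finset.univ t (k + d) w) := by
  induction d generalizing k v with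
  | zero => exact RSpec.pure hv (by simp)
  | succ d ih =>
    have hvβ : ∀ i, v i < 2 ^ β := fun i => by
      have := hv.le_cap i (Finset.mem_univ i)
      omega
    have htβ : ∀ i, t i < 2 ^ β := fun i => by
      have := ht i
      omega
    have hl0 : 0 < l := by
      rcases Nat.eq_zero_or_pos l with rfl | h
      · omega
      · exact h
    -- If all positions were full, the sum k would be lζ, leaving no room for d + 1 more increments.
    -- This keeps all three candidate lists nonempty.
    obtain ⟨i₀, hi₀⟩ : ∃ i, v i ≠ ζ := by
      by_contra hall
      push Not at hall
      have := hv.sum_eq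
      simp [hall] at this
      omega
    unfold SumRank.raise
    refine (RSpec.select hκ hl hvβ (by omega) 0 (List.finRange l) (n := l) (by simp)).bind
      fun J₁ hJ₁ => ?_
    have hJ₁' : ∀ i, i ∈ J₁ ↔ v i ≠ ζ := fun i => by rw [hJ₁.2]; simp
    refine (RSpec.extremum hκ hl htβ (fun x y => y ≤ x) (fun _ => le_rfl)
      (fun _ _ _ h h' => h'.trans h) (fun x y hx hy => (RSpec.maximum hκ hx hy).mono
        (fun z hz => by subst hz; exact ⟨max_choice x y, le_max_left _ _, le_max_right _ _⟩) le_rfl)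
      J₁ hJ₁.1 (List.ne_nil_of_mem ((hJ₁' i₀).2 hi₀))).bind fun a ha => ?_
    obtain ⟨⟨i₁, hi₁, rfl⟩, hamax⟩ := ha
    refine (RSpec.select hκ hl htβ (htβ i₁) 1 J₁ hJ₁.1).bind fun J₂ hJ₂ => ?_
    have hJ₂' : ∀ i, i ∈ J₂ ↔ v i ≠ ζ ∧ t i = t i₁ := fun i => by
      rw [hJ₂.2, hJ₁']
      simp
    refine (RSpec.extremum hκ hl hvβ (fun x y => x ≤ y) (fun _ => le_rfl)
      (fun _ _ _ h h' => h.trans h') (fun x y hx hy => (RSpec.minimum hκ hx hy).mono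
        (fun z hz => by subst hz; exact ⟨min_choice x y, min_le_left _ _, min_le_right _ _⟩) le_rfl)
      J₂ hJ₂.1 (List.ne_nil_of_mem ((hJ₂' i₁).2 ⟨(hJ₁' i₁).1 hi₁, rfl⟩))).bind fun b hb => ?_
    obtain ⟨⟨i₂, hi₂, rfl⟩, hbmin⟩ := hb
    refine (RSpec.select hκ hl hvβ (hvβ i₂) 1 J₂ hJ₂.1).bind fun J₃ hJ₃ => ?_
    have hJ₃' : ∀ i, i ∈ J₃ ↔ i ∈ J₂ ∧ v i = v i₂ := fun i => by
      rw [hJ₃.2]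
      simp
    have hi₂' : i₂ ∈ J₃ := (hJ₃' i₂).2 ⟨hi₂, rfl⟩
    obtain ⟨j, J, rfl⟩ : ∃ j J, J₃ = j :: J := by
      cases J₃ with
      | nil => simp at hi₂'
      | cons j J => exact ⟨j, J, rfl⟩
    dsimp only
    refine RSpec.move_bind hκ ?_
    set h := (j :: J).get ⟨χ l t v (d + 1) % (J.length + 1), Nat.mod_lt _ (Nat.succ_pos _)⟩ with hh
    have hmem : h ∈ j :: J := List.get_mem _ _
    obtain ⟨hm2, hm3⟩ := (hJ₃' h).1 hmem
    obtain ⟨hm4, hm5⟩ := (hJ₂' h).1 hm2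
    have hcap := hv.le_cap h (Finset.mem_univ h)
    refine RSpec.op_bind hκ (β := β) (hvβ h) (by omega) (RSpec.op_bind hκ (β := β) hd (by omega) ?_)
    have hstep := hv.step (Finset.mem_univ h) hm4
      (fun i _ hi => by rw [hm5]; exact hamax i ((hJ₁' i).2 hi))
      (fun i _ hi hti => by rw [hm3]; exact hbmin i ((hJ₂' i).2 ⟨hi, hti.trans hm5⟩))
    refine (ih (k + 1) _ hstep (by omega) (by omega)).mono
      (fun w hw => by rwa [show k + (d + 1) = k + 1 + d by omega]) ?_
    have hlen : ((J.length + 1 : ℕ) : ℤ) + 1 ≤ l * u β := by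
      have h1 := hJ₃.1
      rw [List.length_cons] at h1
      have h2 := hκ.le β
      have h3 : l * 9 ≤ l * u β := Nat.mul_le_mul_left _ (by omega)
      exact_mod_cast (by omega : J.length + 1 + 1 ≤ l * u β)
    have hu1 : (u β : ℤ) ≤ l * u β := by
      exact_mod_cast Nat.le_mul_of_pos_left _ hl0
    push_cast at hlen ⊢
    linarith

theorem RSpec.scomp (hκ : CostBound κ u) (χ : Coins) {ζ s : ℕ} {t : Fin l → ℕ} (hl : l < 2 ^ β)
    (hζ : ζ + 1 < 2 ^ β) (hlζ : l * ζ < 2 ^ β) (ht : ∀ i, t i ≤ ζ) (hts : ∑ i, t i ≤ s)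
    (hs : s ≤ l * ζ) :
    RSpec κ (scomp χ ζ t s) ((s + 1) * ((l + 1) * (13 * u β)))
      (fun w => IsCompletion ζ Finset.univ t s w) := by
  have h := RSpec.foldlM (κ := κ) (c := u β) (body := fun x i => SumRank.op .add x (t i))
    (Inv := fun L x => x + (L.map t).sum = ∑ i, t i) (by
      intro i L x hx
      rw [List.map_cons, List.sum_cons] at hx
      refine (RSpec.op hκ .add (β := β) (by omega) (by have := ht i; omega)).mono ?_ le_rfl
      rintro z rfl
      simp only [Arith.eval]
      omega) (List.finRange l) 0 (by rw [zero_add, ← List.ofFn_eq_map, List.sum_ofFn])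
  unfold SumRank.scomp
  refine h.bind fun T hT => ?_
  obtain rfl : T = ∑ i, t i := by simpa using hT
  refine RSpec.op_bind hκ (β := β) (by omega) (by omega) ?_
  simp only [Arith.eval]
  refine (RSpec.raise hκ χ hl hζ ht (s - ∑ i, t i) _ t
    (IsCompletion.refl Finset.univ fun i _ => ht i) (by omega) (by omega)).mono
    (fun w hw => by rwa [Nat.add_sub_cancel' hts] at hw) ?_
  have h1 : ((s - ∑ i, t i : ℕ) : ℤ) ≤ s := by exact_mod_cast Nat.sub_le _ _
  have h2 : ((s - ∑ i, t i : ℕ) : ℤ) * (l * (13 * u β)) ≤ s * (l * (13 * u β)) :=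
    mul_le_mul_of_nonneg_right h1 (by positivity)
  have h3 : (0 : ℤ) ≤ s * (13 * u β) := by positivity
  have h4 : (0 : ℤ) ≤ l * u β := by positivity
  have h5 : (0 : ℤ) ≤ u β := by positivity
  rw [List.length_finRange]
  linarith

end Scomp

/-- A crude cost function. -/
def sizeCost : BitStep → ℕ
  | .arith _ a b => max a b
  | .move k => k + 1

theorem sizeCost_bound : CostBound sizeCost fun β => 8 * β + 9 where
  arith _ a b β ha hb := by simp only [sizeCost]; omega
  move _ := le_rfl
  le _ := le_rfl

/-- The result of `scomp` is a completion. -/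
theorem isCompletion_scomp (χ : Coins) {l ζ s : ℕ} {t : Fin l → ℕ} (ht : ∀ i, t i ≤ ζ)
    (hts : ∑ i, t i ≤ s) (hs : s ≤ l * ζ) :
    IsCompletion ζ Finset.univ t s (scomp χ ζ t s).val := by
  -- Only the result matters here, so any word length large enough for all bounds will do.
  have hβ : l + (ζ + 1) + l * ζ < 2 ^ (l + (ζ + 1) + l * ζ) := Nat.lt_two_pow_self
  exact (RSpec.scomp sizeCost_bound χ (β := l + (ζ + 1) + l * ζ) (by omega) (by omega) (by omega)
    ht hts hs).1

end SumRank

namespace SumRank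

/-! ### The auxiliary tables -/

/-- The memories agree outside the tables in the list `S`. -/
def Mem.EqOff (S : List Tab) (σ σ' : Mem) : Prop := ∀ T ∉ S, σ T = σ' T

theorem Mem.EqOff.set {S : List Tab} {σ σ' : Mem} (h : σ.EqOff S σ') {T : Tab} (hT : T ∈ S)
    (idx : List ℕ) (v : Option ℕ) : (σ.set T idx v).EqOff S σ' := fun T' hT' => by
  rw [Mem.set_of_tab_ne _ (by rintro rfl; exact hT' hT), h T' hT']

theorem Mem.EqOff.refl (S : List Tab) (σ : Mem) : σ.EqOff S σ := fun _ _ => rfl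

section Set

variable {σ : Mem} {T : Tab}

theorem Mem.set_filled {idx idx₀ : List ℕ} {v v₀ : Option ℕ} (h : idx ≠ idx₀ → σ T idx = v)
    (h₀ : idx = idx₀ → v₀ = v) : σ.set T idx₀ v₀ T idx = v := by
  by_cases hi : idx = idx₀
  · rw [hi, Mem.set_same, h₀ hi]
  · rw [Mem.set_of_idx_ne _ hi, h hi]

/-- D describes the part of the table filled so far and D' the part filled after the store. Both are
arbitrary predicates, so loop invariants reduce to linear arithmetic on indices. -/
theorem Mem.set_filled₁ {D D' : ℕ → Prop} {f : ℕ → ℕ} {a₀ v₀ : ℕ}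
    (h : ∀ a, D a → σ T [a] = some (f a)) (hD : ∀ a, D' a → D a ∨ a = a₀) (h₀ : v₀ = f a₀) :
    ∀ a, D' a → σ.set T [a₀] (some v₀) T [a] = some (f a) := fun a ha =>
  Mem.set_filled (fun hne => h a ((hD a ha).resolve_right fun h' => hne (by rw [h'])))
    (by rintro h; simp only [List.cons.injEq, and_true] at h; rw [h₀, h])

theorem Mem.set_filled₂ {D D' : ℕ → ℕ → Prop} {f : ℕ → ℕ → ℕ} {a₀ b₀ v₀ : ℕ}
    (h : ∀ a b, D a b → σ T [a, b] = some (f a b))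
    (hD : ∀ a b, D' a b → D a b ∨ a = a₀ ∧ b = b₀) (h₀ : v₀ = f a₀ b₀) :
    ∀ a b, D' a b → σ.set T [a₀, b₀] (some v₀) T [a, b] = some (f a b) := fun a b ha =>
  Mem.set_filled (fun hne => h a b ((hD a b ha).resolve_right fun h' => hne (by rw [h'.1, h'.2])))
    (by rintro h; simp only [List.cons.injEq, and_true] at h; rw [h₀, h.1, h.2])

theorem Mem.set_filled₃ {D D' : ℕ → ℕ → ℕ → Prop} {f : ℕ → ℕ → ℕ → ℕ} {a₀ b₀ c₀ v₀ : ℕ}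
    (h : ∀ a b c, D a b c → σ T [a, b, c] = some (f a b c))
    (hD : ∀ a b c, D' a b c → D a b c ∨ a = a₀ ∧ b = b₀ ∧ c = c₀) (h₀ : v₀ = f a₀ b₀ c₀) :
    ∀ a b c, D' a b c → σ.set T [a₀, b₀, c₀] (some v₀) T [a, b, c] = some (f a b c) :=
  fun a b c ha => Mem.set_filled
    (fun hne => h a b c ((hD a b c ha).resolve_right fun h' => hne (by rw [h'.1, h'.2.1, h'.2.2])))
    (by rintro h; simp only [List.cons.injEq, and_true] at h; rw [h₀, h.1, h.2.1, h.2.2])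

end Set

theorem IndexLt.one {β a : ℕ} (ha : a < 2 ^ β) : IndexLt β [a] := by
  simpa [IndexLt] using ha

theorem IndexLt.two {β a b : ℕ} (ha : a < 2 ^ β) (hb : b < 2 ^ β) : IndexLt β [a, b] := by
  simpa [IndexLt] using ⟨ha, hb⟩

theorem IndexLt.three {β a b c : ℕ} (ha : a < 2 ^ β) (hb : b < 2 ^ β) (hc : c < 2 ^ β) :
    IndexLt β [a, b, c] := by
  simpa [IndexLt] using ⟨ha, hb, hc⟩

theorem IndexLt.four {β a b c d : ℕ} (ha : a < 2 ^ β) (hb : b < 2 ^ β) (hc : c < 2 ^ β)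
    (hd : d < 2 ^ β) : IndexLt β [a, b, c, d] := by
  simpa [IndexLt] using ⟨ha, hb, hc, hd⟩

theorem Arith.eval_eq_eq_one {x y : ℕ} : Arith.eq.eval x y = 1 ↔ x = y := by
  simp [Arith.eval]

theorem Arith.eval_le_eq_one {x y : ℕ} : Arith.le.eval x y = 1 ↔ x ≤ y := by
  simp [Arith.eval]

section Fill

variable {α γ : Type} {κ : BitStep → ℕ} {u : ℕ → ℕ} {σ : Mem} {Φ : Mem → ℤ}

/-- A version of `ASpec.loop` with a simpler bound. -/
theorem ASpec.loop_le (hκ : CostBound κ u) {β lo hi n : ℕ} {body : ℕ → α → Alg α} {x : α}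
    (Inv : ℕ → α → Mem → Prop) (c : ℤ) {c' : ℤ} (hc : 0 ≤ c) (hlo : lo ≤ hi + 1)
    (hhi : hi + 1 < 2 ^ β)
    (hn : hi + 1 - lo ≤ n) (hn1 : 1 ≤ n) (h0 : Inv lo x σ)
    (hbody : ∀ i x σ, lo ≤ i → i ≤ hi → Inv i x σ → ASpec κ Φ (body i x) σ c (Inv (i + 1)))
    (hc' : n * (c + 3 * u β) ≤ c') :
    ASpec κ Φ (SumRank.loop lo hi x body) σ c' (Inv (hi + 1)) := by
  refine (ASpec.loop hκ Inv c hlo hhi h0 hbody).mono (fun _ _ h => h) (le_trans ?_ hc')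
  have h1 : ((hi + 1 - lo : ℕ) : ℤ) ≤ n := by exact_mod_cast hn
  have h2 : (1 : ℤ) ≤ n := by exact_mod_cast hn1
  have h3 : (0 : ℤ) ≤ u β := by positivity
  have h4 := mul_le_mul_of_nonneg_right h1 (by linarith : (0 : ℤ) ≤ c + 2 * u β)
  have h5 := mul_le_mul_of_nonneg_right h2 h3
  linarith

theorem ASpec.ite {p : Prop} [Decidable p] {x y : Alg α} {c : ℤ} {Q : α → Mem → Prop}
    (h1 : p → ASpec κ Φ x σ c Q) (h2 : ¬ p → ASpec κ Φ y σ c Q) :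
    ASpec κ Φ (if p then x else y) σ c Q := by
  by_cases h : p
  · rw [if_pos h]; exact h1 h
  · rw [if_neg h]; exact h2 h

theorem ASpec.fillGauss (hκ : CostBound κ u) {q ζ μ β : ℕ} (hζ : ζ + 1 < 2 ^ β)
    (hμ : μ + 1 < 2 ^ β) (hq0 : 1 ≤ q) (hq : q < 2 ^ β) (hp : ∀ b ≤ μ, q ^ b < 2 ^ β)
    (hg : ∀ a ≤ ζ, ∀ b ≤ μ, q ^ b * qBinom q a b < 2 ^ β) :
    ASpec κ (fun _ => 0) (fillGauss q ζ μ) σ ((ζ + 1) * ((μ + 1) * (22 * u β)))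
      (fun _ σ' => (∀ a b, a ≤ ζ → b ≤ μ → σ' .gauss [a, b] = some (qBinom q a b)) ∧
        σ'.EqOff [.pow, .gauss] σ) := by
  have hg' : ∀ a ≤ ζ, ∀ b ≤ μ, qBinom q a b < 2 ^ β := fun a ha b hb =>
    (Nat.le_mul_of_pos_left _ (by positivity)).trans_lt (hg a ha b hb)
  have hu : (0 : ℤ) ≤ u β := by positivity
  unfold SumRank.fillGauss
  set σ₀ := σ
  refine (ASpec.loop_le (n := μ + 1) hκ (fun b p σ => p = q ^ b ∧
      (∀ b', b' < b → σ .pow [b'] = some (q ^ b')) ∧ σ.EqOff [.pow, .gauss] σ₀) (2 * u β) (by positivity) (by omega) hμ (by omega)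
      (by omega) ⟨by simp, by simp, Mem.EqOff.refl _ _⟩ ?_ le_rfl).bind ?_
  · rintro b _ σ - hb ⟨rfl, h, hoff⟩
    refine ASpec.store_bind hκ (β := β) (IndexLt.one (by omega))
      (by rintro _ ⟨⟩; exact hp b hb) (ASpec.op hκ (β := β) (hp b hb) hq ⟨(pow_succ q b).symm, ?_,
        hoff.set (by simp) _ _⟩ (by linarith))
    exact Mem.set_filled₁ h (fun a ha => by omega) rfl
  rintro _ σ ⟨-, hpow, hoff⟩
  refine ASpec.mono (ASpec.loop_le (n := ζ + 1) hκ (fun a _ σ =>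
    (∀ b, b ≤ μ → σ .pow [b] = some (q ^ b)) ∧
    (∀ a' b, (a' < a ∧ b ≤ μ) → σ .gauss [a', b] = some (qBinom q a' b)) ∧ σ.EqOff [.pow, .gauss] σ₀)
    ((μ + 1) * (14 * u β)) (by positivity) (by omega) hζ (by omega) (by omega)
    ⟨fun b hb => hpow b (by omega), by simp, hoff⟩ ?_ le_rfl)
    (fun _ σ' h => ⟨fun a b ha hb => h.2.1 a b ⟨by omega, hb⟩, h.2.2⟩) ?_
  · rintro a _ σ - ha ⟨h1, h2, hoff⟩
    -- The filled part is described lexicographically: complete rows below a, and row a up to b.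
    refine ASpec.mono (ASpec.loop_le (n := μ + 1) hκ (fun b _ σ =>
      (∀ b, b ≤ μ → σ .pow [b] = some (q ^ b)) ∧
      (∀ a' b', (b' ≤ μ ∧ (a' < a ∨ a' = a ∧ b' < b)) → σ .gauss [a', b'] = some (qBinom q a' b')) ∧
      σ.EqOff [.pow, .gauss] σ₀)
      (11 * u β) (by positivity) (by omega) hμ (by omega) (by omega)
      ⟨h1, fun a' b' h => h2 a' b' ⟨by omega, h.1⟩, hoff⟩ ?_ le_rfl)
      (fun _ σ' h => ⟨h.1, fun a' b' h' => h.2.1 a' b' ⟨by omega, by omega⟩, h.2.2⟩) (by push_cast; linarith)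
    rintro b _ σ - hb ⟨h1, h2, hoff⟩
    have hidx : ∀ a' b', a' ≤ a → b' ≤ b → IndexLt β [a', b'] := fun a' b' _ _ =>
      IndexLt.two (by omega) (by omega)
    have h1β : 1 < 2 ^ β := by omega
    have hst : ∀ (v : ℕ) (c : ℤ), v = qBinom q a b → (u β : ℤ) ≤ c →
        ASpec κ (fun _ => 0) (SumRank.store .gauss [a, b] (some v)) σ c (fun _ σ =>
          (∀ b, b ≤ μ → σ .pow [b] = some (q ^ b)) ∧
          (∀ a' b', (b' ≤ μ ∧ (a' < a ∨ a' = a ∧ b' < b + 1)) →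
            σ .gauss [a', b'] = some (qBinom q a' b')) ∧ σ.EqOff [.pow, .gauss] σ₀) := fun v c hv hc =>
      ASpec.store hκ (β := β) (hidx a b le_rfl le_rfl)
        (by rintro _ ⟨⟩; rw [hv]; exact hg' a ha b hb)
        ⟨fun b' hb' => by rw [Mem.set_of_tab_ne _ (by simp), h1 b' hb'],
          Mem.set_filled₂ h2 (fun a' b' h => by omega) hv, hoff.set (by simp) _ _⟩ (by linarith)
    refine ASpec.op_bind hκ (β := β) (by omega) (by omega) (ASpec.ite (fun hb0 => ?_) fun hb0 =>
      ASpec.op_bind hκ (β := β) (by omega) (by omega) (ASpec.ite (fun ha0 => ?_) fun ha0 => ?_))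
    · rw [Arith.eval_eq_eq_one] at hb0
      exact hst 1 _ (by rw [hb0, qBinom_zero_right]) (by linarith)
    · rw [Arith.eval_eq_eq_one] at ha0 hb0
      obtain ⟨b, rfl⟩ := Nat.exists_eq_succ_of_ne_zero hb0
      exact hst 0 _ (by rw [ha0]; rfl) (by linarith)
    · rw [Arith.eval_eq_eq_one] at ha0 hb0
      obtain ⟨b, rfl⟩ := Nat.exists_eq_succ_of_ne_zero hb0
      obtain ⟨a, rfl⟩ := Nat.exists_eq_succ_of_ne_zero ha0
      refine ASpec.op_bind hκ (β := β) (by omega) (by omega) (ASpec.op_bind hκ (β := β)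
        (by omega) (by omega) ?_)
      refine ASpec.fetch_bind hκ (β := β) (hidx a b (by omega) (by omega))
        (h2 a b ⟨by omega, by omega⟩) (hg' _ (by omega) _ (by omega)) ?_
      refine ASpec.fetch_bind hκ (β := β) (hidx a (b + 1) (by omega) (by omega))
        (h2 a (b + 1) ⟨by omega, by omega⟩) (hg' _ (by omega) _ (by omega)) ?_
      refine ASpec.fetch_bind hκ (β := β) (IndexLt.one (by omega)) (h1 (b + 1) hb) (hp _ hb) ?_
      refine ASpec.op_bind hκ (β := β) (hp _ hb) (hg' _ (by omega) _ (by omega)) ?_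
      refine ASpec.op_bind hκ (β := β) (hg' _ (by omega) _ (by omega))
        (hg _ (by omega) _ (by omega)) ?_
      exact hst _ _ rfl (by linarith)
  · have h1 : (0 : ℤ) ≤ ζ * ((μ + 1) * u β) := by positivity
    have h2 : (0 : ℤ) ≤ (ζ + 1) * (μ * u β) := by positivity
    push_cast
    linarith

theorem ASpec.fillChoose (hκ : CostBound κ u) {l β : ℕ} (hl : l + 1 < 2 ^ β)
    (hc : ∀ i ≤ l, ∀ j ≤ l, i.choose j < 2 ^ β) :
    ASpec κ (fun _ => 0) (fillChoose l) σ ((l + 1) * ((l + 1) * (18 * u β)))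
      (fun _ σ' => (∀ i j, i ≤ l → j ≤ l → σ' .choose [i, j] = some (i.choose j)) ∧
        σ'.EqOff [.choose] σ) := by
  have hu : (0 : ℤ) ≤ u β := by positivity
  unfold SumRank.fillChoose
  set σ₀ := σ
  refine ASpec.mono (ASpec.loop_le (n := l + 1) hκ (fun i _ σ =>
    (∀ i' j, (i' < i ∧ j ≤ l) → σ .choose [i', j] = some (i'.choose j)) ∧ σ.EqOff [.choose] σ₀)
    ((l + 1) * (12 * u β)) (by positivity) (by omega) hl (by omega) (by omega)
    ⟨by simp, Mem.EqOff.refl _ _⟩ ?_ le_rfl)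
    (fun _ σ' h => ⟨fun a b ha hb => h.1 a b ⟨by omega, hb⟩, h.2⟩) ?_
  · rintro i _ σ - hi ⟨h1, h2⟩
    refine ASpec.mono (ASpec.loop_le (n := l + 1) hκ (fun j _ σ =>
      (∀ i' j', (j' ≤ l ∧ (i' < i ∨ i' = i ∧ j' < j)) →
        σ .choose [i', j'] = some (i'.choose j')) ∧ σ.EqOff [.choose] σ₀)
      (9 * u β) (by positivity) (by omega) hl (by omega) (by omega)
      ⟨fun a' b' h => h1 a' b' ⟨by omega, h.1⟩, h2⟩ ?_ le_rfl)
      (fun _ σ' h => ⟨fun a' b' h' => h.1 a' b' ⟨by omega, by omega⟩, h.2⟩)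
      (by push_cast; linarith)
    rintro j _ σ - hj ⟨h1, h2⟩
    have hidx : ∀ a' b', a' ≤ i → b' ≤ j → IndexLt β [a', b'] := fun a' b' _ _ =>
      IndexLt.two (by omega) (by omega)
    have hst : ∀ (v : ℕ) (c : ℤ), v = i.choose j → (u β : ℤ) ≤ c →
        ASpec κ (fun _ => 0) (SumRank.store .choose [i, j] (some v)) σ c (fun _ σ =>
          (∀ i' j', (j' ≤ l ∧ (i' < i ∨ i' = i ∧ j' < j + 1)) →
            σ .choose [i', j'] = some (i'.choose j')) ∧ σ.EqOff [.choose] σ₀) := fun v c hv hc' =>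
      ASpec.store hκ (β := β) (hidx i j le_rfl le_rfl)
        (by rintro _ ⟨⟩; rw [hv]; exact hc i hi j hj)
        ⟨Mem.set_filled₂ h1 (fun a' b' h => by omega) hv, h2.set (by simp) _ _⟩ (by linarith)
    refine ASpec.op_bind hκ (β := β) (by omega) (by omega) (ASpec.ite (fun hb0 => ?_) fun hb0 =>
      ASpec.op_bind hκ (β := β) (by omega) (by omega) (ASpec.ite (fun ha0 => ?_) fun ha0 => ?_))
    · rw [Arith.eval_eq_eq_one] at hb0
      exact hst 1 _ (by rw [hb0, Nat.choose_zero_right]) (by linarith)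
    · rw [Arith.eval_eq_eq_one] at ha0 hb0
      obtain ⟨j, rfl⟩ := Nat.exists_eq_succ_of_ne_zero hb0
      exact hst 0 _ (by rw [ha0, Nat.choose_zero_succ]) (by linarith)
    · rw [Arith.eval_eq_eq_one] at ha0 hb0
      obtain ⟨j, rfl⟩ := Nat.exists_eq_succ_of_ne_zero hb0
      obtain ⟨i, rfl⟩ := Nat.exists_eq_succ_of_ne_zero ha0
      refine ASpec.op_bind hκ (β := β) (by omega) (by omega) (ASpec.op_bind hκ (β := β)
        (by omega) (by omega) ?_)
      refine ASpec.fetch_bind hκ (β := β) (hidx i j (by omega) (by omega))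
        (h1 i j ⟨by omega, by omega⟩) (hc _ (by omega) _ (by omega)) ?_
      refine ASpec.fetch_bind hκ (β := β) (hidx i (j + 1) (by omega) (by omega))
        (h1 i (j + 1) ⟨by omega, by omega⟩) (hc _ (by omega) _ (by omega)) ?_
      refine ASpec.op_bind hκ (β := β) (hc _ (by omega) _ (by omega))
        (hc _ (by omega) _ (by omega)) ?_
      exact hst _ _ rfl (by linarith)
  · have h1 : (0 : ℤ) ≤ (l + 1) * (l * u β) := by positivity
    have h2 : (0 : ℤ) ≤ l * u β := by positivity
    push_cast
    linarith

end Fill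

end SumRank

namespace SumRank

/-! ### The tables of cofactors and of coefficients -/

/-- The quotient of `qFact q A` by the Gaussian binomial `qBinom q a b`, for `b ≤ a ≤ A`. -/
def cofactor (q A a b : ℕ) : ℕ :=
  qFact q b * qFact q (a - b) * ∏ i ∈ Finset.Ico a A, (q ^ (i + 1) - 1)

section Cofactor

variable {q A a b : ℕ}

theorem qFact_mul_prod_Ico (h : a ≤ A) :
    qFact q a * ∏ i ∈ Finset.Ico a A, (q ^ (i + 1) - 1) = qFact q A := by
  unfold qFact
  exact Finset.prod_range_mul_prod_Ico _ h

theorem prod_Ico_pos (hq : 2 ≤ q) : 0 < ∏ i ∈ Finset.Ico a A, (q ^ (i + 1) - 1) :=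
  Finset.prod_pos fun i _ => Nat.sub_pos_of_lt (Nat.one_lt_pow (by omega) (by omega))

theorem qFact_mono (hq : 2 ≤ q) (h : a ≤ A) : qFact q a ≤ qFact q A := by
  rw [← qFact_mul_prod_Ico h]
  exact Nat.le_mul_of_pos_right _ (prod_Ico_pos hq)

theorem prod_Ico_le (hq : 2 ≤ q) (h : a ≤ A) :
    ∏ i ∈ Finset.Ico a A, (q ^ (i + 1) - 1) ≤ qFact q A := by
  rw [← qFact_mul_prod_Ico h]
  exact Nat.le_mul_of_pos_left _ (qFact_pos hq a)

/-- The two small factorials complete [a, b] to `qFact q a`, and the remaining factors complete that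
to `qFact q A`. So R is a common denominator for all reciprocals 1/[a, b]. -/
theorem qBinom_mul_cofactor (hq : 2 ≤ q) (hb : b ≤ a) (ha : a ≤ A) :
    qBinom q a b * cofactor q A a b = qFact q A := by
  obtain ⟨c, rfl⟩ := Nat.exists_eq_add_of_le hb
  rw [cofactor, Nat.add_sub_cancel_left, ← mul_assoc, qBinom_mul_qFact hq, qFact_mul_prod_Ico ha]

theorem qBinom_pos (hq : 2 ≤ q) (hb : b ≤ a) : 0 < qBinom q a b :=
  Nat.pos_of_mul_pos_right (by rw [qBinom_mul_cofactor hq hb le_rfl]; exact qFact_pos hq a)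

theorem cofactor_pos (hq : 2 ≤ q) (hb : b ≤ a) (ha : a ≤ A) : 0 < cofactor q A a b :=
  Nat.pos_of_mul_pos_left (by rw [qBinom_mul_cofactor hq hb ha]; exact qFact_pos hq A)

theorem cofactor_le (hq : 2 ≤ q) (hb : b ≤ a) (ha : a ≤ A) : cofactor q A a b ≤ qFact q A := by
  rw [← qBinom_mul_cofactor hq hb ha]
  exact Nat.le_mul_of_pos_left _ (qBinom_pos hq hb)

theorem qFact_mul_qFact_le (hq : 2 ≤ q) (hb : b ≤ a) (ha : a ≤ A) :
    qFact q b * qFact q (a - b) ≤ qFact q A :=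
  (Nat.le_mul_of_pos_right _ (prod_Ico_pos hq)).trans (cofactor_le hq hb ha)

end Cofactor

section Fill

variable {κ : BitStep → ℕ} {u : ℕ → ℕ} {σ : Mem} {Φ : Mem → ℤ}

theorem ASpec.fetch_unset_bind {γ : Type} {c : ℤ} {P : γ → Mem → Prop} (hκ : CostBound κ u)
    {T : Tab} {idx : List ℕ} {β : ℕ} {f : ℕ → Alg γ}
    (hidx : IndexLt β idx) (hv : σ T idx = none)
    (h : ASpec κ Φ (f 0) σ (c - u β) P) : ASpec κ Φ (fetch T idx >>= f) σ c P := by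
  have h1 : ASpec κ Φ (fetch T idx) σ (u β) (fun a σ' => a = 0 ∧ σ' = σ) :=
    (ASpec.load hκ hidx (β := β) (by simp [hv])).bind fun a σ' ha =>
      ASpec.pure ⟨by rw [ha.1, hv]; rfl, ha.2⟩ (by simp)
  exact h1.bind fun a σ' ha => by rw [ha.1, ha.2]; exact h

theorem ASpec.fillCof (hκ : CostBound κ u) {q A B β : ℕ} (hq : 2 ≤ q) (hA : A + 1 < 2 ^ β)
    (hB : B + 1 < 2 ^ β) (hp : q ^ (A + 1) < 2 ^ β) (hR : qFact q A < 2 ^ β)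
    (h0 : σ .factor [0] = none) :
    ASpec κ (fun _ => 0) (fillCof q A B) σ ((A + 1) * ((B + 1) * (40 * u β)))
      (fun _ σ' => (∀ a b, a ≤ A → b ≤ min B a → σ' .cof [a, b] = some (cofactor q A a b)) ∧
        σ' .low [A] = some (qFact q A) ∧ σ'.EqOff [.low, .high, .factor, .cof] σ) := by
  have hu : (0 : ℤ) ≤ u β := by positivity
  have hpow : ∀ k, k ≤ A + 1 → q ^ k < 2 ^ β := fun k hk =>
    (Nat.pow_le_pow_right (by omega) hk).trans_lt hp
  have hqβ : q < 2 ^ β := by simpa using hpow 1 (by omega)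
  have hfact : ∀ k, k ≤ A → qFact q k < 2 ^ β := fun k hk => (qFact_mono hq hk).trans_lt hR
  have hprod : ∀ k, k ≤ A → ∏ i ∈ Finset.Ico k A, (q ^ (i + 1) - 1) < 2 ^ β := fun k hk =>
    (prod_Ico_le hq hk).trans_lt hR
  unfold SumRank.fillCof
  set σ₀ := σ
  refine (ASpec.loop_le (n := A + 1) (c' := (A + 1) * (9 * u β)) hκ (fun k (px : ℕ × ℕ) σ =>
    px = (q ^ k, qFact q k) ∧
      (∀ k', k' < k → σ .low [k'] = some (qFact q k')) ∧
      (∀ k', (1 ≤ k' ∧ k' ≤ k) → σ .factor [k'] = some (q ^ k' - 1)) ∧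
      σ .factor [0] = none ∧ σ.EqOff [.low, .high, .factor, .cof] σ₀)
    (6 * u β) (by positivity) (by omega) hA (by omega)
    (by omega) ⟨by simp [qFact], by simp, fun k hk => by omega, h0, Mem.EqOff.refl _ _⟩ ?_
      (by push_cast; linarith)).bind ?_
  · rintro k _ σ - hk ⟨rfl, h1, h2, h3, h4⟩
    dsimp only
    have hlt : q ^ k * q - 1 < 2 ^ β := by
      rw [← pow_succ]; exact (Nat.sub_le _ _).trans_lt (hpow (k + 1) (by omega))
    refine ASpec.store_bind hκ (β := β) (IndexLt.one (by omega))
      (by rintro _ ⟨⟩; exact hfact k hk) ?_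
    refine ASpec.op_bind hκ (β := β) (hpow k (by omega)) hqβ ?_
    refine ASpec.op_bind hκ (β := β) (x := q ^ k * q)
      (by rw [← pow_succ]; exact hpow (k + 1) (by omega)) (by omega) ?_
    refine ASpec.op_bind hκ (β := β) (by omega) (by omega) ?_
    refine ASpec.store_bind (v := some (q ^ k * q - 1)) hκ (β := β)
      (IndexLt.one (a := k + 1) (by omega)) (by rintro _ ⟨⟩; exact hlt) ?_
    refine ASpec.op_bind hκ (β := β) (y := q ^ k * q - 1) (hfact k hk) hlt ?_
    refine ASpec.pure ⟨?_, ?_, ?_, ?_, ?_⟩ (by linarith)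
    · rw [qFact_succ, pow_succ]; rfl
    · rw [Mem.set_of_tab_ne _ (by simp)]
      exact Mem.set_filled₁ h1 (fun a ha => by omega) rfl
    · exact Mem.set_filled₁ (D := fun k' => 1 ≤ k' ∧ k' ≤ k) (a₀ := k + 1)
        (f := fun k' => q ^ k' - 1)
        (by rwa [Mem.set_of_tab_ne _ (by simp)]) (fun a ha => by omega) (by simp only [pow_succ])
    · exact (Mem.set_of_idx_ne _ (by simp [Arith.eval]) _).trans
        (by rwa [Mem.set_of_tab_ne _ (by simp)])
    · exact (h4.set (by simp) _ _).set (by simp) _ _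
  rintro _ σ ⟨-, hlow, hfac, hfac0, hoff⟩
  refine (ASpec.loop_le (n := A + 1) (c' := (A + 1) * (7 * u β)) hκ (fun i x σ =>
    (i ≤ A → x = ∏ i ∈ Finset.Ico (A - i) A, (q ^ (i + 1) - 1)) ∧
      (∀ k', k' < A + 1 → σ .low [k'] = some (qFact q k')) ∧
      (∀ k', (1 ≤ k' ∧ k' ≤ A + 1) → σ .factor [k'] = some (q ^ k' - 1)) ∧
      σ .factor [0] = none ∧
      (∀ k, (k ≤ A ∧ A < k + i) →
        σ .high [k] = some (∏ i ∈ Finset.Ico k A, (q ^ (i + 1) - 1))) ∧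
      σ.EqOff [.low, .high, .factor, .cof] σ₀)
    (4 * u β) (by positivity) (by omega) hA (by omega)
    (by omega) ⟨by simp, hlow, hfac, hfac0, fun k hk => by omega, hoff⟩ ?_
      (by push_cast; linarith)).bind ?_
  · rintro i x σ - hi ⟨hx, h1, h2, h3, h4, h5⟩
    replace hx := hx hi
    have hxβ : x < 2 ^ β := by rw [hx]; exact hprod _ (Nat.sub_le _ _)
    refine ASpec.op_bind hκ (β := β) (by omega) (by omega) ?_
    refine ASpec.store_bind hκ (β := β) (IndexLt.one (a := A - i) (by omega))
      (by rintro _ ⟨⟩; exact hxβ) ?_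
    have hinv : ∀ y, (i + 1 ≤ A → y = ∏ i ∈ Finset.Ico (A - (i + 1)) A, (q ^ (i + 1) - 1)) →
        (i + 1 ≤ A → y = ∏ i ∈ Finset.Ico (A - (i + 1)) A, (q ^ (i + 1) - 1)) ∧
        (∀ k', k' < A + 1 → σ.set .high [A - i] (some x) .low [k'] = some (qFact q k')) ∧
        (∀ k', (1 ≤ k' ∧ k' ≤ A + 1) →
          σ.set .high [A - i] (some x) .factor [k'] = some (q ^ k' - 1)) ∧
        σ.set .high [A - i] (some x) .factor [0] = none ∧
        (∀ k, (k ≤ A ∧ A < k + (i + 1)) → σ.set .high [A - i] (some x) .high [k] =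
          some (∏ i ∈ Finset.Ico k A, (q ^ (i + 1) - 1))) ∧
        (σ.set .high [A - i] (some x)).EqOff [.low, .high, .factor, .cof] σ₀ := fun y hy =>
      ⟨hy, by rwa [Mem.set_of_tab_ne _ (by simp)], by rwa [Mem.set_of_tab_ne _ (by simp)],
        by rwa [Mem.set_of_tab_ne _ (by simp)],
        Mem.set_filled₁ h4 (fun a ha => by omega) hx, h5.set (by simp) _ _⟩
    -- In the last iteration `factor[0]`, which is never stored, is read as 0. The product formed
    -- with it is discarded, so the invariant claims nothing about x after that iteration.
    rcases Nat.eq_zero_or_pos (A - i) with hi0 | hi0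
    · refine ASpec.fetch_unset_bind hκ (β := β) (IndexLt.one (a := A - i) (by omega)) ?_ ?_
      · rw [Mem.set_of_tab_ne _ (by simp)]
        change σ .factor [A - i] = none
        rw [hi0, h3]
      · exact ASpec.op hκ (β := β) hxβ (by omega) (hinv _ (by omega)) (by linarith)
    · have hlt : q ^ (A - i) - 1 < 2 ^ β := (Nat.sub_le _ _).trans_lt (hpow _ (by omega))
      refine ASpec.fetch_bind hκ (β := β) (v := q ^ (A - i) - 1)
        (IndexLt.one (a := A - i) (by omega)) ?_ hlt ?_
      · rw [Mem.set_of_tab_ne _ (by simp)]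
        exact h2 (A - i) ⟨hi0, by omega⟩
      · refine ASpec.op hκ (β := β) hxβ hlt (hinv _ fun hiA => ?_) (by linarith)
        obtain ⟨k, hk⟩ : ∃ k, A - i = k + 1 := ⟨A - i - 1, by omega⟩
        rw [hx, hk, show A - (i + 1) = k by omega, Finset.prod_eq_prod_Ico_succ_bot
          (show k < A by omega), mul_comm]
        rfl
  rintro _ σ ⟨-, hlow, -, -, hhigh, hoff⟩
  refine ASpec.mono (ASpec.loop_le (n := A + 1) hκ (fun a _ σ =>
    (∀ k', k' < A + 1 → σ .low [k'] = some (qFact q k')) ∧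
    (∀ k, (k ≤ A ∧ A < k + (A + 1)) →
        σ .high [k] = some (∏ i ∈ Finset.Ico k A, (q ^ (i + 1) - 1))) ∧
    (∀ a' b, (a' < a ∧ b ≤ min B a') → σ .cof [a', b] = some (cofactor q A a' b)) ∧
      σ.EqOff [.low, .high, .factor, .cof] σ₀)
    ((B + 1) * (11 * u β) + u β) (by positivity) (by omega) hA (by omega) (by omega)
    ⟨hlow, hhigh, by simp, hoff⟩ ?_ le_rfl)
    (fun _ σ' h => ⟨fun a b ha hb => h.2.2.1 a b ⟨by omega, hb⟩, h.1 A (by omega), h.2.2.2⟩) ?_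
  · rintro a _ σ - ha ⟨h1, h2, h3, h4⟩
    refine ASpec.lift_bind (RSpec.minimum hκ (β := β) (by omega) (by omega)) ?_
    rintro _ rfl
    refine ASpec.mono (ASpec.loop_le (β := β) (n := B + 1) hκ (fun b _ σ =>
      (∀ k', k' < A + 1 → σ .low [k'] = some (qFact q k')) ∧
      (∀ k, (k ≤ A ∧ A < k + (A + 1)) →
        σ .high [k] = some (∏ i ∈ Finset.Ico k A, (q ^ (i + 1) - 1))) ∧
      (∀ a' b', (b' ≤ min B a' ∧ (a' < a ∨ a' = a ∧ b' < b)) →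
        σ .cof [a', b'] = some (cofactor q A a' b')) ∧
      σ.EqOff [.low, .high, .factor, .cof] σ₀)
      (7 * u β) (by positivity) (by omega) (by omega) (by omega) (by omega)
      ⟨h1, h2, fun a' b' h => h3 a' b' ⟨by omega, h.1⟩, h4⟩ ?_ le_rfl)
      (fun _ σ' h => ⟨h.1, h.2.1, fun a' b' h' => h.2.2.1 a' b' ⟨by omega, by omega⟩, h.2.2.2⟩)
      (by
        have : (0 : ℤ) ≤ B * u β := by positivity
        push_cast; linarith)
    rintro b _ σ - hb ⟨h1, h2, h3, h4⟩
    refine ASpec.op_bind hκ (β := β) (by omega) (by omega) ?_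
    refine ASpec.fetch_bind hκ (β := β) (IndexLt.one (by omega)) (h1 b (by omega))
      (hfact b (by omega)) ?_
    refine ASpec.fetch_bind hκ (β := β) (IndexLt.one (a := a - b) (by omega))
      (h1 (a - b) (by omega)) (hfact _ (by omega)) ?_
    refine ASpec.fetch_bind hκ (β := β) (IndexLt.one (by omega)) (h2 a (by omega)) (hprod a ha) ?_
    refine ASpec.op_bind hκ (β := β) (hfact b (by omega)) (hfact _ (by omega)) ?_
    refine ASpec.op_bind hκ (β := β) (x := qFact q b * qFact q (a - b))
      ((qFact_mul_qFact_le hq (by omega) ha).trans_lt hR) (hprod a ha) ?_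
    refine ASpec.store (v := some (cofactor q A a b)) hκ (β := β) (IndexLt.two (by omega) (by omega))
      (by rintro _ ⟨⟩; exact (cofactor_le hq (by omega) ha).trans_lt hR)
      ⟨by rwa [Mem.set_of_tab_ne _ (by simp)], by rwa [Mem.set_of_tab_ne _ (by simp)],
        Mem.set_filled₂ h3 (fun a' b' h => by omega) rfl, h4.set (by simp) _ _⟩ (by linarith)
  · have h1 : (0 : ℤ) ≤ (A + 1) * (B * u β) := by positivity
    have h2 : (0 : ℤ) ≤ (A + 1) * u β := by positivity
    push_cast
    linarith

/-- The table is empty beforehand as well; the point is that the cost of the initialization is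
counted. -/
theorem ASpec.clearM (hκ : CostBound κ u) {t l μ s β : ℕ} (ht : t + 1 < 2 ^ β)
    (hl : l + 1 < 2 ^ β) (hμ : μ + 1 < 2 ^ β) (hs : s + 1 < 2 ^ β) (h0 : ∀ idx, σ .M idx = none) :
    ASpec κ (fun _ => 0) (clearM t l μ s) σ
      ((t + 1) * ((l + 1) * ((μ + 1) * ((s + 1) * (13 * u β)))))
      (fun _ σ' => (∀ idx, σ' .M idx = none) ∧ σ'.EqOff [.M] σ) := by
  have hu : (0 : ℤ) ≤ u β := by positivity
  unfold SumRank.clearM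
  set σ₀ := σ
  refine ASpec.loop_le (n := t + 1) hκ
    (fun _ _ σ => (∀ idx, σ .M idx = none) ∧ σ.EqOff [.M] σ₀)
    ((l + 1) * ((μ + 1) * ((s + 1) * (10 * u β)))) (by positivity) (by omega) ht (by omega)
    (by omega) ⟨h0, Mem.EqOff.refl _ _⟩ ?_ ?_
  · rintro t' _ σ - ht' ⟨h1, h2⟩
    refine ASpec.loop_le (n := l + 1) hκ
      (fun _ _ σ => (∀ idx, σ .M idx = none) ∧ σ.EqOff [.M] σ₀)
      ((μ + 1) * ((s + 1) * (7 * u β))) (by positivity) (by omega) hl (by omega)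
      (by omega) ⟨h1, h2⟩ ?_ ?_
    · rintro l' _ σ - hl' ⟨h1, h2⟩
      refine ASpec.loop_le (n := μ + 1) hκ
        (fun _ _ σ => (∀ idx, σ .M idx = none) ∧ σ.EqOff [.M] σ₀)
        ((s + 1) * (4 * u β)) (by positivity) (by omega) hμ (by omega)
        (by omega) ⟨h1, h2⟩ ?_ ?_
      · rintro μ' _ σ - hμ' ⟨h1, h2⟩
        refine ASpec.loop_le (n := s + 1) hκ
          (fun _ _ σ => (∀ idx, σ .M idx = none) ∧ σ.EqOff [.M] σ₀)
          (u β) (by positivity) (by omega) hs (by omega)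
          (by omega) ⟨h1, h2⟩ ?_ ?_
        · rintro s' _ σ - hs' ⟨h1, h2⟩
          exact ASpec.store hκ (β := β)
            (IndexLt.four (by omega) (by omega) (by omega) (by omega)) (by simp)
            ⟨fun idx => Mem.set_filled (fun _ => h1 idx) fun _ => rfl, h2.set (by simp) _ _⟩
            (by linarith)
        · push_cast; linarith
      · have h1 : (0 : ℤ) ≤ (μ + 1) * (s * u β) := by positivity
        push_cast; linarith
    · have h1 : (0 : ℤ) ≤ (l + 1) * ((μ + 1) * (s * u β)) := by positivity
      have h2 : (0 : ℤ) ≤ (l + 1) * (μ * u β) := by positivity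
      push_cast; linarith
  · have h1 : (0 : ℤ) ≤ (t + 1) * ((l + 1) * ((μ + 1) * (s * u β))) := by positivity
    have h2 : (0 : ℤ) ≤ (t + 1) * ((l + 1) * (μ * u β)) := by positivity
    have h3 : (0 : ℤ) ≤ (t + 1) * (l * u β) := by positivity
    push_cast; linarith

end Fill

end SumRank

/-! ### Numerators of the coefficients of the recursion. -/

namespace SumRank

/-- The numerator of `[ζ, v] / [w, v]` over the denominator `qFact q A`, for `v ≤ w ≤ A`. -/
def ratioNum (q ζ A v w : ℕ) : ℕ := qBinom q ζ v * cofactor q A w v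

theorem ratioNum_pos {q ζ A v w : ℕ} (hq : 2 ≤ q) (hv : v ≤ w) (hw : w ≤ A) (hζ : v ≤ ζ) :
    0 < ratioNum q ζ A v w := Nat.mul_pos (qBinom_pos hq hζ) (cofactor_pos hq hv hw)

section Fill

variable {κ : BitStep → ℕ} {u : ℕ → ℕ} {σ : Mem} {Φ : Mem → ℤ}

/-- All factors are positive integers, so every partial product is bounded by the final one, and
intermediate sizes need no estimate of their own. -/
theorem ASpec.prodRatio (hκ : CostBound κ u) {q ζ A δ β t₁ : ℕ} {v : Fin δ → ℕ}
    (hq : 2 ≤ q) (ht₁ : t₁ ≤ ζ) (hv : ∀ i, t₁ ≤ v i) (hvA : ∀ i, v i ≤ A)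
    (hβ : ∏ i, ratioNum q ζ A t₁ (v i) < 2 ^ β) (hgβ : qBinom q ζ t₁ < 2 ^ β)
    (hAβ : A < 2 ^ β) (ht₁β : t₁ < 2 ^ β) (hR : qFact q A < 2 ^ β)
    (hcof : ∀ i, σ .cof [v i, t₁] = some (cofactor q A (v i) t₁)) :
    ASpec κ Φ ((List.finRange δ).foldlM (init := 1) fun x i => do
        let f ← fetch .cof [v i, t₁]
        let y ← SumRank.op .mul x (qBinom q ζ t₁)
        SumRank.op .mul y f) σ (δ * (3 * u β))
      (fun x σ' => x = ∏ i, ratioNum q ζ A t₁ (v i) ∧ σ' = σ) := by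
  have h := ASpec.foldlM (κ := κ) (Φ := Φ) (c := 3 * u β) (body := fun x i => do
      let f ← fetch .cof [v i, t₁]
      let y ← SumRank.op .mul x (qBinom q ζ t₁)
      SumRank.op .mul y f)
    (Inv := fun L x σ' => x * (L.map fun i => ratioNum q ζ A t₁ (v i)).prod =
      ∏ i, ratioNum q ζ A t₁ (v i) ∧ σ' = σ) (by
    rintro i L x _ ⟨hx, rfl⟩
    have hf := (cofactor_le (b := t₁) hq (hv i) (hvA i)).trans_lt hR
    have hx2 : x * qBinom q ζ t₁ * cofactor q A (v i) t₁ *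
        (L.map fun i => ratioNum q ζ A t₁ (v i)).prod = ∏ i, ratioNum q ζ A t₁ (v i) := by
      rw [← hx, List.map_cons, List.prod_cons, ratioNum]
      ring
    have hpos : 0 < (L.map fun i => ratioNum q ζ A t₁ (v i)).prod :=
      List.prod_pos (by
        intro a ha
        obtain ⟨j, -, rfl⟩ := List.mem_map.1 ha
        exact ratioNum_pos hq (hv j) (hvA j) ht₁)
    have hxg : x * qBinom q ζ t₁ < 2 ^ β := by
      refine lt_of_le_of_lt ?_ hβ
      rw [← hx2, mul_assoc (x * qBinom q ζ t₁)]
      exact Nat.le_mul_of_pos_right _ (Nat.mul_pos (cofactor_pos hq (hv i) (hvA i)) hpos)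
    have hxβ : x < 2 ^ β :=
      (Nat.le_mul_of_pos_right _ (qBinom_pos hq ht₁)).trans_lt hxg
    refine ASpec.fetch_bind hκ (β := β) (IndexLt.two ((hvA i).trans_lt hAβ) ht₁β) (hcof i) hf ?_
    refine ASpec.op_bind hκ (β := β) hxβ hgβ ?_
    exact ASpec.op hκ (β := β) hxg hf ⟨hx2, rfl⟩ (by linarith))
    (List.finRange δ) 1 σ ⟨by rw [one_mul, ← List.ofFn_eq_map, List.prod_ofFn], rfl⟩
  rw [List.length_finRange] at h
  exact h.mono (fun x σ' hx => ⟨by simpa using hx.1, hx.2⟩) le_rfl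

/-- Two word lengths are kept apart: β₀ for indices and for `scomp`, β for numerators. Each entry
may take about lζ·l small steps inside `scomp`; charging these with β could exceed the final bound.
-/
theorem ASpec.fillCoeff (hκ : CostBound κ u) (χ : Coins) {q ζ B l s β β₀ : ℕ} (hq : 2 ≤ q)
    (hl : 0 < l) (hBζ : B ≤ ζ) (hl₀ : l + 1 < 2 ^ β₀) (hζ₀ : ζ + 1 < 2 ^ β₀)
    (hs₀ : s + 1 < 2 ^ β₀) (hlζ₀ : l * ζ < 2 ^ β₀) (hβ : β₀ ≤ β)
    (hgβ : ∀ b ≤ B, qBinom q ζ b < 2 ^ β) (hR : qFact q (min ζ s) < 2 ^ β)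
    (hbal : ∀ δ t₁ S, 1 ≤ δ → δ ≤ l → t₁ ≤ B → S ≤ s → t₁ * δ ≤ S → S ≤ ζ * δ →
      balancedProd (ratioNum q ζ (min ζ s) t₁) δ S < 2 ^ β)
    (hg : ∀ b ≤ B, σ .gauss [ζ, b] = some (qBinom q ζ b))
    (hcof : ∀ a b, a ≤ min ζ s → b ≤ min B a →
      σ .cof [a, b] = some (cofactor q (min ζ s) a b)) :
    ASpec κ (fun _ => 0) (fillCoeff χ ζ B l s) σ
      (l * ((B + 1) * ((s + 1) * ((l * ζ + 1) * ((l + 1) * (26 * u β₀)) + (l + 1) * (3 * u β)))))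
      (fun _ σ' => (∀ δ t₁ S, 1 ≤ δ → δ ≤ l → t₁ ≤ B → S ≤ s → t₁ * δ ≤ S → S ≤ ζ * δ →
        σ' .coeff [δ, t₁, S] = some (balancedProd (ratioNum q ζ (min ζ s) t₁) δ S)) ∧
        σ'.EqOff [.coeff] σ) := by
  have hu : (0 : ℤ) ≤ u β := by positivity
  have hu₀ : (0 : ℤ) ≤ u β₀ := by positivity
  have h2β : 2 ^ β₀ ≤ 2 ^ β := Nat.pow_le_pow_right (by omega) hβ
  have hK : (0 : ℤ) ≤ (l * ζ + 1) * ((l + 1) * (13 * u β₀)) + 4 * u β₀ + (l + 1) * (3 * u β) := by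
    positivity
  have hz : (u β₀ : ℤ) ≤ (l * ζ + 1) * ((l + 1) * u β₀) := by
    exact_mod_cast (Nat.le_mul_of_pos_left _ (Nat.succ_pos l)).trans
      (Nat.le_mul_of_pos_left _ (Nat.succ_pos (l * ζ)))
  set K : ℤ := (l * ζ + 1) * ((l + 1) * (13 * u β₀)) + 4 * u β₀ + (l + 1) * (3 * u β) with hKdef
  set A := min ζ s with hA
  unfold SumRank.fillCoeff
  set σ₀ := σ
  set D : ℕ → ℕ → ℕ → Prop := fun δ t₁ S => 1 ≤ δ ∧ δ ≤ l ∧ t₁ ≤ B ∧ S ≤ s ∧ t₁ * δ ≤ S ∧ S ≤ ζ * δ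
    with hD
  -- One lexicographic invariant serves all three nested loops.
  set Inv : ℕ → ℕ → ℕ → Mem → Prop := fun δ₀ t₀ S₀ σ =>
    (∀ δ t₁ S, (D δ t₁ S ∧ (δ < δ₀ ∨ δ = δ₀ ∧ (t₁ < t₀ ∨ t₁ = t₀ ∧ S < S₀))) →
        σ .coeff [δ, t₁, S] = some (balancedProd (ratioNum q ζ A t₁) δ S)) ∧
        σ.EqOff [.coeff] σ₀ with hInv
  refine ASpec.mono (ASpec.loop_le (β := β₀) (n := l) hκ (fun δ _ σ => Inv δ 0 0 σ)
    ((B + 1) * ((s + 1) * (K + 3 * u β₀) + 3 * u β₀)) (by positivity) (by omega) hl₀ (by omega) hl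
    ⟨fun δ t₁ S h => by omega, Mem.EqOff.refl _ _⟩ ?_ le_rfl)
    (fun _ σ' h => ⟨fun δ t₁ S h1 h2 h3 h4 h5 h6 =>
      h.1 δ t₁ S ⟨⟨h1, h2, h3, h4, h5, h6⟩, by omega⟩, h.2⟩) ?_
  · rintro δ _ σ hδ1 hδ hinv
    have hδζ : δ * ζ ≤ l * ζ := Nat.mul_le_mul_right _ hδ
    have hBδ : B * δ ≤ l * ζ := (Nat.mul_le_mul hBζ hδ).trans (Nat.mul_comm _ _).le
    refine ASpec.mono (ASpec.loop_le (β := β₀) (n := B + 1) hκ (fun t₁ _ σ => Inv δ t₁ 0 σ)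
      ((s + 1) * (K + 3 * u β₀)) (by positivity) (by omega) (by omega) (by omega) (by omega)
      hinv ?_ le_rfl) (fun _ σ' h => ⟨fun δ t₁ S h1 => h.1 δ t₁ S
        ⟨h1.1, by have := h1.1.2.2.1; omega⟩, h.2⟩) (by push_cast; linarith)
    rintro t₁ _ σ - ht₁ hinv
    have htδ : t₁ * δ ≤ B * δ := Nat.mul_le_mul_right _ ht₁
    refine ASpec.mono (ASpec.loop_le (β := β₀) (n := s + 1) hκ (fun S _ σ => Inv δ t₁ S σ)
      K (by positivity) (by omega) (by omega) (by omega) (by omega)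
      hinv ?_ le_rfl) (fun _ σ' h => ⟨fun δ t₁ S h1 => h.1 δ t₁ S
        ⟨h1.1, by have := h1.1.2.2.2.1; omega⟩, h.2⟩) (by push_cast; linarith)
    rintro S _ σ - hS ⟨h1, h2⟩
    refine ASpec.op_bind hκ (β := β₀) (by omega) (by omega) ?_
    refine ASpec.op_bind hκ (β := β₀) (by omega) (by omega) ?_
    refine ASpec.op_bind hκ (β := β₀) (x := t₁ * δ) (by omega) (by omega) ?_
    refine ASpec.op_bind hκ (β := β₀) (y := ζ * δ) (by omega) (by rw [mul_comm]; omega)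
      (ASpec.ite (fun hcd => ?_) fun hcd => ?_)
    · rw [Arith.eval_le_eq_one, Arith.eval_le_eq_one] at hcd
      have hsum : ∑ _i : Fin δ, t₁ = t₁ * δ := by simp [mul_comm]
      refine ASpec.lift_bind (RSpec.scomp hκ χ (β := β₀) (by omega) (by omega) (by omega)
        (fun _ => by omega) (by rw [hsum]; exact hcd.1) (by rw [mul_comm]; exact hcd.2)) ?_
      intro v hv
      have hoff : ∀ T, T ≠ .coeff → σ T = σ₀ T := fun T hT => h2 T (by simpa using hT)
      have hvA : ∀ i, v i ≤ A := fun i => by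
        have h3 := hv.le_cap i (Finset.mem_univ i)
        have h4 := Finset.single_le_sum (f := v) (fun _ _ => Nat.zero_le _) (Finset.mem_univ i)
        rw [hv.sum_eq] at h4
        omega
      -- The input vector is constant, so balance applies to all pairs of positions and the value is
      -- the same for all coins.
      have hprod : ∏ i, ratioNum q ζ A t₁ (v i) = balancedProd (ratioNum q ζ A t₁) δ S := by
        have h3 := prod_eq_balancedProd (ratioNum q ζ A t₁) (D := Finset.univ) (w := v)
          (Finset.univ_nonempty_iff.2 ⟨⟨0, hδ1⟩⟩)
          (fun i hi j hj => hv.balance i hi j hj rfl)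
        rwa [hv.sum_eq, Finset.card_fin] at h3
      have hb := hbal δ t₁ S hδ1 hδ ht₁ hS hcd.1 hcd.2
      refine ASpec.fetch_bind hκ (β := β) (IndexLt.two (by omega) (by omega))
        (by rw [hoff _ (by simp)]; exact hg t₁ ht₁) (hgβ t₁ ht₁) ?_
      refine (ASpec.prodRatio hκ hq (ht₁.trans hBζ) (fun i => hv.le i (Finset.mem_univ i)) hvA
        (by rw [hprod]; exact hb) (hgβ t₁ ht₁) (by omega) (by omega) hR (fun i => by
          rw [hoff _ (by simp)]
          exact hcof _ _ (hvA i) (le_min ht₁ (hv.le i (Finset.mem_univ i))))).bind ?_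
      rintro _ _ ⟨rfl, rfl⟩
      refine ASpec.store hκ (β := β) (IndexLt.three (by omega) (by omega) (by omega))
        (by rintro _ ⟨⟩; rw [hprod]; exact hb)
        ⟨Mem.set_filled₃ h1 (fun δ' t' S' h => by omega) hprod, h2.set (by simp) _ _⟩ ?_
      have h3 : (S : ℤ) ≤ l * ζ := by
        have h4 := hcd.2
        rw [mul_comm] at h4
        exact_mod_cast h4.trans hδζ
      have h4 : (δ : ℤ) ≤ l := by exact_mod_cast hδ
      have h5 : ((S : ℤ) + 1) * ((δ + 1) * (13 * u β₀)) ≤ (l * ζ + 1) * ((l + 1) * (13 * u β₀)) := by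
        gcongr
      have h6 : (δ : ℤ) * (3 * u β) ≤ l * (3 * u β) := by gcongr
      rw [hKdef]
      linarith
    · refine ASpec.pure ⟨fun δ' t' S' h => h1 δ' t' S' ⟨h.1, ?_⟩, h2⟩ ?_
      · rw [Arith.eval_le_eq_one, Arith.eval_le_eq_one] at hcd
        obtain ⟨⟨-, -, -, -, h7, h8⟩, h9⟩ := h
        by_contra hne
        obtain ⟨rfl, rfl, rfl⟩ : δ' = δ ∧ t' = t₁ ∧ S' = S := by omega
        exact hcd ⟨h7, h8⟩
      · have : (0 : ℤ) ≤ (l * ζ + 1) * ((l + 1) * (13 * u β₀)) + (l + 1) * (3 * u β) := by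
          positivity
        rw [hKdef]
        linarith
  · have h1 : (s + 1 : ℤ) * (K + 3 * u β₀) + 3 * u β₀ + 3 * u β₀ ≤ (s + 1) * (K + 9 * u β₀) := by
      have : (0 : ℤ) ≤ s * (6 * u β₀) := by positivity
      linarith
    have h2 : (B + 1 : ℤ) * ((s + 1) * (K + 3 * u β₀) + 3 * u β₀) + 3 * u β₀ ≤
        (B + 1) * ((s + 1) * (K + 9 * u β₀)) := by
      have : (0 : ℤ) ≤ B * (3 * u β₀) := by positivity
      have := mul_le_mul_of_nonneg_left h1 (by positivity : (0 : ℤ) ≤ B + 1)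
      linarith
    have h3 : K + 9 * u β₀ ≤ (l * ζ + 1) * ((l + 1) * (26 * u β₀)) + (l + 1) * (3 * u β) := by
      rw [hKdef]
      linarith
    refine mul_le_mul_of_nonneg_left (h2.trans ?_) (by positivity)
    gcongr

end Fill

end SumRank

namespace SumRank

/-! ### The memoized recursion -/

/-- The number of entries of the table `M` in a box that have not been set. -/
def unset (t l μ s : ℕ) (σ : Mem) : ℕ :=
  ((Finset.range (t + 1) ×ˢ Finset.range (l + 1) ×ˢ Finset.range (μ + 1) ×ˢ
    Finset.range (s + 1)).filter fun p => σ .M [p.1, p.2.1, p.2.2.1, p.2.2.2] = none).card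

theorem unset_le (t l μ s : ℕ) (σ : Mem) :
    unset t l μ s σ ≤ (t + 1) * ((l + 1) * ((μ + 1) * (s + 1))) := by
  refine (Finset.card_filter_le _ _).trans ?_
  simp [Finset.card_product]

theorem unset_set {t l μ s t' l' μ' s' : ℕ} {σ : Mem} (ht : t' ≤ t) (hl : l' ≤ l) (hμ : μ' ≤ μ)
    (hs : s' ≤ s) (h : σ .M [t', l', μ', s'] = none) (v : ℕ) :
    unset t l μ s (σ.set .M [t', l', μ', s'] (some v)) + 1 ≤ unset t l μ s σ := by
  refine Finset.card_lt_card (Finset.ssubset_iff_subset_ne.2 ⟨fun p hp => ?_, fun heq => ?_⟩)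
  · rw [Finset.mem_filter] at hp ⊢
    refine ⟨hp.1, ?_⟩
    by_cases hk : [p.1, p.2.1, p.2.2.1, p.2.2.2] = [t', l', μ', s']
    · rw [hk, h]
    · rw [← hp.2, Mem.set_of_idx_ne _ hk]
  · have hmem := Finset.ext_iff.1 heq (t', l', μ', s')
    simp only [Finset.mem_filter, Finset.mem_product, Finset.mem_range, Mem.set_same, h] at hmem
    simp at hmem
    omega

/-- The tables `coeff` and `choose` have been filled, and all entries of the table `M` that have
been set are correct. -/
structure Mem.Good (h : ℕ → ℕ → ℕ) (ζ t l μ s : ℕ) (σ : Mem) : Prop where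
  coeff : ∀ δ t₁ S, 1 ≤ δ → δ ≤ l → t₁ ≤ min μ t → S ≤ s → t₁ * δ ≤ S → S ≤ ζ * δ →
    σ .coeff [δ, t₁, S] = some (balancedProd (h t₁) δ S)
  choose : ∀ i j, i ≤ l → j ≤ l → σ .choose [i, j] = some (i.choose j)
  correct : ∀ t' l' μ' s' v, σ .M [t', l', μ', s'] = some v → v = vecSum h ζ t' l' (μ' + 1) s'

theorem Mem.Good.set {h : ℕ → ℕ → ℕ} {ζ t l μ s t' l' μ' s' v : ℕ} {σ : Mem}
    (hσ : σ.Good h ζ t l μ s) (hv : v = vecSum h ζ t' l' (μ' + 1) s') :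
    (σ.set .M [t', l', μ', s'] (some v)).Good h ζ t l μ s where
  coeff := by
    rw [Mem.set_of_tab_ne _ (by simp)]
    exact hσ.coeff
  choose := by
    rw [Mem.set_of_tab_ne _ (by simp)]
    exact hσ.choose
  correct t₁ l₁ μ₁ s₁ v₁ h₁ := by
    by_cases hk : [t₁, l₁, μ₁, s₁] = [t', l', μ', s']
    · rw [hk, Mem.set_same] at h₁
      simp only [List.cons.injEq, and_true] at hk
      obtain ⟨rfl, rfl, rfl, rfl⟩ := hk
      rw [← Option.some.inj h₁, hv]
    · rw [Mem.set_of_idx_ne _ hk] at h₁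
      exact hσ.correct _ _ _ _ _ h₁

/-- The memories agree outside the table `M`, and the table `M` has the same entries for all second
indices that are at least `l`. -/
def Mem.SameFrom (l : ℕ) (σ σ' : Mem) : Prop :=
  σ.EqOff [.M] σ' ∧ ∀ t' l' μ' s', l ≤ l' → σ .M [t', l', μ', s'] = σ' .M [t', l', μ', s']

theorem Mem.SameFrom.refl (l : ℕ) (σ : Mem) : σ.SameFrom l σ :=
  ⟨Mem.EqOff.refl _ _, fun _ _ _ _ _ => rfl⟩

theorem Mem.SameFrom.trans {l l' : ℕ} {σ₁ σ₂ σ₃ : Mem} (h₁ : σ₁.SameFrom l' σ₂)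
    (h₂ : σ₂.SameFrom l σ₃) (hl : l' ≤ l) : σ₁.SameFrom l σ₃ :=
  ⟨fun T hT => (h₁.1 T hT).trans (h₂.1 T hT), fun _ _ _ _ h =>
    (h₁.2 _ _ _ _ (hl.trans h)).trans (h₂.2 _ _ _ _ h)⟩

theorem Mem.SameFrom.set (t l μ s : ℕ) (v : Option ℕ) (σ : Mem) :
    (σ.set .M [t, l, μ, s] v).SameFrom (l + 1) σ :=
  ⟨(Mem.EqOff.refl _ _).set (by simp) _ _, fun _ _ _ _ h =>
    Mem.set_of_idx_ne _ (by simp; omega) _⟩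

/-- Bounds the accumulator in the middle of the double loop by its final value, all terms being
natural numbers. -/
theorem sum_Ico_add_sum_Ico_le {f g : ℕ → ℕ} {a b c d n : ℕ} (han : a < n)
    (hf : f a = ∑ j ∈ Finset.Ico b d, g j) (hc : c ≤ d) :
    ∑ i ∈ Finset.Ico 0 a, f i + ∑ j ∈ Finset.Ico b c, g j ≤ ∑ i ∈ Finset.Ico 0 n, f i := by
  have h1 : ∑ j ∈ Finset.Ico b c, g j ≤ f a := by
    rw [hf]
    exact Finset.sum_le_sum_of_subset (Finset.Ico_subset_Ico_right hc)
  calc _ ≤ ∑ i ∈ Finset.Ico 0 a, f i + f a := Nat.add_le_add_left h1 _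
    _ = ∑ i ∈ Finset.Ico 0 (a + 1), f i := (Finset.sum_Ico_succ_top (Nat.zero_le _) f).symm
    _ ≤ _ := Finset.sum_le_sum_of_subset (Finset.Ico_subset_Ico_right han)

section FillM

variable {κ : BitStep → ℕ} {u : ℕ → ℕ}

/-- The amortized cost is that of one load. On a miss the entry passes from unset to set, and the
potential released pays for at most (U+1)(L+1) inner iterations, in which recursive calls cost one
load each, net. For this the entry must still be unset when it is stored: recursive calls change
only entries with smaller second index, which is recorded by `Mem.SameFrom`. -/
theorem ASpec.fillM (hκ : CostBound κ u) {h : ℕ → ℕ → ℕ} {ζ T L U V β : ℕ} (hUζ : U ≤ ζ)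
    (hsmall : T + L + V + L * ζ + ζ + 2 < 2 ^ β)
    (hbig : ∀ t l μ s, l ≤ L → μ ≤ U → s ≤ V → Admissible ζ t l μ s →
      vecSum h ζ t l (μ + 1) s < 2 ^ β)
    (hbal : ∀ δ t₁ S, 1 ≤ δ → δ ≤ L → t₁ ≤ min U T → S ≤ V → t₁ * δ ≤ S → S ≤ ζ * δ →
      balancedProd (h t₁) δ S < 2 ^ β)
    (hchoose : ∀ i ≤ L, ∀ j ≤ L, i.choose j < 2 ^ β) :
    ∀ (fuel t l μ s : ℕ) (σ : Mem), l < fuel → t ≤ T → l ≤ L → μ ≤ U → s ≤ V →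
      Admissible ζ t l μ s → σ.Good h ζ T L U V →
      ASpec κ (fun σ => ((U + 1) * ((L + 1) * (43 * u β)) : ℤ) * unset T L U V σ)
        (fillM ζ fuel t l μ s) σ (u β) (fun x σ' => x = vecSum h ζ t l (μ + 1) s ∧
          σ'.Good h ζ T L U V ∧ σ'.SameFrom (l + 1) σ)
  | 0, _, _, _, _, _, hfuel, _, _, _, _, _, _ => absurd hfuel (Nat.not_lt_zero _)
  | fuel + 1, t, l, μ, s, σ, hfuel, ht, hl, hμ, hs, ha, hσ => by
    have hu : (0 : ℤ) ≤ u β := by positivity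
    have hLU : L * U ≤ L * ζ := Nat.mul_le_mul_left _ hUζ
    have hlζ : l * ζ ≤ L * ζ := Nat.mul_le_mul_right _ hl
    have hlμ : l * μ ≤ L * ζ := (Nat.mul_le_mul_left _ (hμ.trans hUζ)).trans hlζ
    have hidx : IndexLt β [t, l, μ, s] :=
      IndexLt.four (by omega) (by omega) (by omega) (by omega)
    have htot := hbig t l μ s hl hμ hs ha
    unfold SumRank.fillM
    refine (ASpec.load hκ (β := β) hidx fun v hv => ?_).bind ?_
    · rw [hσ.correct _ _ _ _ _ hv]
      exact htot
    rintro o σ₁ ⟨ho, hσ₁⟩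
    rw [ho, hσ₁]
    rcases hM : σ .M [t, l, μ, s] with _ | v
    swap
    · exact ASpec.pure ⟨hσ.correct _ _ _ _ _ hM, hσ, Mem.SameFrom.refl _ _⟩ (by simp)
    dsimp only
    refine ASpec.op_bind hκ (β := β) (by omega) (by omega) ?_
    refine ASpec.op_bind hκ (β := β) (x := t + l) (by omega) (by omega) ?_
    refine ASpec.op_bind hκ (β := β) (x := t + l + s) (by omega) (by omega) ?_
    refine ASpec.op_bind hκ (β := β) (by omega) (by omega) ?_
    refine ASpec.lift_bind (RSpec.minimum hκ (β := β) (y := l * μ) (by omega) (by omega)) ?_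
    rintro _ rfl
    refine ASpec.op_bind hκ (β := β) (by omega) (by omega) ?_
    refine ASpec.op_bind hκ (β := β) (by omega) (by omega) ?_
    refine ASpec.op_bind hκ (β := β) (by omega) (by omega) ?_
    refine ASpec.op_bind hκ (β := β) (y := l * ζ) (by omega) (by omega) ?_
    have h5 : (0 : ℤ) ≤ U * (L * u β) := by positivity
    have h6 : (0 : ℤ) ≤ U * u β := by positivity
    have h7 : (0 : ℤ) ≤ L * u β := by positivity
    -- The remaining budget may be negative here, down to u β minus the potential of one entry,
    -- since storing releases that potential.
    have hstore : ∀ (res : ℕ) (σ' : Mem), res = vecSum h ζ t l (μ + 1) s ∧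
        σ'.Good h ζ T L U V ∧ σ'.SameFrom l σ →
        ∀ c : ℤ, u β - (U + 1) * ((L + 1) * (43 * u β)) ≤ c →
        ASpec κ (fun σ => ((U + 1) * ((L + 1) * (43 * u β)) : ℤ) * unset T L U V σ) (do
          SumRank.store .M [t, l, μ, s] (some res)
          Pure.pure res) σ' c (fun x σ' => x = vecSum h ζ t l (μ + 1) s ∧
          σ'.Good h ζ T L U V ∧ σ'.SameFrom (l + 1) σ) := by
      rintro res σ' ⟨rfl, h1, h2⟩ c hc
      have hM' : σ' .M [t, l, μ, s] = none := by rw [h2.2 _ _ _ _ le_rfl, hM]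
      refine ASpec.store_bind hκ (β := β) hidx (by rintro _ ⟨⟩; exact htot)
        (ASpec.pure ⟨rfl, h1.set rfl, (Mem.SameFrom.set _ _ _ _ _ _).trans
          (h2.trans (Mem.SameFrom.refl _ _) (Nat.le_succ _)) le_rfl⟩ ?_)
      · have h3 : ((unset T L U V (σ'.set .M [t, l, μ, s] (some (vecSum h ζ t l (μ + 1) s))) : ℕ)
            : ℤ) + 1 ≤ unset T L U V σ' := by
          exact_mod_cast unset_set ht hl hμ hs hM' _
        have h4 := mul_le_mul_of_nonneg_left h3
          (by positivity : (0 : ℤ) ≤ (U + 1) * ((L + 1) * (43 * u β)))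
        linarith
    refine ASpec.ite (fun he => ?_) fun he => ASpec.ite (fun hc => ?_) fun hc => ?_
    · rw [Arith.eval_eq_eq_one] at he
      obtain ⟨rfl, rfl⟩ : t = 0 ∧ l = 0 := by omega
      exact (ASpec.pure ⟨by rw [vecSum_zero, if_pos rfl], hσ, Mem.SameFrom.refl _ _⟩ le_rfl).bind
        fun res σ' hres => hstore res σ' hres _ (by linarith)
    · have hl0 : 0 < l := Arith.eval_le_eq_one.1 hc.1
      have hsum := vecSum_eq_sum (h := h) (ζ := ζ) (t := t) (μ := μ) hl0 s
      set G : ℕ → ℕ → ℕ := fun t₁ δ => if t₁ * δ ≤ t then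
        vecSum h ζ (t - t₁ * δ) (l - δ) (t₁ - 1 + 1) (s - topSum ζ t δ t₁ s) *
          balancedProd (h t₁) δ (topSum ζ t δ t₁ s) * l.choose δ else 0 with hG
      set F : ℕ → ℕ := fun t₁ => if t ≤ l * t₁ then
        ∑ δ ∈ Finset.Ico (max (t + l - l * t₁) 1) (l + 1), G t₁ δ else 0 with hF
      refine ASpec.lift_bind (RSpec.minimum hκ (β := β) (by omega) (by omega)) ?_
      rintro _ rfl
      refine ASpec.bind (ASpec.loop_le (β := β) (n := U + 1) hκ (fun t₁ acc σ' =>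
        acc = ∑ i ∈ Finset.Ico 0 t₁, F i ∧ σ'.Good h ζ T L U V ∧ σ'.SameFrom l σ)
        ((L + 1) * (21 * u β) + 6 * u β) (by positivity) (by omega) (by omega) (by omega)
        (by omega) ⟨by simp, hσ, Mem.SameFrom.refl _ _⟩ ?_ le_rfl)
        fun res σ' hres => hstore res σ' ⟨by rw [hres.1, hsum], hres.2⟩ _ (by push_cast; linarith)
      rintro t₁ _ σ' - ht₁ ⟨rfl, h1, h2⟩
      have hlt₁ : l * t₁ ≤ l * ζ := Nat.mul_le_mul_left _ (by omega)
      refine ASpec.op_bind hκ (β := β) (by omega) (by omega) ?_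
      refine ASpec.op_bind hκ (β := β) (y := l * t₁) (by omega) (by omega)
        (ASpec.ite (fun hle => ?_) fun hle => ?_)
      swap
      · rw [Arith.eval_le_eq_one] at hle
        refine ASpec.pure ⟨?_, h1, h2⟩ ?_
        · rw [Finset.sum_Ico_succ_top (Nat.zero_le _), show F t₁ = 0 from if_neg hle, add_zero]
        · have : (0 : ℤ) ≤ L * (21 * u β) := by positivity
          linarith
      rw [Arith.eval_le_eq_one] at hle
      replace hle : t ≤ l * t₁ := hle
      have hFt₁ : F t₁ = ∑ δ ∈ Finset.Ico (max (t + l - l * t₁) 1) (l + 1), G t₁ δ := if_pos hle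
      refine ASpec.op_bind hκ (β := β) (by omega) (by omega) ?_
      refine ASpec.op_bind hκ (β := β) (x := t + l) (y := l * t₁) (by omega) (by omega) ?_
      refine ASpec.lift_bind (RSpec.maximum hκ (β := β) (x := t + l - l * t₁) (by omega)
        (by omega)) ?_
      rintro _ rfl
      refine ASpec.mono (ASpec.loop_le (β := β) (n := L + 1) hκ (fun δ acc σ' =>
        acc = ∑ i ∈ Finset.Ico 0 t₁, F i +
          ∑ j ∈ Finset.Ico (max (t + l - l * t₁) 1) δ, G t₁ j ∧ σ'.Good h ζ T L U V ∧
          σ'.SameFrom l σ)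
        (17 * u β) (by positivity) (by omega) (by omega) (by omega)
        (by omega) ⟨by simp, h1, h2⟩ ?_ le_rfl)
        (fun res σ' hres => ⟨by rw [hres.1, Finset.sum_Ico_succ_top (Nat.zero_le _), hFt₁],
          hres.2⟩) (by
            have : (0 : ℤ) ≤ L * u β := by positivity
            push_cast; linarith)
      rintro δ _ σ' hδ1 hδ ⟨rfl, h1, h2⟩
      have htδ : t₁ * δ ≤ L * ζ := by
        rw [mul_comm]
        exact Nat.mul_le_mul (hδ.trans hl) (by omega)
      have hacc : ∑ i ∈ Finset.Ico 0 t₁, F i +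
          ∑ j ∈ Finset.Ico (max (t + l - l * t₁) 1) (δ + 1), G t₁ j < 2 ^ β := by
        refine lt_of_le_of_lt ?_ htot
        rw [hsum]
        exact sum_Ico_add_sum_Ico_le (by omega) hFt₁ (by omega)
      rw [Finset.sum_Ico_succ_top hδ1] at hacc ⊢
      refine ASpec.op_bind hκ (β := β) (by omega) (by omega) ?_
      refine ASpec.op_bind hκ (β := β) (x := t₁ * δ) (by omega) (by omega)
        (ASpec.ite (fun hle' => ?_) fun hle' => ?_)
      swap
      · rw [Arith.eval_le_eq_one] at hle'
        have hG0 : G t₁ δ = 0 := if_neg hle'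
        exact ASpec.pure ⟨by rw [hG0, add_zero], h1, h2⟩ (by linarith)
      rw [Arith.eval_le_eq_one] at hle'
      replace hle' : t₁ * δ ≤ t := hle'
      have hr : SplitRange t l μ t₁ δ := ⟨by omega, hle, by omega, by omega, hδ, hle'⟩
      have hδζ : δ * ζ ≤ L * ζ := Nat.mul_le_mul_right _ (by omega)
      obtain ⟨hS1, hS2, hS3⟩ := ha.topSum_bounds hr
      refine ASpec.op_bind hκ (β := β) (y := t₁ * δ) (by omega) (by omega) ?_
      refine ASpec.op_bind hκ (β := β) (by omega) (by omega) ?_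
      refine ASpec.op_bind hκ (β := β) (by omega) (by omega) ?_
      refine ASpec.op_bind hκ (β := β) (y := t - t₁ * δ) (by omega) (by omega) ?_
      refine ASpec.op_bind hκ (β := β) (by omega) (by omega) ?_
      refine ASpec.lift_bind (RSpec.minimum hκ (β := β) (x := s - (t - t₁ * δ)) (y := δ * ζ)
        (by omega) (by omega)) ?_
      rintro S hS
      obtain rfl : S = topSum ζ t δ t₁ s := hS
      refine ASpec.op_bind hκ (β := β) (by omega) (by omega) ?_
      have hG1 : G t₁ δ = vecSum h ζ (t - t₁ * δ) (l - δ) (t₁ - 1 + 1) (s - topSum ζ t δ t₁ s) *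
          balancedProd (h t₁) δ (topSum ζ t δ t₁ s) * l.choose δ := if_pos hle'
      -- The table range is fixed by T, L, U, V and not by the current arguments, so the same
      -- potential serves the recursive call.
      refine (ASpec.fillM hκ hUζ hsmall hbig hbal hchoose fuel (t - t₁ * δ) (l - δ) (t₁ - 1)
        (s - topSum ζ t δ t₁ s) σ' (by omega) (by omega) (by omega) (by omega) (by omega)
        (ha.split hr) h1).bind ?_
      rintro x σ'' ⟨hx, h3, h4⟩
      have hxβ : x < 2 ^ β := by rw [hx]; exact hbig _ _ _ _ (by omega) (by omega) (by omega) (ha.split hr)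
      refine ASpec.fetch_bind hκ (β := β) (IndexLt.three (by omega) (by omega) (by omega))
        (h3.coeff δ t₁ _ (by omega) (by omega) (by omega) (by omega) hS1 hS2)
        (hbal δ t₁ _ (by omega) (by omega) (by omega) (by omega) hS1 hS2) ?_
      refine ASpec.fetch_bind hκ (β := β) (IndexLt.two (by omega) (by omega))
        (h3.choose l δ (by omega) (by omega)) (hchoose l (by omega) δ (by omega)) ?_
      have hGx : G t₁ δ = x * balancedProd (h t₁) δ (topSum ζ t δ t₁ s) * l.choose δ := by
        rw [hG1, hx]
      have hxy : x * balancedProd (h t₁) δ (topSum ζ t δ t₁ s) ≤ G t₁ δ := by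
        rw [hGx]
        exact Nat.le_mul_of_pos_right _ (Nat.choose_pos hδ)
      refine ASpec.op_bind hκ (β := β) hxβ
        (hbal δ t₁ _ (by omega) (by omega) (by omega) (by omega) hS1 hS2) ?_
      refine ASpec.op_bind hκ (β := β) (x := x * balancedProd (h t₁) δ (topSum ζ t δ t₁ s))
        (by omega) (hchoose l (by omega) δ (by omega)) ?_
      refine ASpec.op hκ (β := β)
        (y := x * balancedProd (h t₁) δ (topSum ζ t δ t₁ s) * l.choose δ) (by omega)
        (by rw [← hGx]; omega) ⟨?_, h3, h4.trans h2 (by omega)⟩ (by linarith)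
      rw [hGx, ← add_assoc]
      rfl
    -- Unreachable: an admissible call fails the test only for l = 0, which forces t = s = 0, and
    -- that case has been handled.
    · rw [Arith.eval_eq_eq_one] at he
      refine absurd ⟨Arith.eval_le_eq_one.2 ?_, Arith.eval_le_eq_one.2 (le_min ha.le_s ha.le_mul),
        Arith.eval_le_eq_one.2 ha.s_le⟩ hc
      by_contra hl0
      obtain rfl : l = 0 := by omega
      have h1 := ha.le_mul
      have h2 := ha.s_le
      omega
end FillM

end SumRank

namespace SumRank

/-! ### Sizes of the numbers -/

section Sizes

variable {q : ℕ}

theorem qBinom_le_pow (hq : 2 ≤ q) (a b : ℕ) : qBinom q a b ≤ q ^ (a * (b + 1)) := by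
  induction a generalizing b with
  | zero => cases b <;> simp [qBinom]
  | succ a ih =>
    cases b with
    | zero => simpa using Nat.one_le_pow _ _ (by omega)
    | succ b =>
      have h1 : q ^ (a * (b + 1)) ≤ q ^ (b + 1 + a * (b + 2)) :=
        Nat.pow_le_pow_right (by omega) (by nlinarith)
      calc qBinom q (a + 1) (b + 1) = qBinom q a b + q ^ (b + 1) * qBinom q a (b + 1) := rfl
        _ ≤ q ^ (a * (b + 1)) + q ^ (b + 1) * q ^ (a * (b + 2)) :=
          Nat.add_le_add (ih b) (Nat.mul_le_mul_left _ (ih (b + 1)))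
        _ ≤ 2 * q ^ (b + 1 + a * (b + 2)) := by rw [← pow_add]; omega
        _ ≤ q * q ^ (b + 1 + a * (b + 2)) := Nat.mul_le_mul_right _ hq
        _ = q ^ ((a + 1) * (b + 1 + 1)) := by rw [← pow_succ']; congr 1; ring

theorem qFact_le (q : ℕ) (hq : 1 ≤ q) (k : ℕ) : qFact q k ≤ q ^ (k * k) := by
  rw [pow_mul]
  calc qFact q k ≤ ∏ _i ∈ Finset.range k, q ^ k := Finset.prod_le_prod' fun i hi =>
        (Nat.sub_le _ _).trans (Nat.pow_le_pow_right hq (Finset.mem_range.1 hi))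
    _ = (q ^ k) ^ k := by rw [Finset.prod_const, Finset.card_range]

/-- Two of the three copies of ζ² in the exponent bound [ζ, v], the third bounds the cofactor by R.
-/
theorem ratioNum_le (hq : 2 ≤ q) {ζ A μ v w : ℕ} (hμ : 1 ≤ μ) (hμζ : μ ≤ ζ) (hA : A ≤ ζ)
    (hvμ : v ≤ μ) (hv : v ≤ w) (hw : w ≤ A) : ratioNum q ζ A v w ≤ q ^ (3 * ζ ^ 2) := by
  have h1 : qBinom q ζ v ≤ q ^ (2 * ζ ^ 2) :=
    (qBinom_le_pow hq ζ v).trans (Nat.pow_le_pow_right (by omega) (by nlinarith))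
  have h2 : cofactor q A w v ≤ q ^ (ζ ^ 2) :=
    (cofactor_le hq hv hw).trans ((qFact_le q (by omega) A).trans
      (Nat.pow_le_pow_right (by omega) (by nlinarith)))
  calc ratioNum q ζ A v w ≤ q ^ (2 * ζ ^ 2) * q ^ (ζ ^ 2) := Nat.mul_le_mul h1 h2
    _ = q ^ (3 * ζ ^ 2) := by rw [← pow_add]; congr 1; ring

theorem IsCompletion.le_min {ζ s : ℕ} {ι : Type*} {E : Finset ι} {v w : ι → ℕ}
    (h : IsCompletion ζ E v s w) {i : ι} (hi : i ∈ E) : w i ≤ min ζ s := by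
  refine _root_.le_min (h.le_cap i hi) ?_
  rw [← h.sum_eq]
  exact Finset.single_le_sum (fun _ _ => Nat.zero_le _) hi

theorem balancedProd_eq_prod {𝕂 : Type*} [CommMonoid 𝕂] (h : ℕ → 𝕂) {ζ δ t₁ S : ℕ} {w : Fin δ → ℕ}
    (hδ : 1 ≤ δ) (hw : IsCompletion ζ Finset.univ (fun _ : Fin δ => t₁) S w) :
    balancedProd h δ S = ∏ i, h (w i) := by
  have h3 := prod_eq_balancedProd h (D := Finset.univ) (w := w)
    (Finset.univ_nonempty_iff.2 ⟨⟨0, hδ⟩⟩) (fun i hi j hj => hw.balance i hi j hj rfl)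
  rw [hw.sum_eq, Finset.card_fin] at h3
  exact h3.symm

theorem balancedProd_le (hq : 2 ≤ q) {ζ μ s δ t₁ S : ℕ} (hμ : 1 ≤ μ) (hμζ : μ ≤ ζ)
    (hδ : 1 ≤ δ) (ht₁ : t₁ ≤ μ) (hS : S ≤ s) (h1 : t₁ * δ ≤ S) (h2 : S ≤ ζ * δ) :
    balancedProd (ratioNum q ζ (min ζ s) t₁) δ S ≤ q ^ (3 * ζ ^ 2 * δ) := by
  -- `balancedProd` does not involve coins; any choice realizes it as a product over an actual
  -- completion.
  have hw := isCompletion_scomp (fun _ _ _ _ => 0) (ζ := ζ) (s := S) (t := fun _ : Fin δ => t₁)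
    (fun _ => ht₁.trans hμζ) (by simpa [mul_comm] using h1) (by rwa [mul_comm])
  rw [balancedProd_eq_prod _ hδ hw, pow_mul]
  calc _ ≤ ∏ _i : Fin δ, q ^ (3 * ζ ^ 2) := Finset.prod_le_prod' fun i _ =>
        ratioNum_le hq hμ hμζ (min_le_left _ _) ht₁ (hw.le i (Finset.mem_univ i))
          ((hw.le_min (Finset.mem_univ i)).trans (by omega))
    _ = _ := by rw [Finset.prod_const, Finset.card_fin]

/-- The weighted sum over all weight decompositions, computed by means of `scomp`. -/
theorem sum_weightDecomps_eq_vecSum (h : ℕ → ℕ → ℕ) (χ : Coins) {ζ t l μ s : ℕ}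
    (ha : Admissible ζ t l μ s) :
    ∑ v ∈ weightDecomps t l μ, ∏ i, h (v i) ((scomp χ ζ v s).val i) =
      vecSum h ζ t l (μ + 1) s := by
  have h1 := sum_vecs_eq_vecSum (ζ := ζ) h (Finset.univ : Finset (Fin l)) t (μ + 1) s
    (fun v => (scomp χ ζ v s).val) fun v hv => by
      obtain ⟨h1, -, h3⟩ := mem_vecs.1 hv
      exact isCompletion_scomp χ
        (fun i => (Nat.le_of_lt_succ (h1 i (Finset.mem_univ i))).trans ha.le_cap)
        (h3.le.trans ha.le_s) ha.s_le
  rwa [vecs_univ, Finset.card_fin] at h1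

theorem isCompletion_of_mem_weightDecomps (χ : Coins) {ζ t l μ s : ℕ} (ha : Admissible ζ t l μ s)
    {v : Fin l → ℕ} (hv : v ∈ weightDecomps t l μ) :
    IsCompletion ζ Finset.univ v s (scomp χ ζ v s).val := by
  simp only [weightDecomps, Finset.mem_filter, Fintype.mem_piFinset, Finset.mem_range] at hv
  exact isCompletion_scomp χ (fun i => (Nat.le_of_lt_succ (hv.1 i)).trans ha.le_cap)
    (hv.2.le.trans ha.le_s) ha.s_le

theorem card_weightDecomps_le (t l μ : ℕ) : (weightDecomps t l μ).card ≤ (μ + 1) ^ l := by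
  refine (Finset.card_filter_le _ _).trans ?_
  simp [Fintype.card_piFinset]

/-- There are at most (μ+1)^l ≤ q^(ζ²l) vectors, each contributing at most q^(3ζ²l). Hence table
entries have O(lζ² log q) bits. -/
theorem vecSum_le (hq : 2 ≤ q) {ζ t l μ s U V : ℕ} (hU : 1 ≤ U) (hUζ : U ≤ ζ) (hμU : μ ≤ U)
    (hs : s ≤ V) (ha : Admissible ζ t l μ s) :
    vecSum (ratioNum q ζ (min ζ V)) ζ t l (μ + 1) s ≤ q ^ (4 * ζ ^ 2 * l) := by
  rw [← sum_weightDecomps_eq_vecSum _ (fun _ _ _ _ => 0) ha]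
  have h1 : ∀ v ∈ weightDecomps t l μ, ∏ i, ratioNum q ζ (min ζ V) (v i)
      ((scomp (fun _ _ _ _ => 0) ζ v s).val i) ≤ (q ^ (3 * ζ ^ 2)) ^ l := fun v hv => by
    have hw := isCompletion_of_mem_weightDecomps (fun _ _ _ _ => 0) ha hv
    simp only [weightDecomps, Finset.mem_filter, Fintype.mem_piFinset, Finset.mem_range] at hv
    calc _ ≤ ∏ _i : Fin l, q ^ (3 * ζ ^ 2) := Finset.prod_le_prod' fun i _ =>
          ratioNum_le hq hU hUζ (min_le_left _ _) (by have := hv.1 i; omega)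
            (hw.le i (Finset.mem_univ i)) ((hw.le_min (Finset.mem_univ i)).trans (by omega))
      _ = _ := by rw [Finset.prod_const, Finset.card_fin]
  have h2 : μ + 1 ≤ q ^ (ζ ^ 2) :=
    calc μ + 1 ≤ 2 ^ μ := Nat.lt_two_pow_self
      _ ≤ q ^ μ := Nat.pow_le_pow_left hq _
      _ ≤ q ^ (ζ ^ 2) := Nat.pow_le_pow_right (by omega) (by nlinarith)
  calc _ ≤ (weightDecomps t l μ).card • (q ^ (3 * ζ ^ 2)) ^ l := Finset.sum_le_card_nsmul _ _ _ h1
    _ ≤ (q ^ (ζ ^ 2)) ^ l * (q ^ (3 * ζ ^ 2)) ^ l := Nat.mul_le_mul_right _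
      ((card_weightDecomps_le t l μ).trans (Nat.pow_le_pow_left h2 _))
    _ = q ^ (4 * ζ ^ 2 * l) := by rw [← mul_pow, ← pow_add, ← pow_mul]; congr 1; ring

theorem lt_two_pow_of_le_pow {x k e β : ℕ} (hq : q < 2 ^ e) (hx : x ≤ q ^ k) (hk : 1 ≤ k)
    (hβ : e * k ≤ β) : x < 2 ^ β :=
  calc x ≤ q ^ k := hx
    _ < (2 ^ e) ^ k := Nat.pow_lt_pow_left hq (by omega)
    _ = 2 ^ (e * k) := (pow_mul _ _ _).symm
    _ ≤ 2 ^ β := Nat.pow_le_pow_right (by omega) hβ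

end Sizes

/-! ### The whole computation. -/

section Compute

variable {κ : BitStep → ℕ} {u : ℕ → ℕ} {Φ : Mem → ℤ}

theorem ASpec.of_potential {α : Type} {p : Alg α} {σ : Mem} {c : ℤ} {Q : α → Mem → Prop}
    (h : ASpec κ Φ p σ c Q) (hΦ : ∀ σ, 0 ≤ Φ σ) : ASpec κ (fun _ => 0) p σ (c + Φ σ) Q :=
  ⟨h.1, by linarith [h.2, hΦ (p.run σ).val.2]⟩

theorem ASpec.run {α : Type} {p : Alg α} {σ : Mem} {c : ℤ} {Q : α → Mem → Prop}
    (h : ASpec κ (fun _ => 0) p σ c Q) : RSpec κ (p.run σ) c (fun r => Q r.1 r.2) :=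
  ⟨h.1, by simpa using h.2⟩

/-- Bit lengths of the numbers that occur in the different parts of the computation. -/
structure SizeBounds (q ζ t l μ s L βg βc βh β : ℕ) : Prop where
  index : t + l + s + l * ζ + ζ + 2 < 2 ^ L
  index_gauss : L ≤ βg
  index_cof : L ≤ βc
  index_choose : L ≤ βh
  index_big : L ≤ β
  q_gauss : q < 2 ^ βg
  pow_gauss : ∀ b ≤ μ, q ^ b < 2 ^ βg
  mul_gauss : ∀ a ≤ ζ, ∀ b ≤ μ, q ^ b * qBinom q a b < 2 ^ βg
  pow_cof : q ^ (min ζ s + 1) < 2 ^ βc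
  fact_cof : qFact q (min ζ s) < 2 ^ βc
  choose_choose : ∀ i ≤ l, ∀ j ≤ l, i.choose j < 2 ^ βh
  gauss_big : ∀ b ≤ μ, qBinom q ζ b < 2 ^ β
  coeff_big : ∀ δ t₁ S, 1 ≤ δ → δ ≤ l → t₁ ≤ min μ t → S ≤ s → t₁ * δ ≤ S → S ≤ ζ * δ →
    balancedProd (ratioNum q ζ (min ζ s) t₁) δ S < 2 ^ β
  choose_big : ∀ i ≤ l, ∀ j ≤ l, i.choose j < 2 ^ β
  vecSum_big : ∀ t' l' μ' s', l' ≤ l → μ' ≤ μ → s' ≤ s → Admissible ζ t' l' μ' s' →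
    vecSum (ratioNum q ζ (min ζ s)) ζ t' l' (μ' + 1) s' < 2 ^ β
  pow_big : ∀ k ≤ l, qFact q (min ζ s) ^ k < 2 ^ β
  factorial_big : ∀ k ≤ l, k.factorial < 2 ^ β

/-- Up to constants, the lengths are L times ζμe for Gaussian binomials, ζ²e for cofactors, l for
binomials and lζ²e for numerators. The factor L makes room for the indices and for l! ≤ 2^(L·l). -/
theorem sizeBounds {q ζ t l μ s L e : ℕ} (hq : 2 ≤ q)
    (hqe : q < 2 ^ e) (hl : 1 ≤ l) (hμ : 1 ≤ μ) (hμζ : μ ≤ ζ)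
    (hL : t + l + s + l * ζ + ζ + 2 < 2 ^ L) :
    SizeBounds q ζ t l μ s L (L * (4 * (ζ * μ * e))) (L * (2 * (ζ ^ 2 * e))) (L * (2 * l))
      (L * (5 * (l * ζ ^ 2 * e))) := by
  have he : 1 ≤ e := by
    by_contra h
    obtain rfl : e = 0 := by omega
    omega
  have hL1 : 1 ≤ L := by
    by_contra h
    obtain rfl : L = 0 := by omega
    omega
  have hζ1 : 1 ≤ ζ := hμ.trans hμζ
  have hmul : ∀ {x k y : ℕ}, x ≤ q ^ k → 1 ≤ k → k ≤ y → x < 2 ^ (L * (y * e)) := fun hx hk hk' =>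
    lt_two_pow_of_le_pow hqe hx hk (by
      rw [mul_comm e]
      exact (Nat.mul_le_mul_right _ hk').trans (Nat.le_mul_of_pos_left _ hL1))
  have hg : ∀ {x k : ℕ}, x ≤ q ^ k → 1 ≤ k → k ≤ 4 * (ζ * μ) → x < 2 ^ (L * (4 * (ζ * μ * e))) :=
    fun hx hk hk' => by rw [← mul_assoc 4]; exact hmul hx hk hk'
  have hc : ∀ {x k : ℕ}, x ≤ q ^ k → 1 ≤ k → k ≤ 2 * ζ ^ 2 → x < 2 ^ (L * (2 * (ζ ^ 2 * e))) :=
    fun hx hk hk' => by rw [← mul_assoc 2]; exact hmul hx hk hk'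
  have hb : ∀ {x k : ℕ}, x ≤ q ^ k → 1 ≤ k → k ≤ 5 * (l * ζ ^ 2) →
      x < 2 ^ (L * (5 * (l * ζ ^ 2 * e))) :=
    fun hx hk hk' => by rw [← mul_assoc 5]; exact hmul hx hk hk'
  have hqpow : ∀ {a b : ℕ}, a ≤ b → q ^ a ≤ q ^ b := fun h => Nat.pow_le_pow_right (by omega) h
  have hζμ : ζ ≤ ζ * μ := Nat.le_mul_of_pos_right _ hμ
  have hζμ' : μ ≤ ζ * μ := Nat.le_mul_of_pos_left _ hζ1
  have hζζ : ζ ≤ ζ ^ 2 := Nat.le_self_pow (by omega) ζ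
  have hμζ2 : ζ * μ ≤ ζ ^ 2 := by rw [sq]; exact Nat.mul_le_mul_left _ hμζ
  have hlζ : l ≤ l * ζ ^ 2 := Nat.le_mul_of_pos_right _ (by positivity)
  have hlζ' : ζ ^ 2 ≤ l * ζ ^ 2 := Nat.le_mul_of_pos_left _ hl
  have hle : l * ζ ^ 2 ≤ l * ζ ^ 2 * e := Nat.le_mul_of_pos_right _ he
  have hA := min_le_left ζ s
  have hRq : qFact q (min ζ s) ≤ q ^ (ζ ^ 2) := (qFact_le q (by omega) _).trans
    (hqpow (by rw [sq]; exact Nat.mul_le_mul hA hA))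
  have hqB : ∀ b ≤ μ, ∀ a ≤ ζ, qBinom q a b ≤ q ^ (ζ * μ + ζ) := fun b hb a ha =>
    (qBinom_le_pow hq a b).trans (hqpow (Nat.mul_le_mul ha (by omega : b + 1 ≤ μ + 1)))
  have hchoose : ∀ i ≤ l, ∀ j ≤ l, i.choose j ≤ 2 ^ l := fun i hi j _ =>
    (Nat.choose_le_two_pow i j).trans (Nat.pow_le_pow_right (by omega) hi)
  constructor
  · exact hL
  · exact Nat.le_mul_of_pos_right _ (by positivity)
  · exact Nat.le_mul_of_pos_right _ (by positivity)
  · exact Nat.le_mul_of_pos_right _ (by positivity)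
  · exact Nat.le_mul_of_pos_right _ (by positivity)
  · exact hg (pow_one q).ge le_rfl (by omega)
  · exact fun b hb => hg (hqpow hb) hμ (by omega)
  · intro a ha b hb
    refine hg (k := μ + (ζ * μ + ζ)) ?_ (by omega) (by omega)
    rw [pow_add]
    exact Nat.mul_le_mul (hqpow hb) (hqB b hb a ha)
  · exact hc le_rfl (by omega) (by omega)
  · exact hc hRq (by omega) (by omega)
  · refine fun i hi j hj => (hchoose i hi j hj).trans_lt (Nat.pow_lt_pow_right (by omega) ?_)
    exact lt_of_lt_of_le (by omega) (Nat.le_mul_of_pos_left _ hL1)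
  · exact fun b hbμ => hb (hqB b hbμ ζ le_rfl) (by omega) (by omega)
  · exact fun δ t₁ S h1 h2 h3 h4 h5 h6 =>
      hb ((balancedProd_le hq hμ hμζ h1 (h3.trans (min_le_left _ _)) h4 h5 h6).trans
        (hqpow (Nat.mul_le_mul_left _ h2))) (Nat.mul_pos (by positivity) hl)
        (by rw [mul_assoc, mul_comm (ζ ^ 2)]; omega)
  · exact fun i hi j hj => hb ((hchoose i hi j hj).trans (Nat.pow_le_pow_left hq l)) hl (by omega)
  · exact fun t' l' μ' s' h1 h2 h3 h4 =>
      hb ((vecSum_le hq hμ hμζ h2 h3 h4).trans (hqpow (Nat.mul_le_mul_left _ h1)))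
        (Nat.mul_pos (by positivity) hl) (by rw [mul_assoc, mul_comm (ζ ^ 2)]; omega)
  · exact fun k hk => hb ((Nat.pow_le_pow_right (qFact_pos hq _) hk).trans
      ((Nat.pow_le_pow_left hRq l).trans_eq (pow_mul _ _ _).symm))
      (Nat.mul_pos (by positivity) hl) (by rw [mul_comm]; omega)
  · intro k hk
    have h1 : k.factorial ≤ 2 ^ (L * l) :=
      calc k.factorial ≤ l.factorial := Nat.factorial_le hk
        _ ≤ l ^ l := Nat.factorial_le_pow l
        _ ≤ (2 ^ L) ^ l := Nat.pow_le_pow_left (by omega) _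
        _ = 2 ^ (L * l) := (pow_mul _ _ _).symm
    exact h1.trans_lt (Nat.pow_lt_pow_right (by omega)
      (Nat.mul_lt_mul_of_pos_left (by omega) hL1))

/-- A bound on the cost of `compute`. -/
def computeCost (u : ℕ → ℕ) (ζ t l μ s L βg βc βh β : ℕ) : ℕ :=
  (ζ + 1) * ((μ + 1) * (22 * u βg)) +
  (min ζ s + 1) * ((min μ t + 1) * (40 * u βc)) +
  (l + 1) * ((l + 1) * (18 * u βh)) +
  l * ((min μ t + 1) * ((s + 1) * ((l * ζ + 1) * ((l + 1) * (26 * u L)) + (l + 1) * (3 * u β)))) +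
  (t + 1) * ((l + 1) * ((μ + 1) * ((s + 1) * (13 * u L)))) +
  (μ + 1) * ((l + 1) * (43 * u β)) * ((t + 1) * ((l + 1) * ((μ + 1) * (s + 1)))) +
  (8 * l + 4) * u β + 2 * u L

theorem RSpec.compute (hκ : CostBound κ u) (χ : Coins) {q ζ t l μ s L βg βc βh β : ℕ}
    (hq : 2 ≤ q) (hl : 1 ≤ l) (ha : Admissible ζ t l μ s)
    (hb : SizeBounds q ζ t l μ s L βg βc βh β) :
    RSpec κ (compute χ q ζ t l μ s) (computeCost u ζ t l μ s L βg βc βh β) (fun out =>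
      out.numM = vecSum (ratioNum q ζ (min ζ s)) ζ t l (μ + 1) s ∧
      out.numQ = l.factorial * vecSum (ratioNum q ζ (min ζ s)) ζ t l (μ + 1) s ∧
      out.den = l.factorial * qFact q (min ζ s) ^ l) := by
  have hμζ := ha.le_cap
  have hL := hb.index
  have hpow : ∀ {β' x : ℕ}, L ≤ β' → x < 2 ^ L → x < 2 ^ β' := fun hβ hx =>
    hx.trans_le (Nat.pow_le_pow_right (by omega) hβ)
  have hlL : l + 1 < 2 ^ β := hpow hb.index_big (by omega)
  have hu : (0 : ℤ) ≤ u β := by positivity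
  suffices h : ASpec κ (fun _ => 0) (computeAlg χ q ζ t l μ s) (fun _ _ => none)
      (computeCost u ζ t l μ s L βg βc βh β) (fun out _ =>
      out.numM = vecSum (ratioNum q ζ (min ζ s)) ζ t l (μ + 1) s ∧
      out.numQ = l.factorial * vecSum (ratioNum q ζ (min ζ s)) ζ t l (μ + 1) s ∧
      out.den = l.factorial * qFact q (min ζ s) ^ l) by
    exact h.run.bind fun r hr => RSpec.pure hr (by simp)
  unfold computeAlg
  refine ASpec.lift_bind (RSpec.minimum hκ (β := L) (by omega) (by omega)) ?_
  rintro _ rfl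
  refine ASpec.lift_bind (RSpec.minimum hκ (β := L) (by omega) (by omega)) ?_
  rintro _ rfl
  refine (ASpec.fillGauss hκ (hpow hb.index_gauss (by omega)) (hpow hb.index_gauss (by omega))
    (by omega) hb.q_gauss hb.pow_gauss hb.mul_gauss).bind ?_
  rintro _ σ₁ ⟨hg, hoff₁⟩
  refine (ASpec.fillCof hκ hq (hpow hb.index_cof (by omega)) (hpow hb.index_cof (by omega))
    hb.pow_cof hb.fact_cof (by rw [hoff₁ _ (by simp)])).bind ?_
  rintro _ σ₂ ⟨hcof, hlow, hoff₂⟩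
  refine (ASpec.fillChoose hκ (hpow hb.index_choose (by omega)) hb.choose_choose).bind ?_
  rintro _ σ₃ ⟨hch, hoff₃⟩
  refine (ASpec.fillCoeff hκ χ hq hl ((min_le_left _ _).trans hμζ) (by omega) (by omega)
    (by omega) (by omega) hb.index_big (fun b hbB => hb.gauss_big b (by omega))
    (by simpa using hb.pow_big 1 hl) hb.coeff_big
    (fun b hbB => by
      rw [hoff₃ _ (by simp), hoff₂ _ (by simp)]
      exact hg ζ b le_rfl (by omega))
    (fun a b h1 h2 => by
      rw [hoff₃ _ (by simp)]
      exact hcof a b h1 h2)).bind ?_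
  rintro _ σ₄ ⟨hcoeff, hoff₄⟩
  refine (ASpec.clearM hκ (β := L) (by omega) (by omega) (by omega) (by omega) fun idx => by
    rw [hoff₄ _ (by simp), hoff₃ _ (by simp), hoff₂ _ (by simp), hoff₁ _ (by simp)]).bind ?_
  rintro _ σ₅ ⟨hM, hoff₅⟩
  have hgood : σ₅.Good (ratioNum q ζ (min ζ s)) ζ t l μ s :=
    { coeff := by
        rw [hoff₅ _ (by simp)]
        exact hcoeff
      choose := by
        rw [hoff₅ _ (by simp), hoff₄ _ (by simp)]
        exact hch
      correct := fun t' l' μ' s' v hv => by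
        rw [hM] at hv
        cases hv }
  -- The potential of the initial table, in which nothing is set, is converted into actual cost
  -- here.
  refine ((ASpec.fillM hκ hμζ (hpow hb.index_big (by omega)) hb.vecSum_big hb.coeff_big
    hb.choose_big (l + 1) t l μ s σ₅ (by omega) le_rfl le_rfl le_rfl le_rfl ha
    hgood).of_potential (fun σ => by positivity)).bind ?_
  rintro x σ₆ ⟨hx, -, hoff₆, -⟩
  have hxβ : x < 2 ^ β := by
    rw [hx]
    exact hb.vecSum_big _ _ _ _ le_rfl le_rfl le_rfl ha
  refine ASpec.fetch_bind hκ (β := β)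
    (IndexLt.one ((min_le_left _ _).trans_lt (hpow hb.index_big (by omega))))
    (by rw [hoff₆ _ (by simp), hoff₅ _ (by simp), hoff₄ _ (by simp), hoff₃ _ (by simp), hlow])
    (by simpa using hb.pow_big 1 hl) ?_
  refine (ASpec.loop_le (β := β) (n := l) (c' := l * (4 * u β)) hκ
    (fun i y _ => y = qFact q (min ζ s) ^ (i - 1)) (u β) hu (by omega) hlL (by omega) hl
    (by simp) ?_ (by linarith)).bind ?_
  · rintro i _ σ hi1 hi rfl
    refine ASpec.op hκ (β := β) (hb.pow_big _ (by omega)) (by simpa using hb.pow_big 1 hl) ?_ le_rfl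
    obtain ⟨i, rfl⟩ := Nat.exists_eq_add_of_le' hi1
    exact (pow_succ _ _).symm
  rintro _ σ₇ rfl
  rw [Nat.add_sub_cancel]
  refine (ASpec.loop_le (β := β) (n := l) (c' := l * (4 * u β)) hκ
    (fun i y _ => y = (i - 1).factorial) (u β) hu (by omega) hlL (by omega) hl
    (by simp) ?_ (by linarith)).bind ?_
  · rintro i _ σ hi1 hi rfl
    refine ASpec.op hκ (β := β) (hb.factorial_big _ (by omega)) (by omega) ?_ le_rfl
    obtain ⟨i, rfl⟩ := Nat.exists_eq_add_of_le' hi1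
    exact (mul_comm _ _).trans (Nat.factorial_succ i).symm
  rintro _ σ₈ rfl
  rw [Nat.add_sub_cancel]
  refine ASpec.op_bind hκ (β := β) (hb.factorial_big _ le_rfl) hxβ ?_
  refine ASpec.op_bind hκ (β := β) (hb.factorial_big _ le_rfl) (hb.pow_big _ le_rfl) ?_
  refine ASpec.pure ⟨hx, by rw [← hx]; rfl, rfl⟩ ?_
  have hunset : ((unset t l μ s σ₅ : ℕ) : ℤ) ≤ (t + 1) * ((l + 1) * ((μ + 1) * (s + 1))) := by
    exact_mod_cast unset_le t l μ s σ₅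
  have h1 := mul_le_mul_of_nonneg_left hunset
    (by positivity : (0 : ℤ) ≤ (μ + 1) * ((l + 1) * (43 * u β)))
  unfold computeCost
  push_cast
  linarith

end Compute

end SumRank

namespace SumRank

/-! ### Correctness -/

theorem IsCompletion.comp_perm {ζ l s : ℕ} {v w : Fin l → ℕ}
    (h : IsCompletion ζ Finset.univ v s w) (σ : Equiv.Perm (Fin l)) :
    IsCompletion ζ Finset.univ (v ∘ σ) s (w ∘ σ) where
  le i _ := h.le (σ i) (Finset.mem_univ _)
  le_cap i _ := h.le_cap (σ i) (Finset.mem_univ _)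
  sum_eq := by rw [← h.sum_eq]; exact Equiv.sum_comp σ w
  priority i _ j _ := h.priority (σ i) (Finset.mem_univ _) (σ j) (Finset.mem_univ _)
  balance i _ j _ := h.balance (σ i) (Finset.mem_univ _) (σ j) (Finset.mem_univ _)

section Correct

variable (F : Type) [Field F] (χ : Coins) {ζ t l μ s : ℕ}

/-- The summand of `Q` that belongs to a weight decomposition. -/
noncomputable def summand (ζ s : ℕ) {l : ℕ} (v : Fin l → ℕ) : ℚ :=
  ∏ i, (gaussBinom F ζ (v i) : ℚ) / (gaussBinom F ((scomp χ ζ v s).val i) (v i) : ℚ)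

theorem Q_eq_sum_summand : Q F χ ζ s t l μ = ∑ v ∈ weightDecomps t l μ, summand F χ ζ s v := by
  refine Finset.sum_congr rfl fun v _ => ?_
  rw [rho, summand, ← Finset.prod_inv_distrib]
  exact Finset.prod_congr rfl fun i _ => inv_div _ _

/-- `scomp` need not commute with permutations, as the coins see the vector. But permuting a
completion of v gives a completion of the permuted vector, and all completions have the same weight.
-/
theorem summand_comp (ha : Admissible ζ t l μ s) {v : Fin l → ℕ} (hv : v ∈ weightDecomps t l μ)
    (σ : Equiv.Perm (Fin l)) : summand F χ ζ s (v ∘ σ) = summand F χ ζ s v := by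
  have h1 := isCompletion_of_mem_weightDecomps χ ha hv
  have h2 := isCompletion_of_mem_weightDecomps χ ha (comp_mem_weightDecomps hv σ)
  refine ((h2.prod_unique (fun x y => (gaussBinom F ζ x : ℚ) / (gaussBinom F y x : ℚ))
    (h1.comp_perm σ)).trans ?_)
  exact Equiv.prod_comp σ fun i =>
    (gaussBinom F ζ (v i) : ℚ) / (gaussBinom F ((scomp χ ζ v s).val i) (v i) : ℚ)

/-- `Q_{t,l,μ} = l! * M(t, l, μ, s)`. -/
theorem Q_eq_factorial_mul_M (hl : 1 ≤ l) (ha : Admissible ζ t l μ s) :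
    Q F χ ζ s t l μ = l.factorial * M F χ ζ t l μ s := by
  rw [Q_eq_sum_summand, M, if_pos ⟨hl, le_min ha.le_s ha.le_mul, ha.s_le⟩,
    sum_weightDecomps_eq t μ _ fun v hv σ => summand_comp F χ ha hv σ]
  rfl

/-- Each of the l factors [ζ, v_i]/[w_i, v_i] takes one factor R and becomes the integer `ratioNum`.
-/
theorem Q_mul_pow [Fintype F] (ha : Admissible ζ t l μ s) :
    Q F χ ζ s t l μ * (qFact (Fintype.card F) (min ζ s) : ℚ) ^ l =
      vecSum (ratioNum (Fintype.card F) ζ (min ζ s)) ζ t l (μ + 1) s := by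
  have hq : 2 ≤ Fintype.card F := Fintype.one_lt_card
  rw [← sum_weightDecomps_eq_vecSum _ χ ha, Q_eq_sum_summand, Finset.sum_mul, Nat.cast_sum]
  refine Finset.sum_congr rfl fun v hv => ?_
  have h1 := isCompletion_of_mem_weightDecomps χ ha hv
  have h2 : (qFact (Fintype.card F) (min ζ s) : ℚ) ^ l =
      ∏ _i : Fin l, (qFact (Fintype.card F) (min ζ s) : ℚ) := by
    rw [Finset.prod_const, Finset.card_fin]
  rw [summand, h2, ← Finset.prod_mul_distrib, Nat.cast_prod]
  refine Finset.prod_congr rfl fun i _ => ?_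
  have h3 := h1.le i (Finset.mem_univ i)
  have h4 : (qBinom (Fintype.card F) ((scomp χ ζ v s).val i) (v i) : ℚ) ≠ 0 :=
    Nat.cast_ne_zero.2 (qBinom_pos hq h3).ne'
  rw [gaussBinom_eq_qBinom, gaussBinom_eq_qBinom,
    ← qBinom_mul_cofactor hq h3 (h1.le_min (Finset.mem_univ i)), ratioNum]
  push_cast
  field_simp

end Correct

/-- The coins of the program and those in M and Q may differ, since `vecSum` involves none. The
specification is used with an arbitrary cost function, as only its statement on results is needed.
-/
theorem compute_correct (F : Type) [Field F] [Fintype F] {ζ t l μ s : ℕ} (hl : 1 ≤ l) (hμ : 1 ≤ μ)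
    (ha : Admissible ζ t l μ s) (χ χ₀ : Coins) :
    (compute χ (Fintype.card F) ζ t l μ s).val.den ≠ 0 ∧
    ((compute χ (Fintype.card F) ζ t l μ s).val.numM : ℚ) /
      (compute χ (Fintype.card F) ζ t l μ s).val.den = M F χ₀ ζ t l μ s ∧
    ((compute χ (Fintype.card F) ζ t l μ s).val.numQ : ℚ) /
      (compute χ (Fintype.card F) ζ t l μ s).val.den = Q F χ₀ ζ s t l μ ∧
    Q F χ₀ ζ s t l μ = (l.factorial : ℚ) * M F χ₀ ζ t l μ s := by
  have hq : 2 ≤ Fintype.card F := Fintype.one_lt_card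
  obtain ⟨h1, h2, h3⟩ := (RSpec.compute sizeCost_bound χ hq hl ha (sizeBounds hq
    (Nat.lt_size_self _) hl hμ ha.le_cap (Nat.lt_size_self (t + l + s + l * ζ + ζ + 2)))).1
  have hR : (qFact (Fintype.card F) (min ζ s) : ℚ) ^ l ≠ 0 :=
    pow_ne_zero _ (Nat.cast_ne_zero.2 (qFact_pos hq _).ne')
  have hf : (l.factorial : ℚ) ≠ 0 := Nat.cast_ne_zero.2 (Nat.factorial_ne_zero l)
  have hQ := Q_eq_factorial_mul_M F χ₀ hl ha
  have hv := Q_mul_pow F χ₀ ha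
  rw [h1, h2, h3]
  refine ⟨Nat.mul_ne_zero (Nat.factorial_ne_zero l) (pow_ne_zero _ (qFact_pos hq _).ne'),
    ?_, ?_, hQ⟩
  · rw [← hv, hQ]
    push_cast
    field_simp
  · push_cast
    rw [← hv]
    field_simp

end SumRank

namespace SumRank

/-! ### The bound on the number of bit operations -/

/-- A bound on the cost of a step with operands of at most `β` bits. -/
def stepBound (β : ℕ) : ℕ := gateBound (2 * β + 1) + (10 * β + 10)

theorem gateBound_mono : Monotone gateBound := fun a b h => by
  unfold gateBound
  have := Nat.size_le_size h
  gcongr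

theorem costBound_fastArithmetic : CostBound (BitStep.cost fastArithmetic) stepBound where
  arith o a b β ha hb := by
    have h1 := fastArithmetic_gates_le o a b
    have h2 : gateBound (a + b + 1) ≤ gateBound (2 * β + 1) := gateBound_mono (by omega)
    simp only [BitStep.cost, stepBound]
    omega
  move _ := le_rfl
  le β := by unfold stepBound; omega

/-- For b < 2^L the length L·b has O(L) binary digits, so the fifth power in `gateBound` and the
factor L give L^6. The constant covers 3·10^5·7^5 plus the linear terms. -/
theorem stepBound_le {L b : ℕ} (hL : 1 ≤ L) (hb : 1 ≤ b) (hbL : b < 2 ^ L) :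
    stepBound (L * b) ≤ 10 ^ 10 * L ^ 6 * b := by
  have h1 : 1 ≤ L * b := Nat.mul_pos hL hb
  have h2 : (2 * (L * b) + 1).size ≤ 2 * L + 2 := Nat.size_le.2 <| by
    have h3 : L * b < 2 ^ L * 2 ^ L := Nat.mul_lt_mul'' Nat.lt_two_pow_self hbL
    rw [pow_add, two_mul L, pow_add]
    omega
  have h3 : gateBound (2 * (L * b) + 1) ≤ 3 * (L * b) * (100000 * (7 * L) ^ 5) := by
    unfold gateBound
    gcongr <;> omega
  have h4 : L * b ≤ L ^ 6 * b := Nat.mul_le_mul_right _ (Nat.le_self_pow (by omega) L)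
  have h5 : 3 * (L * b) * (100000 * (7 * L) ^ 5) = 5042100000 * (L ^ 6 * b) := by ring
  unfold stepBound
  rw [mul_assoc]
  omega

/-- Every phase is compared with N; the constants add up to less than 16000. The hypothesis on u is
restricted to b ≤ 5N because `stepBound_le` needs b < 2^L. -/
theorem computeCost_le {n ζ t l μ s L e w : ℕ} (hl : 1 ≤ l) (hμ : 1 ≤ μ) (ht : 1 ≤ t)
    (hs : 1 ≤ s) (hζ : 1 ≤ ζ) (he : 1 ≤ e) (hn : l * μ ≤ n)
    {u : ℕ → ℕ} (hu : ∀ b, 1 ≤ b → b ≤ 5 * (t * s * n ^ 3 * μ * ζ ^ 2 * e) → u (L * b) ≤ w * b) :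
    computeCost u ζ t l μ s L (L * (4 * (ζ * μ * e))) (L * (2 * (ζ ^ 2 * e))) (L * (2 * l))
      (L * (5 * (l * ζ ^ 2 * e))) ≤ 16000 * w * (t * s * n ^ 3 * μ * ζ ^ 2 * e) := by
  have hln : l ≤ n := (Nat.le_mul_of_pos_right _ hμ).trans hn
  have hμn : μ ≤ n := (Nat.le_mul_of_pos_left _ hl).trans hn
  have hn1 : 1 ≤ n := hl.trans hln
  set N := t * s * n ^ 3 * μ * ζ ^ 2 * e with hN
  have hn3 : n ≤ n ^ 3 := Nat.le_self_pow (by omega) n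
  have hl3 : l ^ 3 ≤ n ^ 3 := Nat.pow_le_pow_left hln 3
  have hζ2 : ζ ≤ ζ ^ 2 := Nat.le_self_pow (by omega) ζ
  have hts : 1 ≤ t * s := Nat.mul_pos ht hs
  have b1 : ζ ^ 2 * μ ^ 2 * e ≤ N :=
    calc ζ ^ 2 * μ ^ 2 * e = 1 * μ * μ * ζ ^ 2 * e := by ring
      _ ≤ t * s * n ^ 3 * μ * ζ ^ 2 * e := by gcongr; exact hμn.trans hn3
  have b2 : s * t * ζ ^ 2 * e ≤ N :=
    calc s * t * ζ ^ 2 * e = t * s * 1 * 1 * ζ ^ 2 * e := by ring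
      _ ≤ t * s * n ^ 3 * μ * ζ ^ 2 * e := by gcongr; omega
  have b4 : t * s * l ^ 3 * ζ ^ 2 * e ≤ N :=
    calc t * s * l ^ 3 * ζ ^ 2 * e = t * s * l ^ 3 * 1 * ζ ^ 2 * e := by ring
      _ ≤ t * s * n ^ 3 * μ * ζ ^ 2 * e := by gcongr
  have b3 : l ^ 3 ≤ N :=
    calc l ^ 3 = 1 * l ^ 3 * 1 * 1 := by ring
      _ ≤ t * s * l ^ 3 * ζ ^ 2 * e := by gcongr; exact Nat.one_le_pow _ _ hζ
      _ ≤ N := b4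
  have b5 : t * l * μ * s ≤ N :=
    calc t * l * μ * s = t * s * l * μ * 1 * 1 := by ring
      _ ≤ t * s * n ^ 3 * μ * ζ ^ 2 * e := by
        gcongr
        · exact hln.trans hn3
        · exact Nat.one_le_pow _ _ hζ
  -- The dominant term, from the recursion: t·l·μ·s entries, μ·l iterations, lζ²e bits. Here l³μ =
  -- l²·(lμ) ≤ n³ is the only essential use of lμ ≤ n.
  have b6 : t * s * (l ^ 2 * (l * μ)) * μ * ζ ^ 2 * e ≤ N :=
    calc t * s * (l ^ 2 * (l * μ)) * μ * ζ ^ 2 * e ≤ t * s * (n ^ 2 * n) * μ * ζ ^ 2 * e := by gcongr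
      _ = N := by rw [hN]; ring
  have b7 : l ^ 2 * ζ ^ 2 * e ≤ N :=
    calc l ^ 2 * ζ ^ 2 * e = 1 * l ^ 2 * ζ ^ 2 * e := by ring
      _ ≤ t * s * l ^ 3 * ζ ^ 2 * e := by gcongr; omega
      _ ≤ N := b4
  have b8 : l ^ 2 * ζ * (t * s) * l ≤ N :=
    calc l ^ 2 * ζ * (t * s) * l = t * s * l ^ 3 * ζ * 1 := by ring
      _ ≤ t * s * l ^ 3 * ζ ^ 2 * e := by gcongr
      _ ≤ N := b4
  have hN1 : 1 ≤ N := (Nat.one_le_pow 3 l hl).trans b3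
  have p1 : ζ * μ * e ≤ N :=
    calc ζ * μ * e ≤ ζ ^ 2 * μ ^ 2 * e := by gcongr; exact Nat.le_self_pow (by omega) μ
      _ ≤ N := b1
  have p2 : ζ ^ 2 * e ≤ N :=
    calc ζ ^ 2 * e = 1 * ζ ^ 2 * e := by ring
      _ ≤ l ^ 2 * ζ ^ 2 * e := by gcongr; exact Nat.one_le_pow _ _ hl
      _ ≤ N := b7
  have p3 : l ≤ N := (Nat.le_self_pow (by omega) l).trans b3
  have p4 : l * ζ ^ 2 * e ≤ N :=
    calc l * ζ ^ 2 * e ≤ l ^ 2 * ζ ^ 2 * e := by gcongr; exact Nat.le_self_pow (by omega) l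
      _ ≤ N := b7
  have u1 := hu (4 * (ζ * μ * e)) (Nat.succ_le_of_lt (by positivity)) (by omega)
  have u2 := hu (2 * (ζ ^ 2 * e)) (Nat.succ_le_of_lt (by positivity)) (by omega)
  have u3 := hu (2 * l) (Nat.succ_le_of_lt (by positivity)) (by omega)
  have u4 := hu (5 * (l * ζ ^ 2 * e)) (Nat.succ_le_of_lt (by positivity)) (by omega)
  have u5 : u L ≤ w := by simpa using hu 1 le_rfl (by omega)
  have hζ' : ζ + 1 ≤ 2 * ζ := by omega
  have hμ' : μ + 1 ≤ 2 * μ := by omega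
  have hl' : l + 1 ≤ 2 * l := by omega
  have ht' : t + 1 ≤ 2 * t := by omega
  have hs' : s + 1 ≤ 2 * s := by omega
  have hA' : min ζ s + 1 ≤ 2 * s := by omega
  have hB' : min μ t + 1 ≤ 2 * t := by omega
  have hlζ' : l * ζ + 1 ≤ 2 * (l * ζ) := by
    have : 0 < l * ζ := Nat.mul_pos hl hζ
    omega
  have hl4 : 8 * l + 4 ≤ 12 * l := by omega
  calc computeCost u ζ t l μ s L (L * (4 * (ζ * μ * e))) (L * (2 * (ζ ^ 2 * e))) (L * (2 * l))
        (L * (5 * (l * ζ ^ 2 * e)))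
      ≤ 2 * ζ * (2 * μ * (22 * (w * (4 * (ζ * μ * e))))) +
        2 * s * (2 * t * (40 * (w * (2 * (ζ ^ 2 * e))))) +
        2 * l * (2 * l * (18 * (w * (2 * l)))) +
        l * (2 * t * (2 * s * (2 * (l * ζ) * (2 * l * (26 * w)) +
          2 * l * (3 * (w * (5 * (l * ζ ^ 2 * e))))))) +
        2 * t * (2 * l * (2 * μ * (2 * s * (13 * w)))) +
        2 * μ * (2 * l * (43 * (w * (5 * (l * ζ ^ 2 * e))))) *
          (2 * t * (2 * l * (2 * μ * (2 * s)))) +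
        12 * l * (w * (5 * (l * ζ ^ 2 * e))) + 2 * w := by
        unfold computeCost
        gcongr
    _ = w * (352 * (ζ ^ 2 * μ ^ 2 * e) + 320 * (s * t * ζ ^ 2 * e) + 144 * l ^ 3 +
        416 * (l ^ 2 * ζ * (t * s) * l) + 120 * (t * s * l ^ 3 * ζ ^ 2 * e) +
        208 * (t * l * μ * s) + 13760 * (t * s * (l ^ 2 * (l * μ)) * μ * ζ ^ 2 * e) +
        60 * (l ^ 2 * ζ ^ 2 * e) + 2) := by ring
    _ ≤ w * (16000 * N) := Nat.mul_le_mul_left _ (by omega)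
    _ = 16000 * w * N := by ring

/-- With L = size N + 3 one has 8N < 2^L, which bounds all sums of indices as well as the lengths 5N
admitted in `computeCost_le`. -/
theorem bitOps_compute_le (χ : Coins) {q n ζ t l μ s : ℕ} (hq : 2 ≤ q) (hl : 1 ≤ l) (hμ : 1 ≤ μ)
    (ht : 1 ≤ t) (ha : Admissible ζ t l μ s) (hn : l * μ ≤ n) :
    (compute χ q ζ t l μ s).bitOps fastArithmetic ≤
      16000 * (10 ^ 10 * ((t * s * n ^ 3 * μ * ζ ^ 2 * q.size).size + 3) ^ 6) *
        (t * s * n ^ 3 * μ * ζ ^ 2 * q.size) := by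
  have hs : 1 ≤ s := ht.trans ha.le_s
  have hζ : 1 ≤ ζ := hμ.trans ha.le_cap
  have he : 1 ≤ q.size := Nat.size_pos.2 (by omega)
  have hln : l ≤ n := (Nat.le_mul_of_pos_right _ hμ).trans hn
  have hn1 : 1 ≤ n := hl.trans hln
  set N := t * s * n ^ 3 * μ * ζ ^ 2 * q.size with hN
  have hlt : 8 * N < 2 ^ (N.size + 3) := by
    have := Nat.lt_size_self N
    rw [pow_add]
    omega
  have ht1 : t ≤ N := Nat.le_of_dvd (by positivity) ⟨s * n ^ 3 * μ * ζ ^ 2 * q.size, by rw [hN]; ring⟩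
  have hs1 : s ≤ N := Nat.le_of_dvd (by positivity) ⟨t * n ^ 3 * μ * ζ ^ 2 * q.size, by rw [hN]; ring⟩
  have hnζ : n * ζ ≤ N := Nat.le_of_dvd (by positivity)
    ⟨t * s * n ^ 2 * μ * ζ * q.size, by rw [hN]; ring⟩
  have hlζ : l * ζ ≤ N := (Nat.mul_le_mul_right _ hln).trans hnζ
  have hζ1 : ζ ≤ N := (Nat.le_mul_of_pos_left _ hl).trans hlζ
  have hl1 : l ≤ N := (Nat.le_mul_of_pos_right _ hζ).trans hlζ
  have h := (RSpec.compute costBound_fastArithmetic χ hq hl ha (sizeBounds hq (Nat.lt_size_self q)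
    hl hμ ha.le_cap (L := N.size + 3) (by omega))).2
  refine (Nat.cast_le.1 h).trans (computeCost_le hl hμ ht hs hζ he hn fun b hb hb' => ?_)
  exact stepBound_le (by omega) hb (by omega)

end SumRank

/-! ### From bit lengths to real logarithms. -/

namespace SumRank

open Real in
theorem size_le_logb {x : ℕ} (hx : 1 ≤ x) : (x.size : ℝ) ≤ logb 2 x + 1 := by
  obtain ⟨k, hk⟩ : ∃ k, x.size = k + 1 :=
    ⟨x.size - 1, by have := Nat.size_pos.2 hx; omega⟩
  have h1 : 2 ^ k ≤ x := Nat.lt_size.1 (by omega)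
  have h2 : (k : ℝ) ≤ logb 2 x := by
    rw [le_logb_iff_rpow_le (by norm_num) (by exact_mod_cast hx), rpow_natCast]
    exact_mod_cast h1
  rw [hk]
  push_cast
  linarith

open Real in
theorem quasilinear_bound {n ζ t μ s q b : ℕ} (hq : 2 ≤ q) (ht : 1 ≤ t) (hs : 1 ≤ s)
    (hn : 1 ≤ n) (hμ : 1 ≤ μ) (hζ : 1 ≤ ζ)
    (hb : b ≤ 16000 * (10 ^ 10 * ((t * s * n ^ 3 * μ * ζ ^ 2 * q.size).size + 3) ^ 6) *
        (t * s * n ^ 3 * μ * ζ ^ 2 * q.size)) :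
    (b : ℝ) ≤ 32000 * 10 ^ 10 * 7 ^ 6 * ((t : ℝ) * s * (n : ℝ) ^ 3 * μ * (ζ : ℝ) ^ 2 * logb 2 q) *
      log ((t : ℝ) * s * (n : ℝ) ^ 3 * μ * (ζ : ℝ) ^ 2 * logb 2 q + 2) ^ 6 := by
  have hq1 : 1 ≤ logb 2 q := by
    rw [le_logb_iff_rpow_le (by norm_num) (by positivity), rpow_one]
    exact_mod_cast hq
  set P := t * s * n ^ 3 * μ * ζ ^ 2 with hP
  have hP1 : 1 ≤ P := Nat.succ_le_of_lt (by positivity)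
  have hPR : (t : ℝ) * s * (n : ℝ) ^ 3 * μ * (ζ : ℝ) ^ 2 = (P : ℝ) := by
    rw [hP]
    push_cast
    ring
  rw [hPR]
  set N : ℝ := P * logb 2 q with hN
  have hP1' : (1 : ℝ) ≤ P := by exact_mod_cast hP1
  have hN1 : 1 ≤ N := one_le_mul_of_one_le_of_one_le hP1' hq1
  have hsize : (q.size : ℝ) ≤ 2 * logb 2 q := by linarith [size_le_logb (x := q) (by omega)]
  have hN' : ((P * q.size : ℕ) : ℝ) ≤ 2 * N := by
    rw [hN]
    push_cast
    nlinarith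
  have hPq : 1 ≤ P * q.size := Nat.mul_pos hP1 (Nat.size_pos.2 (by omega))
  -- The shift by 2 makes the logarithm at least 1, since N ≥ 1 and e < 3, so additive constants can
  -- be absorbed into it.
  have hlog1 : 1 ≤ log (N + 2) := by
    rw [le_log_iff_exp_le (by linarith)]
    linarith [exp_one_lt_d9]
  have hlogb : logb 2 ((P * q.size : ℕ) : ℝ) ≤ 2 * log (N + 2) + 1 := by
    calc logb 2 ((P * q.size : ℕ) : ℝ) ≤ logb 2 (2 * N) :=
          logb_le_logb_of_le (by norm_num) (by exact_mod_cast hPq) hN'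
      _ = 1 + logb 2 N := by
          rw [logb_mul (by norm_num) (by linarith), logb_self_eq_one (by norm_num)]
      _ ≤ 1 + 2 * log (N + 2) := by
          have h1 : log N ≤ log (N + 2) := log_le_log (by linarith) (by linarith)
          have h2 : 0 ≤ log (N + 2) := by linarith
          have h3 := log_two_gt_d9
          rw [logb, div_eq_mul_inv]
          have h4 : (log 2)⁻¹ ≤ 2 := by
            rw [inv_le_comm₀ (by linarith) (by norm_num)]
            linarith
          have h5 : 0 ≤ (log 2)⁻¹ := inv_nonneg.2 (by linarith)
          nlinarith
      _ = _ := by ring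
  have hL : (((P * q.size).size + 3 : ℕ) : ℝ) ≤ 7 * log (N + 2) := by
    have := size_le_logb hPq
    push_cast at this hlogb ⊢
    linarith
  have hb' : (b : ℝ) ≤ 16000 * (10 ^ 10 * (((P * q.size).size + 3 : ℕ) : ℝ) ^ 6) *
      ((P * q.size : ℕ) : ℝ) := by exact_mod_cast hb
  calc (b : ℝ) ≤ 16000 * (10 ^ 10 * (7 * log (N + 2)) ^ 6) * (2 * N) := hb'.trans (by gcongr)
    _ = 32000 * 10 ^ 10 * 7 ^ 6 * N * log (N + 2) ^ 6 := by ring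

end SumRank

/-! ### The theorem. -/

theorem mainTheorem8 :
    (∀ (F : Type) [Field F] [Fintype F] (n m l μ ζ t s : ℕ),
      0 < n → 0 < m → 0 < l → l ∣ n → μ = min (n / l) m → μ ≤ ζ →
      t ≤ l * μ → t ≤ s → s ≤ l * ζ →
      ∀ χ χ₀ : SumRank.Coins,
        let out := (SumRank.compute χ (Fintype.card F) ζ t l μ s).val
        out.den ≠ 0 ∧
        (out.numM : ℚ) / (out.den : ℚ) = SumRank.M F χ₀ ζ t l μ s ∧
        (out.numQ : ℚ) / (out.den : ℚ) = SumRank.Q F χ₀ ζ s t l μ ∧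
        SumRank.Q F χ₀ ζ s t l μ = (l.factorial : ℚ) * SumRank.M F χ₀ ζ t l μ s) ∧
    (∃ (A : SumRank.BitArithmetic) (C : ℝ) (k : ℕ),
      ∀ (q n m l μ ζ t s : ℕ), IsPrimePow q →
        0 < n → 0 < m → 0 < l → l ∣ n → μ = min (n / l) m → μ ≤ ζ →
        1 ≤ t → t ≤ l * μ → t ≤ s → s ≤ l * ζ →
        ∀ χ : SumRank.Coins,
          let N : ℝ := (t : ℝ) * s * (n : ℝ) ^ 3 * μ * (ζ : ℝ) ^ 2 * Real.logb 2 q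
          ((SumRank.compute χ q ζ t l μ s).bitOps A : ℝ) ≤ C * N * Real.log (N + 2) ^ k) := by
  have hμ : ∀ n m l μ : ℕ, 0 < n → 0 < m → 0 < l → l ∣ n → μ = min (n / l) m →
      1 ≤ μ ∧ l * μ ≤ n := fun n m l μ hn hm hl hln h =>
    ⟨by rw [h]; exact le_min (Nat.div_pos (Nat.le_of_dvd hn hln) hl) hm,
      (Nat.mul_le_mul_left l (h.le.trans (min_le_left _ _))).trans (Nat.mul_div_le n l)⟩
  refine ⟨fun F _ _ n m l μ ζ t s hn hm hl hln hμe hμζ htl hts hsl χ χ₀ =>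
    SumRank.compute_correct F hl (hμ n m l μ hn hm hl hln hμe).1 ⟨htl, hts, hsl, hμζ⟩ χ χ₀,
    SumRank.fastArithmetic, 32000 * 10 ^ 10 * 7 ^ 6, 6,
    fun q n m l μ ζ t s hq hn hm hl hln hμe hμζ ht htl hts hsl χ => ?_⟩
  obtain ⟨hμ1, hlμ⟩ := hμ n m l μ hn hm hl hln hμe
  exact SumRank.quasilinear_bound hq.two_le ht (ht.trans hts) hn hμ1 (hμ1.trans hμζ)
    (SumRank.bitOps_compute_le χ hq.two_le hl hμ1 ht ⟨htl, hts, hsl, hμζ⟩ hlμ)
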